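/- Let $k$ be a field of characteristic $p>0$ and let $G$ be a finite group. Let $\mathcal K(G)$ be the bounded homotopy category of $p$-permutation $kG$-modules, that is, of direct summands of finitely generated permutation $kG$-modules; it is a tensor triangulated category under $\otimes_k$ with diagonal $G$-action, with unit $\mathbb 1=k$. Let $\mathcal N$ be the finite set of normal subgroups $N\trianglelefteq G$ of index $p$. For $N\in\mathcal N$ choose a generator $\sigma$ of $G/N\cong C_p$, put $\tau=\sigma-1$, let $\epsilon\colon k(G/N)\to k$ be the augmentation, and let $\eta\colon k\to k(G/N)$ be given by $1\mapsto\sum_{x\in G/N}x=\tau^{p-1}$. Let $u_N\in\mathcal K(G)$ be the complex $$u_N=\bigl(0\to k(G/N)\xrightarrow{\ \tau\ }k(G/N)\xrightarrow{\ \epsilon\ }k\to 0\bigr)\ \text{ if } p>2,\qquad u_N=\bigl(0\to k(G/N)\xrightarrow{\ \epsilon\ }k\to 0\bigr)\ \text{ if } p=2,$$ with $k$ in degree $0$. Put $2'=2$ if $p>2$ and $2'=1$ if $p=2$. Let $a_N\colon\mathbb 1\to u_N$ be the identity of $k$ in degree zero, let $b_N\colon\mathbb 1\to u_N[-2']$ be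 $\eta$ in degree zero, and, for $p>2$, let $c_N\colon\mathbb 1\to u_N[-1]$ be $\eta$ in degree zero. For $q\in\mathbb N^{\mathcal N}$ put $\mathbb 1(q)=\bigotimes_{N\in\mathcal N}u_N^{\otimes q(N)}$ (the factors taken in a fixed order), and let $$R^{\bullet\bullet}(G)=\bigoplus_{s\in\mathbb Z}\ \bigoplus_{q\in\mathbb N^{\mathcal N}}\operatorname{Hom}_{\mathcal K(G)}\bigl(\mathbb 1,\mathbb 1(q)[s]\bigr)$$ be the twisted cohomology ring of $G$, with the multiplication induced by the tensor product and the canonical isomorphisms $\mathbb 1(q)[s]\otimes\mathbb 1(q')[s']\cong\mathbb 1(q+q')[s+s']$. Then $R^{\bullet\bullet}(G)$ is generated as a $k$-algebra by the finitely many elements $a_N$ and $b_N$ (and $c_N$ if $p>2$), for $N\in\mathcal N$. In particular, $R^{\bullet\bullet}(G)$ is (left and right) noetherian. -/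

import Mathlib

universe u

section
open CategoryTheory MonoidalCategory Limits Category

section
variable {C : Type*} [Category* C] [MonoidalCategory C] [Preadditive C] [MonoidalPreadditive C]
  [BraidedCategory C]

namespace CategoryTheory.GradedObject.Monoidal
variable (X Y Z : GradedObject ℤ C)

/-- The braiding of graded objects with the Koszul sign `x ⊗ y ↦ (-1)^(ij) y ⊗ x`
for `x`, `y` in degrees `i`, `j`. -/
noncomputable def koszulBraiding [HasTensor X Y] [HasTensor Y X] :
    tensorObj X Y ≅ tensorObj Y X where
  hom k := tensorObjDesc (fun i j hij => (i * j).negOnePow • ((β_ _ _).hom ≫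
    ιTensorObj Y X j i k (by simpa only [add_comm j i] using hij)))
  inv k := tensorObjDesc (fun i j hij => (i * j).negOnePow • ((β_ _ _).inv ≫
    ιTensorObj X Y j i k (by simpa only [add_comm j i] using hij)))
  hom_inv_id := by
    ext k i j hij
    simp [mul_comm j i, smul_smul, Linear.units_smul_comp, Linear.comp_units_smul]
  inv_hom_id := by
    ext k i j hij
    simp [mul_comm j i, smul_smul, Linear.units_smul_comp, Linear.comp_units_smul]

lemma ι_koszulBraiding_hom [HasTensor X Y] [HasTensor Y X] (i j k : ℤ) (h : i + j = k)
    (h' : j + i = k) :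
    ιTensorObj X Y i j k h ≫ (koszulBraiding X Y).hom k =
      (i * j).negOnePow • ((β_ _ _).hom ≫ ιTensorObj Y X j i k h') := by
  simp [koszulBraiding]

lemma ι_koszulBraiding_hom_assoc [HasTensor X Y] [HasTensor Y X] (i j k : ℤ) (h : i + j = k)
    (h' : j + i = k) {W : C} (f : tensorObj Y X k ⟶ W) :
    ιTensorObj X Y i j k h ≫ (koszulBraiding X Y).hom k ≫ f =
      ((i * j).negOnePow • ((β_ _ _).hom ≫ ιTensorObj Y X j i k h')) ≫ f := by
  rw [← assoc, ι_koszulBraiding_hom _ _ _ _ _ h h']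

lemma units_smul_whiskerRight' {A B : C} (z : ℤˣ) (f : A ⟶ B) (D : C) :
    (z • f) ▷ D = z • (f ▷ D) := by
  rcases Int.units_eq_one_or z with rfl | rfl
  · simp
  · rw [Units.neg_smul, Units.neg_smul, one_smul, one_smul]
    exact ((tensoringRight C).obj D).map_neg
lemma whiskerLeft_units_smul' {A B : C} (z : ℤˣ) (f : A ⟶ B) (D : C) :
    D ◁ (z • f) = z • (D ◁ f) := by
  rcases Int.units_eq_one_or z with rfl | rfl
  · simp
  · rw [Units.neg_smul, Units.neg_smul, one_smul, one_smul]
    exact ((tensoringLeft C).obj D).map_neg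

lemma koszul_naturality {X X' Y Y' : GradedObject ℤ C} [HasTensor X Y] [HasTensor Y X]
    [HasTensor X' Y'] [HasTensor Y' X'] (f : X ⟶ X') (g : Y ⟶ Y') :
    tensorHom f g ≫ (koszulBraiding X' Y').hom = (koszulBraiding X Y).hom ≫ tensorHom g f := by
  ext k i j hij
  have hji : j + i = k := by omega
  dsimp
  rw [ι_tensorHom_assoc, ι_koszulBraiding_hom _ _ _ _ _ _ hji,
    ι_koszulBraiding_hom_assoc _ _ _ _ _ _ hji]
  simp [Linear.units_smul_comp, Linear.comp_units_smul]

lemma koszul_hexagon_forward [HasTensor X Y] [HasTensor Y X] [HasTensor Y Z]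
    [HasTensor Z X] [HasTensor X Z]
    [HasTensor (tensorObj X Y) Z] [HasTensor X (tensorObj Y Z)]
    [HasTensor (tensorObj Y Z) X] [HasTensor Y (tensorObj Z X)]
    [HasTensor (tensorObj Y X) Z] [HasTensor Y (tensorObj X Z)]
    [HasGoodTensor₁₂Tensor X Y Z] [HasGoodTensorTensor₂₃ X Y Z]
    [HasGoodTensor₁₂Tensor Y Z X] [HasGoodTensorTensor₂₃ Y Z X]
    [HasGoodTensor₁₂Tensor Y X Z] [HasGoodTensorTensor₂₃ Y X Z] :
    (associator X Y Z).hom ≫ (koszulBraiding X (tensorObj Y Z)).hom ≫ (associator Y Z X).hom =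
      whiskerRight (koszulBraiding X Y).hom Z ≫ (associator Y X Z).hom ≫
        whiskerLeft Y (koszulBraiding X Z).hom := by
  ext k i₁ i₂ i₃ h
  have h1 : (i₂ + i₃) + i₁ = k := by omega
  have h2 : i₂ + i₁ + i₃ = k := by omega
  dsimp
  rw [ιTensorObj₃'_associator_hom_assoc, ιTensorObj₃_eq X Y Z i₁ i₂ i₃ k h _ rfl, assoc,
    ι_koszulBraiding_hom_assoc _ _ _ _ _ _ h1,
    ιTensorObj₃'_eq X Y Z i₁ i₂ i₃ k h _ rfl, assoc, ι_tensorHom_assoc,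
    ← MonoidalCategory.tensorHom_id,
    MonoidalCategory.tensorHom_comp_tensorHom_assoc, id_comp,
    ι_koszulBraiding_hom _ _ _ _ _ _ (add_comm i₂ i₁)]
  simp only [Linear.units_smul_comp, Linear.comp_units_smul, categoryOfGradedObjects_id,
    MonoidalCategory.tensorHom_id, units_smul_whiskerRight', comp_whiskerRight, assoc]
  rw [← ιTensorObj₃'_eq_assoc Y X Z i₂ i₁ i₃ k h2 (i₁ + i₂) (add_comm i₂ i₁),
    ιTensorObj₃'_associator_hom_assoc,
    ιTensorObj₃_eq Y X Z i₂ i₁ i₃ k h2 _ rfl, assoc,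
    ι_tensorHom, categoryOfGradedObjects_id, MonoidalCategory.id_tensorHom,
    ← MonoidalCategory.whiskerLeft_comp_assoc,
    ι_koszulBraiding_hom _ _ _ _ _ _ (add_comm i₃ i₁),
    BraidedCategory.braiding_naturality_right_assoc,
    ← ιTensorObj₃'_eq_assoc Y Z X i₂ i₃ i₁ k h1 _ rfl,
    ιTensorObj₃'_associator_hom,
    ιTensorObj₃_eq Y Z X i₂ i₃ i₁ k h1 (i₁ + i₃) (add_comm _ _)]
  simp only [whiskerLeft_units_smul', MonoidalCategory.whiskerLeft_comp, 
    Linear.units_smul_comp, Linear.comp_units_smul, smul_smul, assoc, ← Int.negOnePow_add,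
    ← mul_add]
  simp
  
lemma koszul_hexagon_reverse [HasTensor X Y] [HasTensor Y Z] [HasTensor Z X]
    [HasTensor Z Y] [HasTensor X Z]
    [HasTensor (tensorObj X Y) Z] [HasTensor X (tensorObj Y Z)]
    [HasTensor Z (tensorObj X Y)] [HasTensor (tensorObj Z X) Y]
    [HasTensor X (tensorObj Z Y)] [HasTensor (tensorObj X Z) Y]
    [HasGoodTensor₁₂Tensor X Y Z] [HasGoodTensorTensor₂₃ X Y Z]
    [HasGoodTensor₁₂Tensor Z X Y] [HasGoodTensorTensor₂₃ Z X Y]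
    [HasGoodTensor₁₂Tensor X Z Y] [HasGoodTensorTensor₂₃ X Z Y] :
    (associator X Y Z).inv ≫ (koszulBraiding (tensorObj X Y) Z).hom ≫ (associator Z X Y).inv =
      whiskerLeft X (koszulBraiding Y Z).hom ≫ (associator X Z Y).inv ≫
        whiskerRight (koszulBraiding X Z).hom Y := by
  ext k i₁ i₂ i₃ h
  have h1 : i₃ + (i₁ + i₂) = k := by omega
  have h2 : i₁ + i₃ + i₂ = k := by omega
  have h3 : i₃ + i₁ + i₂ = k := by omega
  dsimp
  rw [ιTensorObj₃_associator_inv_assoc, ιTensorObj₃'_eq X Y Z i₁ i₂ i₃ k h _ rfl, assoc,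
    ι_koszulBraiding_hom_assoc _ _ _ _ _ _ h1,
    ιTensorObj₃_eq X Y Z i₁ i₂ i₃ k h _ rfl, assoc, ι_tensorHom_assoc,
    ← MonoidalCategory.id_tensorHom,
    MonoidalCategory.tensorHom_comp_tensorHom_assoc, id_comp,
    ι_koszulBraiding_hom _ _ _ _ _ _ (add_comm i₃ i₂)]
  simp only [Linear.units_smul_comp, Linear.comp_units_smul, categoryOfGradedObjects_id,
    MonoidalCategory.id_tensorHom, whiskerLeft_units_smul', MonoidalCategory.whiskerLeft_comp,
    assoc]
  rw [← ιTensorObj₃_eq_assoc X Z Y i₁ i₃ i₂ k h2 (i₂ + i₃) (add_comm i₃ i₂),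
    ιTensorObj₃_associator_inv_assoc,
    ιTensorObj₃'_eq X Z Y i₁ i₃ i₂ k h2 _ rfl, assoc,
    ι_tensorHom, categoryOfGradedObjects_id, MonoidalCategory.tensorHom_id,
    ← MonoidalCategory.comp_whiskerRight_assoc,
    ι_koszulBraiding_hom _ _ _ _ _ _ (add_comm i₃ i₁),
    BraidedCategory.braiding_naturality_left_assoc,
    ← ιTensorObj₃_eq_assoc Z X Y i₃ i₁ i₂ k h3 _ rfl,
    ιTensorObj₃_associator_inv,
    ιTensorObj₃'_eq Z X Y i₃ i₁ i₂ k h3 (i₁ + i₃) (add_comm _ _)]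
  simp only [units_smul_whiskerRight', MonoidalCategory.comp_whiskerRight, 
    Linear.units_smul_comp, Linear.comp_units_smul, smul_smul, assoc, ← Int.negOnePow_add,
    ← add_mul]
  simp [add_comm]

end CategoryTheory.GradedObject.Monoidal
end

namespace HomologicalComplex
variable (C : Type*) [Category* C] [MonoidalCategory C] [Preadditive C] [MonoidalPreadditive C]
  [BraidedCategory C] [HasZeroObject C]
  [∀ (X₁ X₂ : GradedObject ℤ C), GradedObject.HasTensor X₁ X₂]
  [∀ X₁, PreservesColimit (Functor.empty.{0} C) ((curriedTensor C).obj X₁)]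
  [∀ X₂, PreservesColimit (Functor.empty.{0} C) ((curriedTensor C).flip.obj X₂)]
  [∀ (X₁ X₂ X₃ X₄ : GradedObject ℤ C), GradedObject.HasTensor₄ObjExt X₁ X₂ X₃ X₄]
  [∀ (X₁ X₂ X₃ : GradedObject ℤ C), GradedObject.HasGoodTensor₁₂Tensor X₁ X₂ X₃]
  [∀ (X₁ X₂ X₃ : GradedObject ℤ C), GradedObject.HasGoodTensorTensor₂₃ X₁ X₂ X₃]

variable {C}
/-- The degree `i` component of the braiding of complexes. -/
noncomputable def koszulX (K L : CochainComplex C ℤ) (i : ℤ) :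
    (tensorObj K L).X i ≅ (tensorObj L K).X i :=
  (GradedObject.eval i).mapIso (GradedObject.Monoidal.koszulBraiding K.X L.X)

lemma ι_koszulX_hom (K L : CochainComplex C ℤ) (p q i : ℤ) (h : p + q = i) (h' : q + p = i) :
    ιTensorObj K L p q i h ≫ (koszulX K L i).hom =
      (p * q).negOnePow • ((β_ _ _).hom ≫ ιTensorObj L K q p i h') :=
  GradedObject.Monoidal.ι_koszulBraiding_hom K.X L.X p q i h h'

lemma ι_koszulX_hom_assoc (K L : CochainComplex C ℤ) (p q i : ℤ) (h : p + q = i) (h' : q + p = i)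
    {W : C} (f : (tensorObj L K).X i ⟶ W) :
    ιTensorObj K L p q i h ≫ (koszulX K L i).hom ≫ f =
      ((p * q).negOnePow • ((β_ _ _).hom ≫ ιTensorObj L K q p i h')) ≫ f := by
  rw [← assoc, ι_koszulX_hom _ _ _ _ _ h h']

lemma koszul_comm (K L : CochainComplex C ℤ) (i j : ℤ) :
    (koszulX K L i).hom ≫ (tensorObj L K).d i j =
      (tensorObj K L).d i j ≫ (koszulX K L j).hom := by
  by_cases hij : (ComplexShape.up ℤ).Rel i j
  swap
  · rw [shape _ _ _ hij, shape _ _ _ hij, comp_zero, zero_comp]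
  obtain rfl : i + 1 = j := hij
  apply mapBifunctor.hom_ext
  intro p q hpq
  replace hpq : p + q = i := hpq
  have hqp : q + p = i := by omega
  change ιTensorObj K L p q i hpq ≫ _ = ιTensorObj K L p q i hpq ≫ _
  rw [ι_koszulX_hom_assoc _ _ _ _ _ _ hqp]
  rw [mapBifunctor.d_eq, mapBifunctor.d_eq]
  simp only [assoc, Preadditive.comp_add, Preadditive.add_comp, mapBifunctor.ι_D₁,
    mapBifunctor.ι_D₂, mapBifunctor.ι_D₁_assoc, mapBifunctor.ι_D₂_assoc, Linear.units_smul_comp]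
  rw [mapBifunctor.d₁_eq L K (curriedTensor C) (.up ℤ) (i₁ := q) (i₁' := q + 1) rfl p (i + 1)
      (by simp; omega),
    mapBifunctor.d₂_eq L K (curriedTensor C) (.up ℤ) q (i₂ := p) (i₂' := p + 1) rfl (i + 1)
      (by simp; omega),
    mapBifunctor.d₁_eq K L (curriedTensor C) (.up ℤ) (i₁ := p) (i₁' := p + 1) rfl q (i + 1)
      (by simp; omega),
    mapBifunctor.d₂_eq K L (curriedTensor C) (.up ℤ) p (i₂ := q) (i₂' := q + 1) rfl (i + 1)
      (by simp; omega)]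
  simp only [Linear.units_smul_comp, assoc]
  rw [ι_koszulX_hom K L (p + 1) q (i + 1) (by omega) (by omega),
    ι_koszulX_hom K L p (q + 1) (i + 1) (by omega) (by omega)]
  simp only [Linear.comp_units_smul, smul_smul, curriedTensor_map_app,
    curriedTensor_obj_map, BraidedCategory.braiding_naturality_right_assoc,
    BraidedCategory.braiding_naturality_left_assoc]
  refine (add_comm _ _).trans (congrArg₂ (· + ·) (congrArg₂ (· • ·) ?_ rfl)
    (congrArg₂ (· • ·) ?_ rfl))
  · change (p * q).negOnePow * q.negOnePow = 1 * ((p + 1) * q).negOnePow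
    rw [add_mul, one_mul, one_mul, Int.negOnePow_add]
  · change (p * q).negOnePow * 1 = p.negOnePow * (p * (q + 1)).negOnePow
    rw [mul_add, mul_one, mul_one, ← Int.negOnePow_add, add_left_comm, ← two_mul,
      Int.negOnePow_add, Int.negOnePow_two_mul, mul_one]

/-- The braiding `x ⊗ y ↦ (-1)^(|x||y|) y ⊗ x` of cochain complexes. -/
noncomputable def koszulBraiding (K L : CochainComplex C ℤ) : K ⊗ L ≅ L ⊗ K :=
  Hom.isoOfComponents (fun i ↦ koszulX K L i) (fun i j _ => koszul_comm K L i j)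

noncomputable instance braidedCategory : BraidedCategory (CochainComplex C ℤ) where
  braiding K L := koszulBraiding K L
  braiding_naturality_right X Y Z f := by
    ext i
    exact congrFun (GradedObject.Monoidal.koszul_naturality (𝟙 X.X) ((forget _ _).map f)) i
  braiding_naturality_left {X Y} f Z := by
    ext i
    exact congrFun (GradedObject.Monoidal.koszul_naturality ((forget _ _).map f) (𝟙 Z.X)) i
  hexagon_forward X Y Z := by
    ext i
    exact congrFun (GradedObject.Monoidal.koszul_hexagon_forward X.X Y.X Z.X) i
  hexagon_reverse X Y Z := by
    ext i
    exact congrFun (GradedObject.Monoidal.koszul_hexagon_reverse X.X Y.X Z.X) i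
end HomologicalComplex

/-- An `M`-graded monoid object of a monoidal category: objects `X m`, a unit `1 ⟶ X 0` and
associative, unital products `X i ⊗ X j ⟶ X (i + j)`. -/
structure GradedMon (M : Type*) [AddMonoid M] (C : Type*) [Category* C] [MonoidalCategory C] where
  X : M → C
  one : 𝟙_ C ⟶ X 0
  mul (i j : M) : X i ⊗ X j ⟶ X (i + j)
  one_mul (i : M) : one ▷ X i ≫ mul 0 i = (λ_ (X i)).hom ≫ eqToHom (by rw [zero_add])
  mul_one (i : M) : X i ◁ one ≫ mul i 0 = (ρ_ (X i)).hom ≫ eqToHom (by rw [add_zero])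
  mul_assoc (i j l : M) : mul i j ▷ X l ≫ mul (i + j) l ≫ eqToHom (by rw [add_assoc]) =
    (α_ (X i) (X j) (X l)).hom ≫ X i ◁ mul j l ≫ mul i (j + l)

namespace GradedMon
variable {C : Type*} [Category* C] [MonoidalCategory C]

/-- The `n`-th tensor power `u^{⊗ n}`. -/
def tpow (u : C) : ℕ → C
  | 0 => 𝟙_ C
  | n + 1 => tpow u n ⊗ u

/-- The canonical isomorphism `u^{⊗ i} ⊗ u^{⊗ j} ⟶ u^{⊗ (i + j)}`. -/
def tpowMul (u : C) (i : ℕ) : ∀ j : ℕ, tpow u i ⊗ tpow u j ⟶ tpow u (i + j)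
  | 0 => (ρ_ _).hom
  | j + 1 => (α_ _ _ _).inv ≫ tpowMul u i j ▷ u

lemma tpow_eqToHom (u : C) {i j : ℕ} (h : i = j) :
    eqToHom (congrArg (tpow u) h) ▷ u = eqToHom (congrArg (fun n => tpow u (n + 1)) h) := by
  subst h; simp; rfl

lemma one_mul_step {A u D : C} (e : A ⟶ D) :
    (α_ (𝟙_ C) A u).inv ≫ ((λ_ A).hom ≫ e) ▷ u = (λ_ (A ⊗ u)).hom ≫ e ▷ u := by
  simp

lemma mul_assoc_base {A B P : C} (m : A ⊗ B ⟶ P) :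
    m ▷ 𝟙_ C ≫ (ρ_ P).hom ≫ 𝟙 P = (α_ A B (𝟙_ C)).hom ≫ A ◁ (ρ_ B).hom ≫ m := by
  simp

lemma mul_assoc_step {A B D P Q R S u : C} (m : A ⊗ B ⟶ P) (n : P ⊗ D ⟶ R) (e : R ⟶ S)
    (r : B ⊗ D ⟶ Q) (t : A ⊗ Q ⟶ S)
    (h : m ▷ D ≫ n ≫ e = (α_ A B D).hom ≫ A ◁ r ≫ t) :
    m ▷ (D ⊗ u) ≫ ((α_ P D u).inv ≫ n ▷ u) ≫ e ▷ u =
      (α_ A B (D ⊗ u)).hom ≫ A ◁ ((α_ B D u).inv ≫ r ▷ u) ≫ (α_ A Q u).inv ≫ t ▷ u := by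
  have h' := congrArg (fun f => f ▷ u) h
  simp only [comp_whiskerRight] at h'
  have key : m ▷ (D ⊗ u) ≫ (α_ P D u).inv = (α_ _ _ _).inv ≫ (m ▷ D) ▷ u := by simp
  rw [assoc, reassoc_of% key, h']
  simp

lemma tpow_one_mul (u : C) : ∀ i : ℕ, tpowMul u 0 i =
    (λ_ (tpow u i)).hom ≫ eqToHom (congrArg (tpow u) (zero_add i).symm)
  | 0 => unitors_equal.symm.trans (comp_id _).symm
  | i + 1 => by
    rw [tpowMul, tpow_one_mul u i]
    exact (one_mul_step _).trans (congrArg _ (tpow_eqToHom u (zero_add i).symm))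

lemma tpow_mul_assoc (u : C) (i j : ℕ) : ∀ l : ℕ,
    tpowMul u i j ▷ tpow u l ≫ tpowMul u (i + j) l ≫
      eqToHom (congrArg (tpow u) (add_assoc i j l)) =
    (α_ _ _ _).hom ≫ tpow u i ◁ tpowMul u j l ≫ tpowMul u i (j + l)
  | 0 => mul_assoc_base _
  | l + 1 => by
    have e : eqToHom (congrArg (tpow u) (add_assoc i j (l + 1))) =
      eqToHom (congrArg (tpow u) (add_assoc i j l)) ▷ u :=
      (tpow_eqToHom u (add_assoc i j l)).symm
    rw [e]
    exact mul_assoc_step _ _ _ _ _ (tpow_mul_assoc u i j l)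

/-- The tensor powers of `u` as an `ℕ`-graded monoid. -/
@[simps]
def powers (u : C) : GradedMon ℕ C where
  X := tpow u
  one := 𝟙 _
  mul i j := tpowMul u i j
  one_mul i := by
    rw [tpow_one_mul]
    exact (congrArg (· ≫ _) (id_whiskerRight _ _)).trans (id_comp _)
  mul_one i := (congrArg (· ≫ _) (whiskerLeft_id _ _)).trans
    ((id_comp _).trans (comp_id _).symm)
  mul_assoc i j l := tpow_mul_assoc u i j l

lemma mul_cast {M : Type*} [AddMonoid M] (A : GradedMon M C) {i i' j j' : M} (h : i = i')
    (h' : j = j') :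
    A.mul i j ≫ eqToHom (by rw [h, h']) =
      (eqToHom (congrArg A.X h) ⊗ₘ eqToHom (congrArg A.X h')) ≫ A.mul i' j' := by
  subst h h'; simp

/-- Reindexing along a monoid homomorphism. -/
@[simps]
def comap {M N : Type*} [AddMonoid M] [AddMonoid N] (f : M →+ N) (A : GradedMon N C) :
    GradedMon M C where
  X m := A.X (f m)
  one := A.one ≫ eqToHom (by rw [map_zero])
  mul i j := A.mul (f i) (f j) ≫ eqToHom (by rw [map_add])
  one_mul i := by
    have h := A.mul_cast (map_zero f).symm (rfl : f i = f i)
    rw [eqToHom_refl, tensorHom_id] at h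
    rw [comp_whiskerRight, assoc, ← reassoc_of% h, ← assoc, A.one_mul]
    simp
  mul_one i := by
    have h := A.mul_cast (rfl : f i = f i) (map_zero f).symm
    rw [eqToHom_refl, id_tensorHom] at h
    rw [whiskerLeft_comp, assoc, ← reassoc_of% h, ← assoc, A.mul_one]
    simp
  mul_assoc i j l := by
    have h := A.mul_cast (map_add f i j).symm (rfl : f l = f l)
    have h' := A.mul_cast (rfl : f i = f i) (map_add f j l).symm
    rw [eqToHom_refl, tensorHom_id] at h
    rw [eqToHom_refl, id_tensorHom] at h'
    rw [comp_whiskerRight, whiskerLeft_comp]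
    simp only [assoc]
    rw [← reassoc_of% h, ← reassoc_of% h', ← reassoc_of% (A.mul_assoc (f i) (f j) (f l))]
    simp

/-- The unit object in every degree. -/
@[simps]
def unit (M : Type*) [AddMonoid M] : GradedMon M C where
  X _ := 𝟙_ C
  one := 𝟙 _
  mul _ _ := (λ_ _).hom
  one_mul _ := by simp
  mul_one _ := by simp [unitors_equal]
  mul_assoc _ _ _ := by simp [unitors_equal]

lemma eqToHom_tensor {A B A' B' : C} (h : A = A') (h' : B = B') :
    (eqToHom h ⊗ₘ eqToHom h') = eqToHom (by rw [h, h']) := by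
  subst h h'; simp

/-- The degreewise tensor product `A_m ⊗ B_m`; the middle factors of
`(A_i ⊗ B_i) ⊗ (A_j ⊗ B_j)` are exchanged by the braiding. -/
@[simps]
def tensor [BraidedCategory C] {M : Type*} [AddMonoid M] (A B : GradedMon M C) :
    GradedMon M C where
  X m := A.X m ⊗ B.X m
  one := (λ_ (𝟙_ C)).inv ≫ (A.one ⊗ₘ B.one)
  mul i j := tensorμ _ _ _ _ ≫ (A.mul i j ⊗ₘ B.mul i j)
  one_mul i := by
    rw [comp_whiskerRight, assoc, tensorμ_natural_left_assoc, tensorHom_comp_tensorHom,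
      A.one_mul, B.one_mul, ← tensorHom_comp_tensorHom, tensor_left_unitality, assoc, assoc,
      eqToHom_tensor]
  mul_one i := by
    rw [whiskerLeft_comp, assoc, tensorμ_natural_right_assoc, tensorHom_comp_tensorHom,
      A.mul_one, B.mul_one, ← tensorHom_comp_tensorHom, tensor_right_unitality, assoc, assoc,
      eqToHom_tensor]
  mul_assoc i j l := by
    have h := tensor_associativity (A.X i) (B.X i) (A.X j) (B.X j) (A.X l) (B.X l)
    rw [← eqToHom_tensor (congrArg A.X (add_assoc i j l)) (congrArg B.X (add_assoc i j l)),
      comp_whiskerRight, assoc, assoc, tensorμ_natural_left_assoc,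
      tensorHom_comp_tensorHom, tensorHom_comp_tensorHom, A.mul_assoc, B.mul_assoc,
      ← tensorHom_comp_tensorHom, reassoc_of% h,
      ← tensorHom_comp_tensorHom, whiskerLeft_comp]
    simp only [assoc]
    rw [tensorμ_natural_right_assoc]
end GradedMon

namespace TwistedCohomology
open HomologicalComplex

section
variable {k G : Type u} [Field k] [Group G]

/-- Cochain complexes of `kG`-modules. -/
abbrev Cpx (k G : Type u) [Field k] [Group G] := CochainComplex (Rep.{u} k G) ℤ

noncomputable instance : MonoidalCategory (Cpx k G) := inferInstance
noncomputable instance : BraidedCategory (Cpx k G) := inferInstance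
instance (X Y : GradedObject ℤ (Rep.{u} k G)) : GradedObject.HasTensor X Y := inferInstance
instance (X Y : Cpx k G) : HasTensor X Y := inferInstance
instance (X Y : Cpx k G) : HasMapBifunctor X Y (curriedTensor (Rep.{u} k G)) (.up ℤ) :=
  inferInstance
instance (X Y Z : GradedObject ℤ (Rep.{u} k G)) : GradedObject.HasGoodTensor₁₂Tensor X Y Z :=
  inferInstance
instance (X Y Z : GradedObject ℤ (Rep.{u} k G)) : GradedObject.HasGoodTensorTensor₂₃ X Y Z :=
  inferInstance
noncomputable instance : HasShift (Cpx k G) ℤ := inferInstance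
instance (s : ℤ) : (CategoryTheory.shiftFunctor (Cpx k G) s).Additive := inferInstance
instance : MonoidalPreadditive (Rep.{u} k G) := inferInstance

/-- The canonical isomorphism `X[s] ⊗ Y[t] ≅ (X ⊗ Y)[s + t]`. -/
noncomputable def tensorShift (X Y : Cpx k G) (s t : ℤ) :
    X⟦s⟧ ⊗ Y⟦t⟧ ≅ (X ⊗ Y)⟦s + t⟧ :=
  CochainComplex.mapBifunctorShift₂Iso (X⟦s⟧) Y (curriedTensor _) t ≪≫
    (CategoryTheory.shiftFunctor _ t).mapIso
      (CochainComplex.mapBifunctorShift₁Iso X Y (curriedTensor _) s) ≪≫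
    ((shiftFunctorAdd _ s t).app _).symm

/-- The product `1 ≅ 1 ⊗ 1 ⟶ X[s] ⊗ Y[t] ≅ (X ⊗ Y)[s + t]` of `f : 1 ⟶ X[s]` and
`g : 1 ⟶ Y[t]`. -/
noncomputable def cup {X Y : Cpx k G} {s t : ℤ} (f : 𝟙_ (Cpx k G) ⟶ X⟦s⟧)
    (g : 𝟙_ (Cpx k G) ⟶ Y⟦t⟧) : 𝟙_ (Cpx k G) ⟶ (X ⊗ Y)⟦s + t⟧ :=
  (λ_ _).inv ≫ (f ⊗ₘ g) ≫ (tensorShift X Y s t).hom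

/-- The degree zero component of `f : 1 ⟶ X[s]`, as a map `k ⟶ X^s`. -/
noncomputable def el {X : Cpx k G} {s : ℤ} (f : 𝟙_ (Cpx k G) ⟶ X⟦s⟧) :
    𝟙_ (Rep k G) ⟶ X.X s :=
  (singleObjXSelf (.up ℤ) 0 (𝟙_ (Rep k G))).inv ≫ f.f 0 ≫
    (CochainComplex.shiftFunctorObjXIso X s 0 s (by simp)).hom

lemma el_injective {X : Cpx k G} {s : ℤ} {f g : 𝟙_ (Cpx k G) ⟶ X⟦s⟧} (h : el f = el g) :
    f = g := by
  apply HomologicalComplex.from_single_hom_ext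
  exact (cancel_mono _).1 ((cancel_epi _).1 h)

lemma shift_naturality {X Y : Cpx k G} (φ : X ⟶ Y) (s a b : ℤ) (h : b = a + s) :
    (φ⟦s⟧').f a ≫ (CochainComplex.shiftFunctorObjXIso Y s a b h).hom =
      (CochainComplex.shiftFunctorObjXIso X s a b h).hom ≫ φ.f b := by
  subst h
  exact (comp_id _).trans (id_comp _).symm

lemma shift_naturality' {X Y : Cpx k G} (φ : X ⟶ Y) (s a b : ℤ) (h : b = a + s) :
    (CochainComplex.shiftFunctorObjXIso X s a b h).inv ≫ (φ⟦s⟧').f a =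
      φ.f b ≫ (CochainComplex.shiftFunctorObjXIso Y s a b h).inv := by
  subst h
  exact (id_comp _).trans (comp_id _).symm

lemma combine {D : Type*} [Category* D] {A₁ A₂ A₃ A₄ A₅ A₆ A₇ A₈ A₉ A₁₀ : D}
    {i₀ : A₁ ⟶ A₂} {a : A₂ ⟶ A₃} {w : A₁ ⟶ A₄} {i₁ : A₄ ⟶ A₅} {x : A₅ ⟶ A₃}
    {b : A₃ ⟶ A₆} {b' : A₅ ⟶ A₇} {y : A₇ ⟶ A₆} {w' : A₄ ⟶ A₈} {i₂ : A₈ ⟶ A₉} {z : A₉ ⟶ A₇}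
    {d : A₆ ⟶ A₁₀} {e : A₁₀ ⟶ A₉}
    (h₁ : i₀ ≫ a = w ≫ i₁ ≫ x) (h₂ : i₁ ≫ b' = w' ≫ i₂ ≫ z) (h₃ : x ≫ b = b' ≫ y)
    (h₄ : z ≫ y ≫ d ≫ e = 𝟙 _) : i₀ ≫ (a ≫ b ≫ d) ≫ e = w ≫ w' ≫ i₂ := by
  simp only [assoc]
  rw [reassoc_of% h₁, reassoc_of% h₃, reassoc_of% h₂, h₄, comp_id]

lemma el_comp {X Y : Cpx k G} {s : ℤ} (f : 𝟙_ (Cpx k G) ⟶ X⟦s⟧) (φ : X ⟶ Y) :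
    el (f ≫ φ⟦s⟧') = el f ≫ φ.f s := by
  simp only [el, comp_f, assoc]
  rw [shift_naturality]

lemma ι_tensorHom {X Y X' Y' : Cpx k G} (f : X ⟶ X') (g : Y ⟶ Y') (p q n : ℤ) (h : p + q = n) :
    ιTensorObj X Y p q n h ≫ (f ⊗ₘ g).f n = (f.f p ⊗ₘ g.f q) ≫ ιTensorObj X' Y' p q n h := by
  have := ι_mapBifunctorMap f g (curriedTensor (Rep.{u} k G)) (.up ℤ) p q n h
  exact this.trans ((assoc _ _ _).symm.trans (congrArg (· ≫ _) (MonoidalCategory.tensorHom_def _ _).symm))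

lemma leftUnitor_inv_f (X : Cpx k G) (n : ℤ) : (λ_ X).inv.f n =
    (λ_ (X.X n)).inv ≫ (singleObjXSelf (.up ℤ) 0 (𝟙_ (Rep k G))).inv ▷ X.X n ≫
      ιTensorObj (tensorUnit _ _) X 0 n n (zero_add n) :=
  leftUnitor'_inv X n
end

section
variable {k G : Type u} [Field k] [Group G]
lemma shift_add_aux (Z : Cpx k G) (s t : ℤ) :
    (CochainComplex.shiftFunctorObjXIso Z s t (s + t) (by omega)).inv ≫
      (CochainComplex.shiftFunctorObjXIso (Z⟦s⟧) t 0 t (by simp)).inv ≫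
      ((shiftFunctorAdd (Cpx k G) s t).inv.app Z).f 0 ≫
      (CochainComplex.shiftFunctorObjXIso Z (s + t) 0 (s + t) (by simp)).hom = 𝟙 _ := by
  rw [CochainComplex.shiftFunctorAdd_inv_app_f]
  simp only [XIsoOfEq, CochainComplex.shiftFunctorObjXIso, eqToIso.hom, eqToIso.inv]
  erw [eqToHom_trans, eqToHom_trans]
  exact (eqToHom_trans (congrArg Z.X (add_comm s t)) (congrArg Z.X (add_comm t s)))

lemma ι_tensorShift (X Y : Cpx k G) (s t : ℤ) :
    ιTensorObj (X⟦s⟧) (Y⟦t⟧) 0 0 0 rfl ≫ (tensorShift X Y s t).hom.f 0 ≫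
      (CochainComplex.shiftFunctorObjXIso (X ⊗ Y) (s + t) 0 (s + t) (by simp)).hom =
    ((CochainComplex.shiftFunctorObjXIso X s 0 s (by simp)).hom ⊗ₘ
      (CochainComplex.shiftFunctorObjXIso Y t 0 t (by simp)).hom) ≫
        ιTensorObj X Y s t (s + t) rfl := by
  have h1 := CochainComplex.ι_mapBifunctorShift₂Iso_hom_f (X⟦s⟧) Y (curriedTensor _) t 0 0 0 rfl
    t t (by simp) (by simp)
  have h2 := CochainComplex.ι_mapBifunctorShift₁Iso_hom_f X Y (curriedTensor _) s 0 t t (by simp)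
    s (s + t) (by simp) (by omega)
  have h3 := shift_naturality' (CochainComplex.mapBifunctorShift₁Iso X Y (curriedTensor _) s).hom
    t 0 t (by simp)
  have h4 : (CochainComplex.shiftFunctorObjXIso (X ⊗ Y) s t (s + t) (by omega)).inv ≫
      (CochainComplex.shiftFunctorObjXIso ((X ⊗ Y)⟦s⟧) t 0 t (by simp)).inv ≫
      ((shiftFunctorAdd (Cpx k G) s t).inv.app (X ⊗ Y)).f 0 ≫
      (CochainComplex.shiftFunctorObjXIso (X ⊗ Y) (s + t) 0 (s + t) (by simp)).hom = 𝟙 _ := by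
    exact shift_add_aux _ _ _
  rw [zero_mul, Int.negOnePow_zero, one_smul] at h1
  exact (combine h1 h2 h3 h4).trans ((assoc _ _ _).symm.trans
    (congrArg (· ≫ _) (MonoidalCategory.tensorHom_def' _ _).symm))

lemma el_cup {X Y : Cpx k G} {s t : ℤ} (f : 𝟙_ (Cpx k G) ⟶ X⟦s⟧)
    (g : 𝟙_ (Cpx k G) ⟶ Y⟦t⟧) :
    el (cup f g) = (λ_ _).inv ≫ (el f ⊗ₘ el g) ≫ ιTensorObj X Y s t (s + t) rfl := by
  have h : (singleObjXSelf (.up ℤ) 0 (𝟙_ (Rep k G))).inv ≫ (λ_ (𝟙_ (Cpx k G))).inv.f 0 =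
      (λ_ _).inv ≫ ((singleObjXSelf (.up ℤ) 0 (𝟙_ (Rep k G))).inv ⊗ₘ
        (singleObjXSelf (.up ℤ) 0 (𝟙_ (Rep k G))).inv) ≫ 
          ιTensorObj (𝟙_ (Cpx k G)) (𝟙_ (Cpx k G)) 0 0 0 rfl := by
    rw [leftUnitor_inv_f, tensorHom_def', assoc]
    exact (leftUnitor_inv_naturality_assoc _ _)
  simp only [el, cup, comp_f, assoc]
  rw [reassoc_of% h]
  erw [reassoc_of% (ι_tensorHom f g 0 0 0 rfl)]
  rw [ι_tensorShift]
  simp only [tensorHom_comp_tensorHom_assoc]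
end

section
variable {k G : Type u} [Field k] [Group G]

lemma ι_associator (X Y Z : Cpx k G) (p q r n : ℤ) (h : p + q + r = n) :
    ιTensorObj X Y p q (p + q) rfl ▷ Z.X r ≫ ιTensorObj (X ⊗ Y) Z (p + q) r n h ≫
      (α_ X Y Z).hom.f n = (α_ _ _ _).hom ≫ X.X p ◁ ιTensorObj Y Z q r (q + r) rfl ≫
        ιTensorObj X (Y ⊗ Z) p (q + r) n (by omega) := by
  have := GradedObject.Monoidal.ιTensorObj₃'_associator_hom X.X Y.X Z.X p q r n h
  rw [GradedObject.Monoidal.ιTensorObj₃'_eq X.X Y.X Z.X p q r n h _ rfl,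
    GradedObject.Monoidal.ιTensorObj₃_eq X.X Y.X Z.X p q r n h _ rfl, assoc] at this
  exact this

lemma el_eqToHom {M : Type*} (X : M → Cpx k G) {i j : ℤ × M} (h : i = j)
    (f : 𝟙_ (Cpx k G) ⟶ (X i.2)⟦i.1⟧) :
    el (f ≫ eqToHom (congrArg (fun i : ℤ × M => (X i.2)⟦i.1⟧) h)) =
      el f ≫ eqToHom (congrArg (fun i : ℤ × M => (X i.2).X i.1) h) := by
  subst h
  simp

variable {M : Type*} [AddMonoid M] (P : GradedMon M (Cpx k G))

/-- The product `1 ⟶ (P_q ⊗ P_q')[s + t] ⟶ P_{q + q'}[s + t]` of `f : 1 ⟶ P_q[s]` and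
`g : 1 ⟶ P_q'[t]`, where `i = (s, q)` and `j = (t, q')`. -/
noncomputable def chainMul {i j : ℤ × M} (f : 𝟙_ (Cpx k G) ⟶ (P.X i.2)⟦i.1⟧)
    (g : 𝟙_ (Cpx k G) ⟶ (P.X j.2)⟦j.1⟧) : 𝟙_ (Cpx k G) ⟶ (P.X (i + j).2)⟦(i + j).1⟧ :=
  cup f g ≫ (P.mul i.2 j.2)⟦i.1 + j.1⟧'

lemma el_chainMul {i j : ℤ × M} (f : 𝟙_ (Cpx k G) ⟶ (P.X i.2)⟦i.1⟧)
    (g : 𝟙_ (Cpx k G) ⟶ (P.X j.2)⟦j.1⟧) : el (chainMul P f g) =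
      (λ_ _).inv ≫ (el f ⊗ₘ el g) ≫ ιTensorObj _ _ i.1 j.1 (i.1 + j.1) rfl ≫
        (P.mul i.2 j.2).f (i + j).1 :=
  (el_comp _ _).trans (by rw [el_cup]; simp only [assoc])

/-- The unit `1 ⟶ P_0 = P_0[0]`. -/
noncomputable def chainOne : 𝟙_ (Cpx k G) ⟶ (P.X (0 : ℤ × M).2)⟦(0 : ℤ × M).1⟧ :=
  P.one ≫ (shiftFunctorZero (Cpx k G) ℤ).inv.app (P.X 0)

lemma el_chainOne : el (chainOne P) =
    (singleObjXSelf (.up ℤ) 0 (𝟙_ (Rep k G))).inv ≫ P.one.f 0 := by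
  have h : ((shiftFunctorZero (Cpx k G) ℤ).inv.app (P.X 0)).f 0 ≫
      (CochainComplex.shiftFunctorObjXIso (P.X 0) 0 0 0 (by simp)).hom = 𝟙 _ := by
    rw [CochainComplex.shiftFunctorZero_inv_app_f]
    exact eqToHom_trans (X := (P.X 0).X 0) (Y := (P.X 0).X (0 + 0)) (Z := (P.X 0).X 0) rfl rfl
  rw [el, chainOne, comp_f, assoc]
  erw [h]
  exact congrArg (_ ≫ ·) (comp_id (P.one.f 0))

lemma ι_mul_eqToHom {X Y Z Z' : Cpx k G} (m : X ⊗ Y ⟶ Z) (h : Z = Z') {p q n n' : ℤ}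
    (e : p + q = n) (hn : n = n') :
    ιTensorObj X Y p q n e ≫ m.f n ≫ eqToHom (by rw [h, hn] : Z.X n = Z'.X n') =
      ιTensorObj X Y p q n' (e.trans hn) ≫ (m ≫ eqToHom h).f n' := by
  subst h hn
  simp

lemma one_mul_combine {D : Type*} [Category* D] [MonoidalCategory D] {S E X : D} (s : 𝟙_ D ⟶ S)
    (o : S ⟶ E) (b : E ⊗ X ⟶ X) (h : (λ_ X).inv ≫ s ▷ X ≫ o ▷ X ≫ b = 𝟙 X) (f : 𝟙_ D ⟶ X) :
    (λ_ _).inv ≫ ((s ≫ o) ⊗ₘ f) ≫ b = f := by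
  rw [tensorHom_def', comp_whiskerRight]
  simp only [assoc, ← leftUnitor_inv_naturality_assoc, h, comp_id]

lemma mul_one_combine {D : Type*} [Category* D] [MonoidalCategory D] {S E X : D} (s : 𝟙_ D ⟶ S)
    (o : S ⟶ E) (b : X ⊗ E ⟶ X) (h : (ρ_ X).inv ≫ X ◁ s ≫ X ◁ o ≫ b = 𝟙 X) (f : 𝟙_ D ⟶ X) :
    (λ_ _).inv ≫ (f ⊗ₘ (s ≫ o)) ≫ b = f := by
  rw [MonoidalCategory.tensorHom_def, MonoidalCategory.whiskerLeft_comp, unitors_inv_equal]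
  simp only [assoc, ← rightUnitor_inv_naturality_assoc, h, comp_id]

lemma one_mul_aux {A X : Cpx k G} (o : 𝟙_ (Cpx k G) ⟶ A) (m : A ⊗ X ⟶ X)
    (h : o ▷ X ≫ m = (λ_ X).hom) (n : ℤ) (f : 𝟙_ (Rep k G) ⟶ X.X n) :
    (λ_ _).inv ≫ (((singleObjXSelf (.up ℤ) 0 (𝟙_ (Rep k G))).inv ≫ o.f 0) ⊗ₘ f) ≫
      ιTensorObj A X 0 n n (zero_add n) ≫ m.f n = f := by
  have h' := congrArg (fun f => ((λ_ X).inv ≫ f).f n) h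
  simp only [Iso.inv_hom_id, id_f] at h'
  have h1 := ι_tensorHom o (𝟙 X) 0 n n (zero_add n)
  rw [tensorHom_id, id_f, tensorHom_id] at h1
  rw [comp_f, comp_f, leftUnitor_inv_f] at h'
  simp only [assoc] at h'
  erw [reassoc_of% h1] at h'
  exact one_mul_combine _ _ _ h' f

lemma mul_one_aux {A X : Cpx k G} (o : 𝟙_ (Cpx k G) ⟶ A) (m : X ⊗ A ⟶ X)
    (h : X ◁ o ≫ m = (ρ_ X).hom) (n : ℤ) (f : 𝟙_ (Rep k G) ⟶ X.X n) :
    (λ_ _).inv ≫ (f ⊗ₘ ((singleObjXSelf (.up ℤ) 0 (𝟙_ (Rep k G))).inv ≫ o.f 0)) ≫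
      ιTensorObj X A n 0 n (add_zero n) ≫ m.f n = f := by
  have h' := congrArg (fun f => ((ρ_ X).inv ≫ f).f n) h
  simp only [Iso.inv_hom_id, id_f] at h'
  have h1 := ι_tensorHom (𝟙 X) o n 0 n (add_zero n)
  rw [id_tensorHom, id_f, id_tensorHom] at h1
  have h2 : (ρ_ X).inv.f n = (ρ_ (X.X n)).inv ≫
    X.X n ◁ (singleObjXSelf (.up ℤ) 0 (𝟙_ (Rep k G))).inv ≫
      ιTensorObj X (tensorUnit _ _) n 0 n (add_zero n) := rightUnitor'_inv X n
  rw [comp_f, comp_f, h2] at h'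
  simp only [assoc] at h'
  erw [reassoc_of% h1] at h'
  exact mul_one_combine _ _ _ h' f

lemma chain_one_mul (i : ℤ × M) (f : 𝟙_ (Cpx k G) ⟶ (P.X i.2)⟦i.1⟧) :
    chainMul P (chainOne P) f ≫
      eqToHom (congrArg (fun i : ℤ × M => (P.X i.2)⟦i.1⟧) (zero_add i)) = f := by
  apply el_injective
  rw [el_eqToHom P.X (zero_add i), el_chainMul, el_chainOne]
  simp only [assoc]
  refine Eq.trans ?_ (one_mul_aux P.one (P.mul 0 i.2 ≫ eqToHom (by rw [zero_add])) ?_ i.1 (el f))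
  · exact congrArg (fun x => (λ_ _).inv ≫ (_ ⊗ₘ el f) ≫ x)
      (ι_mul_eqToHom (P.mul 0 i.2) (congrArg P.X (zero_add i.2)) rfl (zero_add i.1))
  · rw [← assoc, P.one_mul]
    simp

lemma chain_mul_one (i : ℤ × M) (f : 𝟙_ (Cpx k G) ⟶ (P.X i.2)⟦i.1⟧) :
    chainMul P f (chainOne P) ≫
      eqToHom (congrArg (fun i : ℤ × M => (P.X i.2)⟦i.1⟧) (add_zero i)) = f := by
  apply el_injective
  rw [el_eqToHom P.X (add_zero i), el_chainMul, el_chainOne]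
  simp only [assoc]
  refine Eq.trans ?_ (mul_one_aux P.one (P.mul i.2 0 ≫ eqToHom (by rw [add_zero])) ?_ i.1 (el f))
  · exact congrArg (fun x => (λ_ _).inv ≫ (el f ⊗ₘ _) ≫ x)
      (ι_mul_eqToHom (P.mul i.2 0) (congrArg P.X (add_zero i.2)) rfl (add_zero i.1))
  · rw [← assoc, P.mul_one]
    simp

lemma assoc_combine {D : Type*} [Category* D] [MonoidalCategory D] {A B E F F' W : D}
    (x : 𝟙_ D ⟶ A) (y : 𝟙_ D ⟶ B) (z : 𝟙_ D ⟶ E) (a : A ⊗ B ⟶ F) (b : F ⊗ E ⟶ W)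
    (a' : B ⊗ E ⟶ F') (b' : A ⊗ F' ⟶ W) (h : a ▷ E ≫ b = (α_ _ _ _).hom ≫ A ◁ a' ≫ b') :
    (λ_ _).inv ≫ (((λ_ _).inv ≫ (x ⊗ₘ y) ≫ a) ⊗ₘ z) ≫ b =
      (λ_ _).inv ≫ (x ⊗ₘ ((λ_ _).inv ≫ (y ⊗ₘ z) ≫ a')) ≫ b' := by
  have e1 : (((λ_ (𝟙_ D)).inv ≫ (x ⊗ₘ y) ≫ a) ⊗ₘ z) =
      (λ_ _).inv ▷ _ ≫ ((x ⊗ₘ y) ⊗ₘ z) ≫ a ▷ E := by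
    rw [← tensorHom_id, ← tensorHom_id, tensorHom_comp_tensorHom, tensorHom_comp_tensorHom,
      id_comp, comp_id]
  have e2 : (x ⊗ₘ ((λ_ (𝟙_ D)).inv ≫ (y ⊗ₘ z) ≫ a')) =
      _ ◁ (λ_ _).inv ≫ (x ⊗ₘ (y ⊗ₘ z)) ≫ A ◁ a' := by
    rw [← id_tensorHom, ← id_tensorHom, tensorHom_comp_tensorHom, tensorHom_comp_tensorHom,
      id_comp, comp_id]
  rw [e1, e2]
  simp only [assoc, h, associator_naturality_assoc]
  have e3 : (λ_ (𝟙_ D)).inv ≫ (λ_ (𝟙_ D)).inv ▷ 𝟙_ D ≫ (α_ _ _ _).hom =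
    (λ_ _).inv ≫ _ ◁ (λ_ _).inv := by monoidal
  rw [reassoc_of% e3]

lemma assoc_aux {X Y Z XY YZ W : Cpx k G} (m : X ⊗ Y ⟶ XY) (n : XY ⊗ Z ⟶ W) (m' : Y ⊗ Z ⟶ YZ)
    (n' : X ⊗ YZ ⟶ W) (h : m ▷ Z ≫ n = (α_ X Y Z).hom ≫ X ◁ m' ≫ n') (p q r l : ℤ)
    (hl : p + q + r = l) (x : 𝟙_ _ ⟶ X.X p) (y : 𝟙_ _ ⟶ Y.X q) (z : 𝟙_ _ ⟶ Z.X r) :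
    (λ_ _).inv ≫ (((λ_ _).inv ≫ (x ⊗ₘ y) ≫ ιTensorObj X Y p q (p + q) rfl ≫ m.f (p + q)) ⊗ₘ z) ≫
      ιTensorObj XY Z (p + q) r l hl ≫ n.f l =
    (λ_ _).inv ≫ (x ⊗ₘ ((λ_ _).inv ≫ (y ⊗ₘ z) ≫ ιTensorObj Y Z q r (q + r) rfl ≫ m'.f (q + r))) ≫
      ιTensorObj X YZ p (q + r) l (by omega) ≫ n'.f l := by
  apply assoc_combine
  have h' := congrArg (fun f => f.f l) h
  simp only [comp_f] at h'
  have h1 := ι_tensorHom m (𝟙 Z) (p + q) r l hl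
  have h2 := ι_tensorHom (𝟙 X) m' p (q + r) l (by omega)
  rw [tensorHom_id, id_f, tensorHom_id] at h1
  rw [id_tensorHom, id_f, id_tensorHom] at h2
  have h3 := ι_associator X Y Z p q r l hl
  rw [comp_whiskerRight, MonoidalCategory.whiskerLeft_comp, assoc, assoc]
  erw [← reassoc_of% h1, h', reassoc_of% h3, reassoc_of% h2]

lemma chain_mul_assoc {i j l : ℤ × M} (f : 𝟙_ (Cpx k G) ⟶ (P.X i.2)⟦i.1⟧)
    (g : 𝟙_ (Cpx k G) ⟶ (P.X j.2)⟦j.1⟧) (h : 𝟙_ (Cpx k G) ⟶ (P.X l.2)⟦l.1⟧) :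
    chainMul P (chainMul P f g) h ≫
      eqToHom (congrArg (fun i : ℤ × M => (P.X i.2)⟦i.1⟧) (add_assoc i j l)) =
    chainMul P f (chainMul P g h) := by
  apply el_injective
  rw [el_eqToHom P.X (add_assoc i j l), el_chainMul, el_chainMul, el_chainMul, el_chainMul]
  simp only [assoc]
  refine Eq.trans ?_ (assoc_aux (P.mul i.2 j.2)
    (P.mul (i.2 + j.2) l.2 ≫ eqToHom (by rw [add_assoc])) (P.mul j.2 l.2)
    (P.mul i.2 (j.2 + l.2)) (P.mul_assoc i.2 j.2 l.2) i.1 j.1 l.1 (i.1 + (j.1 + l.1))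
    (add_assoc _ _ _) (el f) (el g) (el h))
  exact congrArg (fun x => (λ_ _).inv ≫ (_ ⊗ₘ el h) ≫ x)
      (ι_mul_eqToHom (P.mul (i.2 + j.2) l.2) (congrArg P.X (add_assoc i.2 j.2 l.2)) rfl
        (add_assoc i.1 j.1 l.1))
end

section
variable {k G : Type u} [Field k] [Group G]

lemma el_add {X : Cpx k G} {s : ℤ} (f g : 𝟙_ (Cpx k G) ⟶ X⟦s⟧) : el (f + g) = el f + el g :=
  (congrArg (_ ≫ ·) (Preadditive.add_comp _ _ _ (f.f 0) (g.f 0) _)).trans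
    (Preadditive.comp_add _ _ _ _ _ _)

lemma el_smul {X : Cpx k G} {s : ℤ} (a : k) (f : 𝟙_ (Cpx k G) ⟶ X⟦s⟧) : el (a • f) = a • el f :=
  (congrArg (_ ≫ ·) (Linear.smul_comp _ _ _ a (f.f 0) _)).trans (Linear.comp_smul _ _ _ _ _ _)

variable {M : Type*} [AddMonoid M] (P : GradedMon M (Cpx k G)) {i j l : ℤ × M}

lemma chain_add_mul (f f' : 𝟙_ (Cpx k G) ⟶ (P.X i.2)⟦i.1⟧)
    (g : 𝟙_ (Cpx k G) ⟶ (P.X j.2)⟦j.1⟧) :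
    chainMul P (f + f') g = chainMul P f g + chainMul P f' g := by
  apply el_injective
  rw [el_add, el_chainMul, el_chainMul, el_chainMul, el_add, MonoidalPreadditive.add_tensor,
    Preadditive.add_comp, Preadditive.comp_add]

lemma chain_mul_add (f : 𝟙_ (Cpx k G) ⟶ (P.X i.2)⟦i.1⟧)
    (g g' : 𝟙_ (Cpx k G) ⟶ (P.X j.2)⟦j.1⟧) :
    chainMul P f (g + g') = chainMul P f g + chainMul P f g' := by
  apply el_injective
  rw [el_add, el_chainMul, el_chainMul, el_chainMul, el_add, MonoidalPreadditive.tensor_add,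
    Preadditive.add_comp, Preadditive.comp_add]

lemma chain_smul_mul (a : k) (f : 𝟙_ (Cpx k G) ⟶ (P.X i.2)⟦i.1⟧)
    (g : 𝟙_ (Cpx k G) ⟶ (P.X j.2)⟦j.1⟧) :
    chainMul P (a • f) g = a • chainMul P f g := by
  apply el_injective
  rw [el_smul, el_chainMul, el_chainMul, el_smul, tensorHom_def', MonoidalLinear.smul_whiskerRight,
    tensorHom_def']
  simp only [Linear.comp_smul, Linear.smul_comp]

lemma chain_mul_smul (a : k) (f : 𝟙_ (Cpx k G) ⟶ (P.X i.2)⟦i.1⟧)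
    (g : 𝟙_ (Cpx k G) ⟶ (P.X j.2)⟦j.1⟧) :
    chainMul P f (a • g) = a • chainMul P f g := by
  apply el_injective
  rw [el_smul, el_chainMul, el_chainMul, el_smul, tensorHom_def', MonoidalLinear.whiskerLeft_smul,
    tensorHom_def']
  simp only [Linear.comp_smul, Linear.smul_comp]

/-- The product is compatible with chain homotopies. -/
noncomputable def chainMulHomotopy {f f' : 𝟙_ (Cpx k G) ⟶ (P.X i.2)⟦i.1⟧}
    {g g' : 𝟙_ (Cpx k G) ⟶ (P.X j.2)⟦j.1⟧} (hf : Homotopy f f') (hg : Homotopy g g') :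
    Homotopy (chainMul P f g) (chainMul P f' g') := by
  have h1 : Homotopy (f ⊗ₘ g) (f' ⊗ₘ g) :=
    mapBifunctorMapHomotopy₁ hf g (curriedTensor (Rep.{u} k G)) (.up ℤ)
  have h2 : Homotopy (f' ⊗ₘ g) (f' ⊗ₘ g') :=
    mapBifunctorMapHomotopy₂ f' hg (curriedTensor (Rep.{u} k G)) (.up ℤ)
  exact (((h1.trans h2).compRight _).compLeft _).compRight _

variable (k G) in
/-- The homotopy category of complexes of `kG`-modules. -/
abbrev HoCat := HomotopyCategory (Rep.{u} k G) (.up ℤ)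

variable (k G) in
/-- The functor from complexes to the homotopy category. -/
noncomputable abbrev Q : Cpx k G ⥤ HoCat k G := HomotopyCategory.quotient (Rep.{u} k G) (.up ℤ)

/-- The product of homotopy classes, computed on representatives. -/
noncomputable def homMul (x : (Q k G).obj (𝟙_ _) ⟶ (Q k G).obj ((P.X i.2)⟦i.1⟧))
    (y : (Q k G).obj (𝟙_ _) ⟶ (Q k G).obj ((P.X j.2)⟦j.1⟧)) :
    (Q k G).obj (𝟙_ _) ⟶ (Q k G).obj ((P.X (i + j).2)⟦(i + j).1⟧) :=
  (Q k G).map (chainMul P ((Q k G).preimage x) ((Q k G).preimage y))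

lemma homMul_map (f : 𝟙_ (Cpx k G) ⟶ (P.X i.2)⟦i.1⟧) (g : 𝟙_ (Cpx k G) ⟶ (P.X j.2)⟦j.1⟧) :
    homMul P ((Q k G).map f) ((Q k G).map g) = (Q k G).map (chainMul P f g) :=
  HomotopyCategory.eq_of_homotopy _ _ (chainMulHomotopy P
    (HomotopyCategory.homotopyOfEq _ _ ((Q k G).map_preimage _))
    (HomotopyCategory.homotopyOfEq _ _ ((Q k G).map_preimage _)))
end

section
variable {k G : Type u} [Field k] [Group G]

/-- The map `k[S] ⟶ V` with `s ↦ v s`, for an equivariant map `v`. -/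
noncomputable def permLift {S : Type u} [MulAction G S] {V : Rep.{u} k G} (v : S → V.V)
    (hv : ∀ (g : G) (s : S), v (g • s) = V.ρ g (v s)) : Rep.ofMulAction k G S ⟶ V :=
  Rep.ofHom ⟨(MonoidAlgebra.basis S k).constr k v, fun g => (MonoidAlgebra.basis S k).ext fun s => by
    have h (t : S) : (MonoidAlgebra.basis S k).constr k v (MonoidAlgebra.single t 1) = v t :=
      (MonoidAlgebra.basis S k).constr_basis k v t
    simp [h, hv]⟩

@[simp]
lemma permLift_single {S : Type u} [MulAction G S] {V : Rep.{u} k G} (v : S → V.V)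
    (hv : ∀ (g : G) (s : S), v (g • s) = V.ρ g (v s)) (s : S) :
    (permLift v hv).hom (MonoidAlgebra.single s 1) = v s :=
  (MonoidAlgebra.basis S k).constr_basis k v s

lemma perm_hom_ext {S : Type u} [MulAction G S] {V : Rep.{u} k G}
    {f g : Rep.ofMulAction k G S ⟶ V}
    (h : ∀ s, f.hom (MonoidAlgebra.single s 1) = g.hom (MonoidAlgebra.single s 1)) : f = g := by
  apply Rep.hom_ext
  apply Representation.IntertwiningMap.toLinearMap_injective
  exact (MonoidAlgebra.basis S k).ext h

/-- `V` is a `p`-permutation module: a direct summand of a finitely generated permutation module. -/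
def IsPermSummand (V : Rep.{u} k G) : Prop :=
  ∃ (S : Type u) (_ : MulAction G S), Finite S ∧ Nonempty (Retract V (Rep.ofMulAction k G S))

lemma IsPermSummand.of_retract {V W : Rep.{u} k G} (h : IsPermSummand W) (r : Retract V W) :
    IsPermSummand V := by
  obtain ⟨S, hS, hf, ⟨r'⟩⟩ := h
  exact ⟨S, hS, hf, ⟨r.trans r'⟩⟩

lemma isPermSummand_perm (S : Type u) [MulAction G S] [Finite S] :
    IsPermSummand (Rep.ofMulAction k G S) := ⟨S, _, ‹_›, ⟨Retract.refl _⟩⟩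

lemma isPermSummand_unit : IsPermSummand (𝟙_ (Rep.{u} k G)) := by
  let _ : MulAction G PUnit.{u + 1} := { smul := fun _ x => x, one_smul := fun _ => rfl, mul_smul := fun _ _ _ => rfl }
  exact (isPermSummand_perm PUnit.{u + 1}).of_retract
    (Retract.ofIso (Rep.mkIso (.symm (.mk ((MonoidAlgebra.basis PUnit.{u + 1} k).equiv (.singleton PUnit.{u + 1} k)
      (Equiv.refl _)) fun g => (MonoidAlgebra.basis _ k).ext fun s => by simp))))

/-- `k[S × T] ≅ k[S] ⊗ k[T]`. -/
noncomputable def permTensorIso (S T : Type u) [MulAction G S] [MulAction G T] :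
    Rep.ofMulAction k G (S × T) ≅ Rep.ofMulAction k G S ⊗ Rep.ofMulAction k G T :=
  Rep.mkIso (.mk ((MonoidAlgebra.basis (S × T) k).equiv
    ((MonoidAlgebra.basis S k).tensorProduct (MonoidAlgebra.basis T k)) (Equiv.refl _))
    fun g => (MonoidAlgebra.basis (S × T) k).ext fun s => by
      have h (t : S × T) := (MonoidAlgebra.basis (S × T) k).equiv_apply t
        ((MonoidAlgebra.basis S k).tensorProduct (MonoidAlgebra.basis T k)) (Equiv.refl _)
      simp only [MonoidAlgebra.basis_apply] at h
      obtain ⟨s, t⟩ := s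
      simp [h])

lemma IsPermSummand.tensor {V W : Rep.{u} k G} (hV : IsPermSummand V) (hW : IsPermSummand W) :
    IsPermSummand (V ⊗ W) := by
  obtain ⟨S, hS, hf, ⟨r⟩⟩ := hV
  obtain ⟨T, hT, hg, ⟨r'⟩⟩ := hW
  refine ⟨S × T, inferInstance, inferInstance, ⟨⟨(r.i ⊗ₘ r'.i) ≫ (permTensorIso S T).inv,
    (permTensorIso S T).hom ≫ (r.r ⊗ₘ r'.r), ?_⟩⟩⟩
  rw [assoc, Iso.inv_hom_id_assoc, tensorHom_comp_tensorHom, r.retract, r'.retract, id_tensorHom_id]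

lemma IsPermSummand.of_sum {V : Rep.{u} k G} {ι : Type} [Fintype ι] (A : ι → Rep.{u} k G)
    (hA : ∀ i, IsPermSummand (A i)) (a : ∀ i, V ⟶ A i) (b : ∀ i, A i ⟶ V)
    (h : ∑ i, a i ≫ b i = 𝟙 V) : IsPermSummand V := by
  classical
  choose S hS hf r using hA
  let r' i := (r i).some
  let j (i : ι) : Rep.ofMulAction k G (S i) ⟶ Rep.ofMulAction k G (Σ i, S i) :=
    permLift (fun s => MonoidAlgebra.single ⟨i, s⟩ 1) (fun g s => by simp)
  let q (i : ι) : Rep.ofMulAction k G (Σ i, S i) ⟶ Rep.ofMulAction k G (S i) :=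
    permLift (fun s => if e : s.1 = i then MonoidAlgebra.single (e ▸ s.2) 1 else 0) (by
      rintro g ⟨l, s⟩
      by_cases e : l = i
      · subst e; simp
      · simp [e])
  have hj i : j i ≫ q i = 𝟙 _ := perm_hom_ext fun s =>
    (congrArg (q i).hom (permLift_single _ _ s)).trans ((permLift_single _ _ _).trans (by simp))
  have hj' i l (e : i ≠ l) : j i ≫ q l = 0 := perm_hom_ext fun s =>
    (congrArg (q l).hom (permLift_single _ _ s)).trans ((permLift_single _ _ _).trans (by simp [e]))
  refine ⟨Σ i, S i, inferInstance, inferInstance, ⟨⟨∑ i, a i ≫ (r' i).i ≫ j i,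
    ∑ i, q i ≫ (r' i).r ≫ b i, ?_⟩⟩⟩
  rw [Preadditive.sum_comp, ← h]
  refine Finset.sum_congr rfl fun i _ => ?_
  rw [Preadditive.comp_sum, Finset.sum_eq_single i]
  · simp only [assoc]
    rw [reassoc_of% (hj i), reassoc_of% (r' i).retract]
  · intro l _ e
    simp only [assoc]
    rw [reassoc_of% (hj' i l e.symm)]
    simp
  · simp

/-- Bounded complexes of direct summands of finitely generated permutation modules. -/
def IsPermComplex (X : Cpx k G) : Prop :=
  (∀ n, IsPermSummand (X.X n)) ∧ ∃ N : ℤ, ∀ n, N < |n| → IsZero (X.X n)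

lemma IsPermComplex.shift {X : Cpx k G} (h : IsPermComplex X) (s : ℤ) : IsPermComplex (X⟦s⟧) := by
  obtain ⟨h1, N, hN⟩ := h
  refine ⟨fun n => h1 (n + s), N + |s|, fun n hn => hN (n + s) ?_⟩
  have h2 := abs_sub (n + s) s
  rw [add_sub_cancel_right] at h2
  linarith

lemma isPermSummand_of_isZero {V : Rep.{u} k G} (h : IsZero V) : IsPermSummand V :=
  .of_sum (ι := Empty) nofun nofun nofun nofun (h.eq_of_src _ _)

lemma isPermComplex_unit : IsPermComplex (𝟙_ (Cpx k G)) := by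
  have h (n : ℤ) (hn : n ≠ 0) : IsZero ((𝟙_ (Cpx k G)).X n) :=
    HomologicalComplex.isZero_single_obj_X (.up ℤ) 0 (𝟙_ (Rep.{u} k G)) n hn
  refine ⟨fun n => ?_, 0, fun n hn => h n (abs_pos.1 hn)⟩
  by_cases hn : n = 0
  · subst hn
    exact isPermSummand_unit.of_retract
      (Retract.ofIso (singleObjXSelf (.up ℤ) 0 (𝟙_ (Rep.{u} k G))))
  · exact isPermSummand_of_isZero (h n hn)

lemma isZero_tensor_left {V W : Rep.{u} k G} (h : IsZero V) : IsZero (V ⊗ W) := by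
  rw [IsZero.iff_id_eq_zero] at h ⊢
  rw [← id_tensorHom_id, h, MonoidalPreadditive.zero_tensor]

lemma isZero_tensor_right {V W : Rep.{u} k G} (h : IsZero W) : IsZero (V ⊗ W) := by
  rw [IsZero.iff_id_eq_zero] at h ⊢
  rw [← id_tensorHom_id, h, MonoidalPreadditive.tensor_zero]

/-- Projection of `(X ⊗ Y)^n` onto the summand `X^p ⊗ Y^(n-p)`. -/
noncomputable def tensorProj (X Y : Cpx k G) (n p : ℤ) : (X ⊗ Y).X n ⟶ X.X p ⊗ Y.X (n - p) :=
  mapBifunctorDesc (F := curriedTensor (Rep.{u} k G)) (c := .up ℤ) (fun p' q' h => if e : p' = p then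
    eqToHom (by
      replace h : p' + q' = n := h
      obtain rfl : q' = n - p := by omega
      rw [e]; rfl) else 0)

lemma ι_tensorProj_self (X Y : Cpx k G) (n p q : ℤ) (h : p + q = n) :
    ιTensorObj X Y p q n h ≫ tensorProj X Y n p = eqToHom (by rw [← h, add_sub_cancel_left]) :=
  (ι_mapBifunctorDesc _ _ _ _).trans (dif_pos rfl)

lemma ι_tensorProj_ne (X Y : Cpx k G) (n p q p' : ℤ) (h : p + q = n) (hp : p ≠ p') :
    ιTensorObj X Y p q n h ≫ tensorProj X Y n p' = 0 :=
  (ι_mapBifunctorDesc _ _ _ _).trans (dif_neg hp)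

lemma eqToHom_ι (X Y : Cpx k G) (n p q q' : ℤ) (h : p + q = n) (e : q = q') :
    eqToHom (by rw [e]) ≫ ιTensorObj X Y p q' n (by rw [← e, h]) = ιTensorObj X Y p q n h := by
  subst e
  simp

lemma tensor_hom_ext {X Y : Cpx k G} {n : ℤ} {V : Rep.{u} k G} {f g : (X ⊗ Y).X n ⟶ V}
    (h : ∀ p q e, ιTensorObj X Y p q n e ≫ f = ιTensorObj X Y p q n e ≫ g) : f = g :=
  mapBifunctor.hom_ext (K₁ := X) (K₂ := Y) (F := curriedTensor (Rep.{u} k G)) (c := .up ℤ) h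

lemma IsPermComplex.tensor {X Y : Cpx k G} (hX : IsPermComplex X) (hY : IsPermComplex Y) :
    IsPermComplex (X ⊗ Y) := by
  classical
  obtain ⟨h1, N, hN⟩ := hX
  obtain ⟨h1', N', hN'⟩ := hY
  refine ⟨fun n => ?_, N + N', fun n hn => ?_⟩
  · refine .of_sum (ι := Finset.Icc (-N) N) (fun p => X.X p ⊗ Y.X (n - p))
      (fun p => (h1 _).tensor (h1' _)) (fun p => tensorProj X Y n p)
      (fun p => ιTensorObj X Y p (n - p) n (by omega)) (tensor_hom_ext fun p q e => ?_)
    by_cases hp : N < |p|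
    · exact (isZero_tensor_left (hN p hp)).eq_of_src _ _
    · rw [Preadditive.comp_sum, Finset.sum_eq_single ⟨p, Finset.mem_Icc.2 (abs_le.1 (not_lt.1 hp))⟩]
      · rw [← assoc, ι_tensorProj_self]
        exact (eqToHom_ι X Y n p q (n - p) e (by omega)).trans (comp_id _).symm
      · intro p' _ h
        rw [← assoc, ι_tensorProj_ne _ _ _ _ _ _ _ (fun h' => h (Subtype.ext h'.symm)), zero_comp]
      · simp
  · rw [IsZero.iff_id_eq_zero]
    refine tensor_hom_ext fun p q h => ?_
    suffices IsZero (X.X p ⊗ Y.X q) from this.eq_of_src _ _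
    by_cases hp : N < |p|
    · exact isZero_tensor_left (hN p hp)
    · refine isZero_tensor_right (hN' q ?_)
      have := abs_add_le p q
      rw [h] at this
      linarith

lemma IsPermComplex.tpow {X : Cpx k G} (hX : IsPermComplex X) :
    ∀ n, IsPermComplex (GradedMon.tpow X n)
  | 0 => isPermComplex_unit
  | n + 1 => (hX.tpow n).tensor hX
end

section
variable {k G : Type u} [Field k] [Group G]

variable (k G) in
/-- `K(G)`, the bounded homotopy category of `p`-permutation modules: the full subcategory of the
homotopy category of `kG`-modules on the bounded complexes of `p`-permutation modules. -/
abbrev KG := ObjectProperty.FullSubcategory (fun Z : HoCat k G => IsPermComplex Z.as)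

/-- A bounded complex of `p`-permutation modules, as an object of `K(G)`. -/
noncomputable abbrev KG.of (X : Cpx k G) (h : IsPermComplex X) : KG k G := ⟨(Q k G).obj X, h⟩

/-- A chain map, as a morphism of `K(G)`. -/
noncomputable def KG.map {X Y : Cpx k G} {hX : IsPermComplex X} {hY : IsPermComplex Y} (f : X ⟶ Y) :
    KG.of X hX ⟶ KG.of Y hY := ObjectProperty.homMk ((Q k G).map f)

lemma KG.map_surjective {X Y : Cpx k G} {hX : IsPermComplex X} {hY : IsPermComplex Y}
    (x : KG.of X hX ⟶ KG.of Y hY) : ∃ f : X ⟶ Y, KG.map f = x :=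
  ⟨(Q k G).preimage x.hom, ObjectProperty.hom_ext _ ((Q k G).map_preimage x.hom)⟩

variable {M : Type*} [AddMonoid M] (P : GradedMon M (Cpx k G)) (hP : ∀ q, IsPermComplex (P.X q))

/-- `Hom_{K(G)}(1, P_q[s])` for `i = (s, q)`. -/
abbrev TwHom (i : ℤ × M) :=
  KG.of (𝟙_ (Cpx k G)) isPermComplex_unit ⟶ KG.of ((P.X i.2)⟦i.1⟧) ((hP i.2).shift i.1)

variable {P hP} {i j l : ℤ × M}

namespace TwHom
/-- The class of a chain map. -/
noncomputable def cls (f : 𝟙_ (Cpx k G) ⟶ (P.X i.2)⟦i.1⟧) : TwHom P hP i := KG.map f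

lemma cls_surjective (x : TwHom P hP i) : ∃ f : 𝟙_ (Cpx k G) ⟶ (P.X i.2)⟦i.1⟧, cls f = x :=
  KG.map_surjective x

lemma cls_add (f g : 𝟙_ (Cpx k G) ⟶ (P.X i.2)⟦i.1⟧) :
    (cls (f + g) : TwHom P hP i) = cls f + cls g :=
  ObjectProperty.hom_ext _ ((Q k G).map_add)

lemma cls_smul (a : k) (f : 𝟙_ (Cpx k G) ⟶ (P.X i.2)⟦i.1⟧) :
    (cls (a • f) : TwHom P hP i) = a • cls f :=
  ObjectProperty.hom_ext _ ((Q k G).map_smul a f)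

/-- The product `Hom(1, P_q[s]) × Hom(1, P_q'[t]) → Hom(1, P_{q+q'}[s+t])`. -/
noncomputable def mul (x : TwHom P hP i) (y : TwHom P hP j) : TwHom P hP (i + j) :=
  ObjectProperty.homMk (homMul P x.hom y.hom)

lemma mul_cls (f : 𝟙_ (Cpx k G) ⟶ (P.X i.2)⟦i.1⟧) (g : 𝟙_ (Cpx k G) ⟶ (P.X j.2)⟦j.1⟧) :
    mul (cls f : TwHom P hP i) (cls g : TwHom P hP j) = cls (chainMul P f g) :=
  ObjectProperty.hom_ext _ (homMul_map P f g)

lemma add_mul (x x' : TwHom P hP i) (y : TwHom P hP j) : mul (x + x') y = mul x y + mul x' y := by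
  obtain ⟨f, rfl⟩ := cls_surjective x
  obtain ⟨f', rfl⟩ := cls_surjective x'
  obtain ⟨g, rfl⟩ := cls_surjective y
  rw [← cls_add, mul_cls, mul_cls, mul_cls, chain_add_mul, cls_add]

lemma mul_add (x : TwHom P hP i) (y y' : TwHom P hP j) : mul x (y + y') = mul x y + mul x y' := by
  obtain ⟨f, rfl⟩ := cls_surjective x
  obtain ⟨g, rfl⟩ := cls_surjective y
  obtain ⟨g', rfl⟩ := cls_surjective y'
  rw [← cls_add, mul_cls, mul_cls, mul_cls, chain_mul_add, cls_add]

lemma smul_mul (a : k) (x : TwHom P hP i) (y : TwHom P hP j) : mul (a • x) y = a • mul x y := by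
  obtain ⟨f, rfl⟩ := cls_surjective x
  obtain ⟨g, rfl⟩ := cls_surjective y
  rw [← cls_smul, mul_cls, mul_cls, chain_smul_mul, cls_smul]

lemma mul_smul (a : k) (x : TwHom P hP i) (y : TwHom P hP j) : mul x (a • y) = a • mul x y := by
  obtain ⟨f, rfl⟩ := cls_surjective x
  obtain ⟨g, rfl⟩ := cls_surjective y
  rw [← cls_smul, mul_cls, mul_cls, chain_mul_smul, cls_smul]

lemma mk_eq (h : i = j) (f : 𝟙_ (Cpx k G) ⟶ (P.X i.2)⟦i.1⟧) (g : 𝟙_ (Cpx k G) ⟶ (P.X j.2)⟦j.1⟧)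
    (e : f ≫ eqToHom (congrArg (fun i : ℤ × M => (P.X i.2)⟦i.1⟧) h) = g) :
    GradedMonoid.mk (A := TwHom P hP) i (cls f) = GradedMonoid.mk j (cls g) := by
  subst h e
  rw [eqToHom_refl, comp_id]

noncomputable instance : GradedMonoid.GOne (TwHom P hP) := ⟨cls (chainOne P)⟩
noncomputable instance : GradedMonoid.GMul (TwHom P hP) := ⟨mul⟩

noncomputable instance : GradedMonoid.GMonoid (TwHom P hP) where
  one_mul := by
    rintro ⟨i, x⟩
    obtain ⟨f, rfl⟩ := cls_surjective x
    refine Eq.trans ?_ (mk_eq (zero_add i) _ _ (chain_one_mul P i f))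
    exact congrArg (GradedMonoid.mk (A := TwHom P hP) (0 + i)) (mul_cls _ _)
  mul_one := by
    rintro ⟨i, x⟩
    obtain ⟨f, rfl⟩ := cls_surjective x
    refine Eq.trans ?_ (mk_eq (add_zero i) _ _ (chain_mul_one P i f))
    exact congrArg (GradedMonoid.mk (A := TwHom P hP) (i + 0)) (mul_cls _ _)
  mul_assoc := by
    rintro ⟨i, x⟩ ⟨j, y⟩ ⟨l, z⟩
    obtain ⟨f, rfl⟩ := cls_surjective x
    obtain ⟨g, rfl⟩ := cls_surjective y
    obtain ⟨h, rfl⟩ := cls_surjective z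
    refine Eq.trans ?_ ((mk_eq (add_assoc i j l) _ _ (chain_mul_assoc P f g h)).trans ?_)
    · exact congrArg (GradedMonoid.mk (A := TwHom P hP) (i + j + l))
        ((congrArg (mul · _) (mul_cls _ _)).trans (mul_cls _ _))
    · exact (congrArg (GradedMonoid.mk (A := TwHom P hP) (i + (j + l)))
        ((congrArg (mul _ ·) (mul_cls _ _)).trans (mul_cls _ _))).symm

noncomputable instance : DirectSum.GRing (TwHom P hP) where
  __ := (inferInstance : GradedMonoid.GMonoid (TwHom P hP))
  mul_zero a := (congrArg (mul a) (zero_smul k 0).symm).trans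
    ((mul_smul (0 : k) a 0).trans (zero_smul _ _))
  zero_mul a := (congrArg (mul · a) (zero_smul k 0).symm).trans
    ((smul_mul (0 : k) 0 a).trans (zero_smul _ _))
  mul_add := mul_add
  add_mul := add_mul
  natCast n := n • cls (chainOne P)
  natCast_zero := zero_smul _ _
  natCast_succ n := succ_nsmul _ n
  intCast n := n • cls (chainOne P)
  intCast_ofNat n := natCast_zsmul _ n
  intCast_negSucc_ofNat n := negSucc_zsmul _ n

lemma mk_smul_eq (r : k) {x : TwHom P hP i} {y : TwHom P hP j}
    (h : GradedMonoid.mk (A := TwHom P hP) i x = GradedMonoid.mk j y) :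
    GradedMonoid.mk (A := TwHom P hP) i (r • x) = GradedMonoid.mk j (r • y) := by
  cases h
  rfl

lemma smul_one_mul (r : k) (x : TwHom P hP i) :
    GradedMonoid.mk (A := TwHom P hP) (0 + i) (mul (r • cls (chainOne P) : TwHom P hP 0) x) =
      GradedMonoid.mk i (r • x) :=
  (congrArg (GradedMonoid.mk (A := TwHom P hP) _) (smul_mul _ _ _)).trans
    (mk_smul_eq r (one_mul (GradedMonoid.mk (A := TwHom P hP) i x)))

lemma mul_smul_one (r : k) (x : TwHom P hP i) :
    GradedMonoid.mk (A := TwHom P hP) (i + 0) (mul x (r • cls (chainOne P) : TwHom P hP 0)) =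
      GradedMonoid.mk i (r • x) :=
  (congrArg (GradedMonoid.mk (A := TwHom P hP) _) (mul_smul _ _ _)).trans
    (mk_smul_eq r (mul_one (GradedMonoid.mk (A := TwHom P hP) i x)))

noncomputable instance : DirectSum.GAlgebra k (TwHom P hP) where
  toFun := (LinearMap.toSpanSingleton k (TwHom P hP 0) (cls (chainOne P))).toAddMonoidHom
  map_one := one_smul k _
  map_mul r s := (congrArg (GradedMonoid.mk (A := TwHom P hP) 0) (SemigroupAction.mul_smul r s _)).trans
    (smul_one_mul r (s • cls (chainOne P) : TwHom P hP 0)).symm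
  commutes r x := (smul_one_mul r x.2).trans (mul_smul_one r x.2).symm
  smul_def r x := (smul_one_mul r x.2).symm
end TwHom
end

section
variable {k G : Type u} [Field k] [Group G]

/-- The chain map `1 ⟶ X[s]` given by the cycle `x` of degree `s`. -/
noncomputable def ofCycle {X : Cpx k G} (s : ℤ) (x : 𝟙_ (Rep.{u} k G) ⟶ X.X s)
    (h : x ≫ X.d s (s + 1) = 0) : 𝟙_ (Cpx k G) ⟶ X⟦s⟧ :=
  mkHomFromSingle (x ≫ (CochainComplex.shiftFunctorObjXIso X s 0 s (by simp)).inv) (by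
    rintro j rfl
    have h' : (CochainComplex.shiftFunctorObjXIso X s 0 s (by simp)).inv ≫ X.d (0 + s) (0 + 1 + s) =
      X.d s (0 + 1 + s) := XIsoOfEq_inv_comp_d _ _ _
    have e : s + 1 = 0 + 1 + s := by ring
    rw [e] at h
    refine (assoc _ _ _).trans ((congrArg (x ≫ ·) ((Linear.comp_units_smul _ s.negOnePow _).trans
      (congrArg (s.negOnePow • ·) h'))).trans ((Linear.comp_units_smul x s.negOnePow _).trans ?_))
    rw [h, smul_zero]
    rfl)

lemma el_ofCycle {X : Cpx k G} (s : ℤ) (x : 𝟙_ (Rep.{u} k G) ⟶ X.X s)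
    (h : x ≫ X.d s (s + 1) = 0) : el (ofCycle s x h) = x := by
  rw [el, ofCycle]
  erw [mkHomFromSingle_f]
  simp

variable (k) in
/-- The permutation module `k(G/N)`. -/
noncomputable abbrev permMod (N : Subgroup G) : Rep.{u} k G := Rep.ofMulAction k G (G ⧸ N)

/-- The augmentation `ε : k(G/N) ⟶ k`, sending every coset to `1`. -/
noncomputable def aug (N : Subgroup G) : permMod k N ⟶ 𝟙_ (Rep.{u} k G) :=
  permLift (V := Rep.trivial k G k) (fun _ => (1 : k)) (fun _ _ => rfl)

lemma aug_single (N : Subgroup G) (x : G ⧸ N) :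
    (aug (k := k) N).hom (MonoidAlgebra.single x 1) = (1 : k) := permLift_single _ _ x

lemma smul_mul_coset (N : Subgroup G) [N.Normal] (g : G) (x y : G ⧸ N) :
    (g • x) * y = g • (x * y) := by
  induction x using QuotientGroup.induction_on
  induction y using QuotientGroup.induction_on
  exact congrArg _ (mul_assoc _ _ _)

/-- Multiplication by `σ ∈ G/N` on `k(G/N)`. -/
noncomputable def rightMul (N : Subgroup G) [N.Normal] (σ : G ⧸ N) : permMod k N ⟶ permMod k N :=
  permLift (fun x => MonoidAlgebra.single (x * σ) 1) (fun g x => by simp [smul_mul_coset])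

/-- `τ = σ - 1 : k(G/N) ⟶ k(G/N)`. -/
noncomputable def tau (N : Subgroup G) [N.Normal] (σ : G ⧸ N) : permMod k N ⟶ permMod k N :=
  rightMul N σ - 𝟙 _

lemma tau_aug (N : Subgroup G) [N.Normal] (σ : G ⧸ N) : tau (k := k) N σ ≫ aug N = 0 := by
  rw [tau, Preadditive.sub_comp, id_comp, sub_eq_zero]
  refine perm_hom_ext fun x => ?_
  exact (congrArg (aug N).hom (permLift_single _ _ x)).trans
    ((aug_single _ _).trans (aug_single _ _).symm)

/-- The invariant vector `v` as a map `k ⟶ V`. -/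
noncomputable def invLift {V : Rep.{u} k G} (v : V.V) (hv : ∀ g, V.ρ g v = v) :
    𝟙_ (Rep.{u} k G) ⟶ V :=
  (Rep.ofHom ⟨LinearMap.toSpanSingleton k V.V v, fun g => by ext; simp [hv]⟩ :
    Rep.trivial k G k ⟶ V)

lemma unit_hom_ext {V : Rep.{u} k G} {f g : 𝟙_ (Rep.{u} k G) ⟶ V}
    (h : f.hom (1 : k) = g.hom (1 : k)) : f = g := by
  apply Rep.hom_ext
  apply Representation.IntertwiningMap.toLinearMap_injective
  exact LinearMap.ext_ring h

lemma invLift_one {V : Rep.{u} k G} (v : V.V) (hv : ∀ g, V.ρ g v = v) :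
    (invLift v hv).hom (1 : k) = v := one_smul k v

/-- `η : k ⟶ k(G/N)`, sending `1` to the sum of all cosets. -/
noncomputable def eta [Finite G] (N : Subgroup G) : 𝟙_ (Rep.{u} k G) ⟶ permMod k N :=
  letI := Fintype.ofFinite (G ⧸ N)
  invLift (∑ x : G ⧸ N, MonoidAlgebra.single x 1) fun g => by
    rw [map_sum]
    simp only [Representation.ofMulAction_single]
    exact Fintype.sum_equiv (MulAction.toPerm g) _ _ fun _ => rfl

lemma eta_tau [Finite G] (N : Subgroup G) [N.Normal] (σ : G ⧸ N) :
    eta (k := k) N ≫ tau N σ = 0 := by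
  let := Fintype.ofFinite (G ⧸ N)
  rw [tau, Preadditive.comp_sub, comp_id, sub_eq_zero]
  refine unit_hom_ext ?_
  refine (congrArg (rightMul N σ).hom (invLift_one _ _)).trans (Eq.trans ?_ (invLift_one _ _).symm)
  refine (map_sum (rightMul (k := k) N σ).hom _ _).trans ?_
  exact Fintype.sum_equiv (Equiv.mulRight σ) _ _ fun x => permLift_single _ _ x

lemma eta_aug [Finite G] (p : ℕ) [CharP k p] (N : Subgroup G) (h : N.index = p) :
    eta (k := k) N ≫ aug N = 0 := by
  let := Fintype.ofFinite (G ⧸ N)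
  refine unit_hom_ext ?_
  refine (congrArg (aug N).hom (invLift_one _ _)).trans ?_
  refine (map_sum (aug (k := k) N).hom _ _).trans ?_
  refine (Finset.sum_congr rfl fun x _ => aug_single N x).trans ?_
  rw [Finset.sum_const, Finset.card_univ, ← Nat.card_eq_fintype_card]
  change N.index • (1 : k) = 0
  rw [h, nsmul_eq_mul, CharP.cast_eq_zero, zero_mul]

open ZeroObject in
/-- The terms of `u_N`, with `k` in degree `0`. -/
noncomputable def uX (odd : Bool) (N : Subgroup G) : ℤ → Rep.{u} k G
  | .ofNat 0 => 𝟙_ _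
  | .negSucc 0 => permMod k N
  | .negSucc 1 => if odd then permMod k N else 0
  | _ => 0

/-- The differential of `u_N`. -/
noncomputable def uD (odd : Bool) (N : Subgroup G) [N.Normal] (σ : G ⧸ N) :
    ∀ i j : ℤ, uX (k := k) odd N i ⟶ uX odd N j
  | .negSucc 0, .ofNat 0 => aug N
  | .negSucc 1, .negSucc 0 => match odd with
    | true => tau N σ
    | false => 0
  | _, _ => 0

lemma uD_cases (odd : Bool) (N : Subgroup G) [N.Normal] (σ : G ⧸ N) (i j : ℤ) :
    uD (k := k) odd N σ i j = 0 ∨ (i = -1 ∧ j = 0) ∨ (i = -2 ∧ j = -1) := by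
  rcases i with (_ | i) | (_ | _ | i) <;> rcases j with (_ | j) | (_ | _ | j)
  all_goals first | exact Or.inl rfl | exact Or.inr (Or.inl ⟨rfl, rfl⟩) |
    exact Or.inr (Or.inr ⟨rfl, rfl⟩)

/-- The complex `0 ⟶ k(G/N) --τ--> k(G/N) --ε--> k ⟶ 0` if `odd` is true, and
`0 ⟶ k(G/N) --ε--> k ⟶ 0` otherwise, with `k` in degree `0` and increasing differential. -/
noncomputable def uCpx (odd : Bool) (N : Subgroup G) [N.Normal] (σ : G ⧸ N) : Cpx k G where
  X := uX odd N
  d := uD odd N σ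
  shape i j h := by
    rcases uD_cases (k := k) odd N σ i j with h' | ⟨rfl, rfl⟩ | ⟨rfl, rfl⟩
    · exact h'
    · exact absurd rfl h
    · exact absurd rfl h
  d_comp_d' i j l _ _ := by
    rcases uD_cases (k := k) odd N σ i j with h | ⟨rfl, rfl⟩ | ⟨rfl, rfl⟩
    · rw [h, zero_comp]
    · rcases uD_cases (k := k) odd N σ 0 l with h | ⟨h, _⟩ | ⟨h, _⟩
      · rw [h, comp_zero]
      · exact absurd h (by decide)
      · exact absurd h (by decide)
    · rcases uD_cases (k := k) odd N σ (-1) l with h | ⟨_, rfl⟩ | ⟨h, _⟩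
      · rw [h, comp_zero]
      · cases odd
        · exact zero_comp
        · exact tau_aug N σ
      · exact absurd h (by decide)

lemma isPermComplex_uCpx [Finite G] (odd : Bool) (N : Subgroup G) [N.Normal] (σ : G ⧸ N) :
    IsPermComplex (uCpx (k := k) odd N σ) := by
  refine ⟨fun n => ?_, 2, fun n hn => ?_⟩
  · rcases n with (_ | n) | (_ | _ | n)
    · exact isPermSummand_unit
    · exact isPermSummand_of_isZero (isZero_zero _)
    · exact isPermSummand_perm (G ⧸ N)
    · cases odd
      · exact isPermSummand_of_isZero (isZero_zero _)
      · exact isPermSummand_perm (G ⧸ N)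
    · exact isPermSummand_of_isZero (isZero_zero _)
  · rcases n with (_ | n) | (_ | _ | n)
    · exact absurd hn (by decide)
    · exact isZero_zero _
    · exact absurd hn (by decide)
    · exact absurd hn (by decide)
    · exact isZero_zero _

/-- `a_N : 1 ⟶ u_N` is the identity in degree zero. -/
noncomputable def aMap (odd : Bool) (N : Subgroup G) [N.Normal] (σ : G ⧸ N) :
    𝟙_ (Cpx k G) ⟶ (uCpx odd N σ)⟦(0 : ℤ)⟧ :=
  ofCycle 0 (𝟙 (𝟙_ (Rep.{u} k G))) comp_zero

/-- `b_N : 1 ⟶ u_N[-2']` is `η` in degree zero, where `2' = 2` for odd `p` and `2' = 1` for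
`p = 2`. -/
noncomputable def bMap [Finite G] (p : ℕ) [CharP k p] (odd : Bool) (N : Subgroup G) [N.Normal]
    (hN : N.index = p) (σ : G ⧸ N) :
    𝟙_ (Cpx k G) ⟶ (uCpx odd N σ)⟦(if odd then -2 else -1 : ℤ)⟧ :=
  match odd with
  | true => ofCycle (-2) (eta N) (eta_tau N σ)
  | false => ofCycle (-1) (eta N) (eta_aug p N hN)

/-- `c_N : 1 ⟶ u_N[-1]` is `η` in degree zero. -/
noncomputable def cMap [Finite G] (p : ℕ) [CharP k p] (odd : Bool) (N : Subgroup G) [N.Normal]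
    (hN : N.index = p) (σ : G ⧸ N) :
    𝟙_ (Cpx k G) ⟶ (uCpx odd N σ)⟦(-1 : ℤ)⟧ :=
  ofCycle (-1) (eta N) (eta_aug p N hN)

end

section
variable (p : ℕ) (k G : Type u) [Field k] [Group G]

/-- The set of normal subgroups of `G` of index `p`. -/
def NormalOfIndex (G : Type u) [Group G] := {N : Subgroup G // N.Normal ∧ N.index = p}

instance (N : NormalOfIndex p G) : N.1.Normal := N.2.1

instance [Finite G] : Finite (NormalOfIndex p G) := Subtype.finite

/-- The choices that enter the construction: a generator of the cyclic group `G/N` for each normal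
subgroup `N` of index `p`, and the order of the factors in tensor products over all `N`. -/
structure Choices where
  σ (N : NormalOfIndex p G) : G ⧸ N.1
  zpowers_eq_top (N : NormalOfIndex p G) : Subgroup.zpowers (σ N) = ⊤
  list : List (NormalOfIndex p G)
  nodup : list.Nodup
  mem_list (N : NormalOfIndex p G) : N ∈ list

lemma nonempty_choices [Fact p.Prime] [Finite G] : Nonempty (Choices p G) := by
  classical
  have := Fintype.ofFinite (NormalOfIndex p G)
  have h (N : NormalOfIndex p G) : ∃ σ : G ⧸ N.1, Subgroup.zpowers σ = ⊤ := by
    have := isCyclic_of_prime_card (α := G ⧸ N.1) (p := p) N.2.2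
    obtain ⟨σ, hσ⟩ := IsCyclic.exists_generator (α := G ⧸ N.1)
    exact ⟨σ, (Subgroup.eq_top_iff' _).2 hσ⟩
  choose σ hσ using h
  exact ⟨σ, hσ, Finset.univ.toList, Finset.nodup_toList _, fun N => by simp⟩

variable {p G} (D : Choices p G)

/-- The invertible complex `u_N`. -/
noncomputable def uN (N : NormalOfIndex p G) : Cpx k G := uCpx (decide (p ≠ 2)) N.1 (D.σ N)

/-- The objects `1(q) = ⨂ u_N^{⊗ q(N)}`, the tensor product over the `N` in a list, with the
canonical products `1(q) ⊗ 1(q') ⟶ 1(q + q')`. -/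
noncomputable def twistList : List (NormalOfIndex p G) → GradedMon (NormalOfIndex p G → ℕ) (Cpx k G)
  | [] => GradedMon.unit _
  | N :: l => ((GradedMon.powers (uN k D N)).comap (Pi.evalAddMonoidHom (fun _ => ℕ) N)).tensor
      (twistList l)

lemma isPermComplex_twistList [Finite G] (q : NormalOfIndex p G → ℕ) :
    ∀ l, IsPermComplex ((twistList k D l).X q)
  | [] => isPermComplex_unit
  | _ :: l => ((isPermComplex_uCpx _ _ _).tpow _).tensor (isPermComplex_twistList q l)

/-- The canonical isomorphism `1 ≅ 1(q)` if `q` vanishes on the list. -/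
noncomputable def unitIso (q : NormalOfIndex p G → ℕ) : ∀ l : List (NormalOfIndex p G),
    (∀ N ∈ l, q N = 0) → (𝟙_ (Cpx k G) ≅ (twistList k D l).X q)
  | [], _ => Iso.refl _
  | N :: l, h => (λ_ (𝟙_ (Cpx k G))).symm ≪≫
      (eqToIso (congrArg (GradedMon.tpow (uN k D N)) (h N List.mem_cons_self).symm) ⊗ᵢ
        unitIso q l fun M hM => h M (List.mem_cons_of_mem _ hM))

/-- The canonical isomorphism `u_M ≅ 1(q)` if `q(M) = 1` and `q` vanishes at the other elements of the list. -/
noncomputable def genIso (M : NormalOfIndex p G) (q : NormalOfIndex p G → ℕ) (hM : q M = 1)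
    (hq : ∀ N, N ≠ M → q N = 0) : ∀ l : List (NormalOfIndex p G), l.Nodup → M ∈ l →
      (uN k D M ≅ (twistList k D l).X q)
  | [], _, h => absurd h List.not_mem_nil
  | N :: l, hl, h =>
    open Classical in
    if e : N = M then
      (ρ_ (uN k D M)).symm ≪≫
        (((λ_ (uN k D M)).symm ≪≫
          eqToIso (show GradedMon.tpow (uN k D M) 1 = GradedMon.tpow (uN k D N) (q N) by
            rw [e, hM])) ⊗ᵢ
          unitIso k D q l fun L hL => hq L fun e' =>
            (List.nodup_cons.1 hl).1 (by rwa [e, ← e']))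
    else
      (λ_ (uN k D M)).symm ≪≫
        (eqToIso (congrArg (GradedMon.tpow (uN k D N)) (hq N e).symm) ⊗ᵢ
          genIso M q hM hq l (List.nodup_cons.1 hl).2
            ((List.mem_cons.1 h).resolve_left (Ne.symm e)))

variable [Finite G]

/-- `Hom_{K(G)}(1, 1(q)[s])` for `i = (s, q)`. -/
abbrev TwHomG : ℤ × (NormalOfIndex p G → ℕ) → Type u :=
  TwHom (twistList k D D.list) (fun q => isPermComplex_twistList k D q D.list)

noncomputable instance : DirectSum.GRing (TwHomG k D) :=
  inferInstanceAs (DirectSum.GRing (TwHom (twistList k D D.list) (fun q => isPermComplex_twistList k D q D.list)))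


/-- The twisted cohomology ring: the direct sum of `Hom_{K(G)}(1, 1(q)[s])` over all
`s ∈ ℤ` and `q ∈ ℕ^𝒩`, where `𝒩` is the set of normal subgroups of index `p`. -/
def TwistedRing : Type u := DirectSum (ℤ × (NormalOfIndex p G → ℕ)) (TwHomG k D)

open Classical in
noncomputable instance : Ring (TwistedRing k D) :=
  inferInstanceAs (Ring (DirectSum (ℤ × (NormalOfIndex p G → ℕ)) (TwHomG k D)))

open Classical in
noncomputable instance : Algebra k (TwistedRing k D) :=
  inferInstanceAs (Algebra k (DirectSum (ℤ × (NormalOfIndex p G → ℕ)) (TwHomG k D)))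

open Classical in
/-- The weight `q` with `q(N) = 1` and `q(M) = 0` for `M ≠ N`. -/
noncomputable abbrev basisWeight (N : NormalOfIndex p G) : NormalOfIndex p G → ℕ := Pi.single N 1

open Classical in
/-- A morphism `1 ⟶ u_N[s]` as a homogeneous element of the twisted cohomology ring. -/
noncomputable def homToRing (N : NormalOfIndex p G) (s : ℤ) (f : 𝟙_ (Cpx k G) ⟶ (uN k D N)⟦s⟧) :
    TwistedRing k D :=
  DirectSum.of (TwHomG k D) (s, basisWeight N) (KG.map (f ≫
    (genIso k D N (basisWeight N) (Pi.single_eq_same _ _) (fun _ h => Pi.single_eq_of_ne h _)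
      D.list D.nodup (D.mem_list N)).hom⟦s⟧'))

/-- `a_N`, as an element of the twisted cohomology ring. -/
noncomputable def elemA (N : NormalOfIndex p G) : TwistedRing k D := homToRing k D N 0 (aMap _ _ _)

/-- `b_N`, as an element of the twisted cohomology ring. -/
noncomputable def elemB [CharP k p] (N : NormalOfIndex p G) : TwistedRing k D :=
  homToRing k D N _ (bMap p _ _ N.2.2 _)

/-- `c_N`, as an element of the twisted cohomology ring (used for odd `p`). -/
noncomputable def elemC [CharP k p] (N : NormalOfIndex p G) : TwistedRing k D :=
  homToRing k D N _ (cMap p _ _ N.2.2 _)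
end

end TwistedCohomology
end

/-! A morphism `1 ⟶ X[s]` in `K(G)` is a `G`-fixed cycle of degree `s` in `X`, modulo boundaries of
`G`-fixed elements. The part of the ring in weight `q` is therefore the cohomology of the fixed
points of `1(q)`, and everything can be done with vectors.

Generation is proved by induction on the total weight, by splitting one factor `u_N` off `1(q)`. To
make the induction work, one carries along the statement that for `X = 1(q)` the restriction
`H^*(X^G) → H^*(X^H)` is surjective for every subgroup `H` (`RestrictionSurjective`). Given this for
`X`, write an `H`-fixed cycle of `X ⊗ u_N` in coordinates along the standard bases of `u_N`: an
element `x₀` of `X` and one or two `H`-equivariant families `x₁`, `x₂` on `G/N`. Up to the boundary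
of an `H`-fixed element all families can be made constant, with `G`-fixed cycles as values
(`RestrictionSurjective.split_odd`, `RestrictionSurjective.split_two`). If `H ≤ N`, then `H` acts
trivially on `G/N`, and exactness of translation difference and sum on a cyclic group concentrates
the cycle in the lowest degree of `u_N`. Otherwise `H` is transitive on `G/N`, and surjectivity of
restriction to `H ∩ N` makes the families constant one after the other; the obstructions vanish
because the sum of a constant family has `p` equal terms.

A constant family with value `z` is the product of `z` with the vector underlying `b_N` or `c_N`,
and an element in the top layer is a product with `a_N`. So
`RestrictionSurjective.exists_splitCycles` gives two things at once: every class of weight `q + N`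
is a sum of products of classes of weight `q` with generators, and the restriction property passes
to `X ⊗ u_N`, because the split part is `G`-fixed.

For noetherianity, the generators commute pairwise up to sign (`generators_commute_or`). For
distinct `N` this is the Koszul rule; for one `N` explicit boundaries in `u_N ⊗ u_N` are given.
Hence the squares of the generators are central, and the ring is a finite module over a polynomial
algebra acting through these squares, spanned by square-free monomials. -/

section
open CategoryTheory MonoidalCategory Limits Category HomologicalComplex

/-! ### Calculus with vectors in tensor products of complexes. -/

namespace TwistedCohomology
section
variable {k G : Type u} [Field k] [Group G]

/-- The differential of a complex of representations, as a linear map. -/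
noncomputable def dl (X : Cpx k G) (i j : ℤ) : (X.X i).V →ₗ[k] (X.X j).V := (X.d i j).hom.toLinearMap

/-- A component of a chain map, as a linear map. -/
noncomputable def fl {X Y : Cpx k G} (φ : X ⟶ Y) (n : ℤ) : (X.X n).V →ₗ[k] (Y.X n).V :=
  (φ.f n).hom.toLinearMap

/-- The pure tensor `x ⊗ y` in degree `n = p + q` of a tensor product of complexes. -/
noncomputable def ten (X Y : Cpx k G) (p q n : ℤ) (h : p + q = n) :
    (X.X p).V →ₗ[k] (Y.X q).V →ₗ[k] ((X ⊗ Y).X n).V :=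
  (TensorProduct.mk k (X.X p).V (Y.X q).V).compr₂ (ιTensorObj X Y p q n h).hom.toLinearMap

lemma hom_congr {V W : Rep.{u} k G} {f g : V ⟶ W} (h : f = g) (v : V.V) : f.hom v = g.hom v := by
  rw [h]

lemma dl_dl (X : Cpx k G) (i j l : ℤ) (x : (X.X i).V) : dl X j l (dl X i j x) = 0 :=
  hom_congr (X.d_comp_d i j l) x

lemma fl_dl {X Y : Cpx k G} (φ : X ⟶ Y) (i j : ℤ) (x : (X.X i).V) :
    fl φ j (dl X i j x) = dl Y i j (fl φ i x) :=
  (hom_congr (φ.comm i j) x).symm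

lemma dl_shape (X : Cpx k G) (i j : ℤ) (h : i + 1 ≠ j) (x : (X.X i).V) : dl X i j x = 0 :=
  hom_congr (X.shape i j h) x

lemma fl_comp {X Y Z : Cpx k G} (φ : X ⟶ Y) (ψ : Y ⟶ Z) (n : ℤ) (x : (X.X n).V) :
    fl (φ ≫ ψ) n x = fl ψ n (fl φ n x) := rfl

lemma fl_id (X : Cpx k G) (n : ℤ) (x : (X.X n).V) : fl (𝟙 X) n x = x := rfl

lemma fl_rho {X Y : Cpx k G} (φ : X ⟶ Y) (n : ℤ) (g : G) (x : (X.X n).V) :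
    fl φ n ((X.X n).ρ g x) = (Y.X n).ρ g (fl φ n x) := Rep.hom_comm_apply _ _ _

lemma dl_rho (X : Cpx k G) (i j : ℤ) (g : G) (x : (X.X i).V) :
    dl X i j ((X.X i).ρ g x) = (X.X j).ρ g (dl X i j x) := Rep.hom_comm_apply _ _ _

lemma fl_hom_inv {X Y : Cpx k G} (e : X ≅ Y) (n : ℤ) (y : (Y.X n).V) :
    fl e.hom n (fl e.inv n y) = y := by
  rw [← fl_comp, e.inv_hom_id, fl_id]

lemma fl_inv_hom {X Y : Cpx k G} (e : X ≅ Y) (n : ℤ) (x : (X.X n).V) :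
    fl e.inv n (fl e.hom n x) = x := by
  rw [← fl_comp, e.hom_inv_id, fl_id]

lemma ten_rho (X Y : Cpx k G) (p q n : ℤ) (h : p + q = n) (g : G) (x : (X.X p).V) (y : (Y.X q).V) :
    ((X ⊗ Y).X n).ρ g (ten X Y p q n h x y) =
      ten X Y p q n h ((X.X p).ρ g x) ((Y.X q).ρ g y) :=
  (Rep.hom_comm_apply (ιTensorObj X Y p q n h) g (x ⊗ₜ[k] y)).symm

lemma fl_tensorHom {X Y X' Y' : Cpx k G} (f : X ⟶ X') (g : Y ⟶ Y') (p q n : ℤ) (h : p + q = n)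
    (x : (X.X p).V) (y : (Y.X q).V) :
    fl (f ⊗ₘ g) n (ten X Y p q n h x y) = ten X' Y' p q n h (fl f p x) (fl g q y) :=
  hom_congr (ι_tensorHom f g p q n h) (x ⊗ₜ[k] y)

lemma fl_whiskerRight {X X' : Cpx k G} (f : X ⟶ X') (Y : Cpx k G) (p q n : ℤ) (h : p + q = n)
    (x : (X.X p).V) (y : (Y.X q).V) :
    fl (f ▷ Y) n (ten X Y p q n h x y) = ten X' Y p q n h (fl f p x) y := by
  rw [← tensorHom_id, fl_tensorHom, fl_id]

lemma fl_whiskerLeft {Y Y' : Cpx k G} (X : Cpx k G) (g : Y ⟶ Y') (p q n : ℤ) (h : p + q = n)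
    (x : (X.X p).V) (y : (Y.X q).V) :
    fl (X ◁ g) n (ten X Y p q n h x y) = ten X Y' p q n h x (fl g q y) := by
  rw [← id_tensorHom, fl_tensorHom, fl_id]

lemma fl_associator (X Y Z : Cpx k G) (p q r n pq qr : ℤ) (hpq : p + q = pq) (h : pq + r = n)
    (hqr : q + r = qr) (h' : p + qr = n) (x : (X.X p).V) (y : (Y.X q).V) (z : (Z.X r).V) :
    fl (α_ X Y Z).hom n (ten _ _ pq r n h (ten _ _ p q pq hpq x y) z) =
      ten _ _ p qr n h' x (ten _ _ q r qr hqr y z) := by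
  subst hpq hqr
  exact hom_congr (ι_associator X Y Z p q r n h) ((x ⊗ₜ[k] y) ⊗ₜ[k] z)

lemma fl_associator_inv (X Y Z : Cpx k G) (p q r n pq qr : ℤ) (hpq : p + q = pq) (h : pq + r = n)
    (hqr : q + r = qr) (h' : p + qr = n) (x : (X.X p).V) (y : (Y.X q).V) (z : (Z.X r).V) :
    fl (α_ X Y Z).inv n (ten _ _ p qr n h' x (ten _ _ q r qr hqr y z)) =
      ten _ _ pq r n h (ten _ _ p q pq hpq x y) z := by
  rw [← fl_associator X Y Z p q r n pq qr hpq h hqr h', fl_inv_hom]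

variable (k G) in
/-- The element `1` of the unit complex. -/
noncomputable def oneU : ((𝟙_ (Cpx k G)).X 0).V :=
  (singleObjXSelf (.up ℤ) 0 (𝟙_ (Rep k G))).inv.hom (1 : k)

lemma oneU_rho (g : G) : ((𝟙_ (Cpx k G)).X 0).ρ g (oneU k G) = oneU k G :=
  (Rep.hom_comm_apply (singleObjXSelf (.up ℤ) 0 (𝟙_ (Rep k G))).inv g (1 : k)).symm

lemma dl_oneU (n : ℤ) : dl (𝟙_ (Cpx k G)) 0 n (oneU k G) = 0 :=
  hom_congr (single_obj_d (.up ℤ) 0 (𝟙_ (Rep k G)) 0 n : (𝟙_ (Cpx k G)).d 0 n = 0) _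

lemma fl_leftUnitor_inv (X : Cpx k G) (n : ℤ) (x : (X.X n).V) :
    fl (λ_ X).inv n x = ten _ _ 0 n n (zero_add n) (oneU k G) x :=
  hom_congr (leftUnitor_inv_f X n) x

lemma fl_rightUnitor_inv (X : Cpx k G) (n : ℤ) (x : (X.X n).V) :
    fl (ρ_ X).inv n x = ten _ _ n 0 n (add_zero n) x (oneU k G) :=
  hom_congr (rightUnitor'_inv X n : (ρ_ X).inv.f n = (ρ_ (X.X n)).inv ≫
    X.X n ◁ (singleObjXSelf (.up ℤ) 0 (𝟙_ (Rep k G))).inv ≫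
      ιTensorObj X (tensorUnit _ _) n 0 n (add_zero n)) x

lemma fl_leftUnitor (X : Cpx k G) (n : ℤ) (h : 0 + n = n) (x : (X.X n).V) :
    fl (λ_ X).hom n (ten _ _ 0 n n h (oneU k G) x) = x := by
  rw [← fl_leftUnitor_inv, fl_hom_inv]

lemma fl_rightUnitor (X : Cpx k G) (n : ℤ) (h : n + 0 = n) (x : (X.X n).V) :
    fl (ρ_ X).hom n (ten _ _ n 0 n h x (oneU k G)) = x := by
  rw [← fl_rightUnitor_inv, fl_hom_inv]

lemma units_smul_hom {V W : Rep.{u} k G} (z : ℤˣ) (f : V ⟶ W) (v : V.V) :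
    (z • f).hom v = z • f.hom v := by
  rcases Int.units_eq_one_or z with rfl | rfl
  · rw [one_smul, one_smul]
  · rw [Units.neg_smul, Units.neg_smul, one_smul, one_smul]
    rfl

lemma fl_braiding (X Y : Cpx k G) (p q n : ℤ) (h : p + q = n) (h' : q + p = n) (x : (X.X p).V)
    (y : (Y.X q).V) :
    fl (β_ X Y).hom n (ten X Y p q n h x y) = (p * q).negOnePow • ten Y X q p n h' y x :=
  (hom_congr (ι_koszulX_hom X Y p q n h h') (x ⊗ₜ[k] y)).trans (units_smul_hom _ _ _)

/-- The Leibniz rule with the Koszul sign. Every degree is a variable tied by an equation, so the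
rule applies without casts between degrees that agree only propositionally. -/
lemma dl_ten (X Y : Cpx k G) (p q n p' q' n' : ℤ) (h : p + q = n) (hp : p + 1 = p')
    (hq : q + 1 = q') (h₁ : p' + q = n') (h₂ : p + q' = n') (x : (X.X p).V) (y : (Y.X q).V) :
    dl (X ⊗ Y) n n' (ten X Y p q n h x y) =
      ten X Y p' q n' h₁ (dl X p p' x) y + p.negOnePow • ten X Y p q' n' h₂ x (dl Y q q' y) := by
  have e : ιTensorObj X Y p q n h ≫ (X ⊗ Y).d n n' =
      (X.d p p' ▷ Y.X q) ≫ ιTensorObj X Y p' q n' h₁ +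
        p.negOnePow • ((X.X p ◁ Y.d q q') ≫ ιTensorObj X Y p q' n' h₂) := by
    change ιTensorObj X Y p q n h ≫ (HomologicalComplex.tensorObj X Y).d n n' = _
    rw [mapBifunctor.d_eq]
    simp only [Preadditive.comp_add]
    erw [mapBifunctor.ι_D₁, mapBifunctor.ι_D₂]
    erw [mapBifunctor.d₁_eq X Y (curriedTensor _) (.up ℤ) (i₁ := p) (i₁' := p') hp q n' h₁,
      mapBifunctor.d₂_eq X Y (curriedTensor _) (.up ℤ) p (i₂ := q) (i₂' := q') hq n' h₂]
    refine congrArg₂ (· + ·) (one_smul ℤˣ _) ?_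
    rfl
  refine (hom_congr e (x ⊗ₜ[k] y)).trans ?_
  exact congrArg (_ + ·) (units_smul_hom _ (X.X p ◁ Y.d q q' ≫ ιTensorObj X Y p q' n' h₂) _)

/-- The span of the pure tensors is stable under `G`, and the quotient map by it vanishes on every
summand, hence is zero. Scalars can be moved into the second factor, so `P` need not be closed under
them. -/
lemma ten_induction {X Y : Cpx k G} {n : ℤ} {P : ((X ⊗ Y).X n).V → Prop} (zero : P 0)
    (add : ∀ v w, P v → P w → P (v + w)) (ten : ∀ p q e x y, P (ten X Y p q n e x y))
    (v : ((X ⊗ Y).X n).V) : P v := by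
  let W : Submodule k ((X ⊗ Y).X n).V :=
    Submodule.span k {v | ∃ p q e x y, TwistedCohomology.ten X Y p q n e x y = v}
  have hW (g : G) : W ≤ W.comap (((X ⊗ Y).X n).ρ g) := by
    refine Submodule.span_le.2 ?_
    rintro _ ⟨p, q, e, x, y, rfl⟩
    exact Submodule.subset_span ⟨p, q, e, _, _, (ten_rho X Y p q n e g x y).symm⟩
  have h : Rep.mkQ _ W hW = 0 := by
    refine tensor_hom_ext fun p q e => ?_
    rw [comp_zero]
    apply Rep.hom_ext
    apply Representation.IntertwiningMap.toLinearMap_injective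
    refine TensorProduct.ext' fun x y => ?_
    exact (Submodule.Quotient.mk_eq_zero W).2 (Submodule.subset_span ⟨p, q, e, x, y, rfl⟩)
  have hv : v ∈ W := (Submodule.Quotient.mk_eq_zero W).1 (hom_congr h v)
  induction hv using Submodule.closure_induction with
  | zero => exact zero
  | add v w _ _ hv hw => exact add v w hv hw
  | smul_mem r v hv =>
    obtain ⟨p, q, e, x, y, rfl⟩ := hv
    rw [← map_smul]
    exact ten p q e x (r • y)

/-- A linear form on a term of the second factor induces a linear map from a term of a tensor
product of complexes to a term of the first factor. -/
lemma exists_contraction (X Y : Cpx k G) (p q n : ℤ) (h : p + q = n) (c : (Y.X q).V →ₗ[k] k) :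
    ∃ π : ((X ⊗ Y).X n).V →ₗ[k] (X.X p).V, (∀ x y, π (ten X Y p q n h x y) = c y • x) ∧
      ∀ p' q' h' x y, p' ≠ p → π (ten X Y p' q' n h' x y) = 0 := by
  obtain rfl : q = n - p := by omega
  refine ⟨(TensorProduct.lift (LinearMap.lsmul k (X.X p).V ∘ₗ c).flip) ∘ₗ
    (tensorProj X Y n p).hom.toLinearMap, fun x y => ?_, fun p' q' h' x y hp => ?_⟩
  · have := hom_congr (ι_tensorProj_self X Y n p (n - p) h) (x ⊗ₜ[k] y)
    exact congrArg (TensorProduct.lift (LinearMap.lsmul k (X.X p).V ∘ₗ c).flip) this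
  · have := hom_congr (ι_tensorProj_ne X Y n p' q' p h' hp) (x ⊗ₜ[k] y)
    exact (congrArg (TensorProduct.lift (LinearMap.lsmul k (X.X p).V ∘ₗ c).flip) this).trans
      (map_zero _)
end
end TwistedCohomology

/-! ### Splitting of cycles in coordinates. -/

namespace TwistedCohomology

/-- On a finite cyclic group, a function of sum zero is a difference `f (x σ⁻¹) - f x`. -/
lemma exists_sub_eq_of_sum_eq_zero {Q V : Type*} [Group Q] [Fintype Q] [AddCommGroup V] (σ : Q)
    (hσ : Subgroup.zpowers σ = ⊤) (F : Q → V) (hF : ∑ x, F x = 0) :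
    ∃ f : Q → V, ∀ x, f (x * σ⁻¹) - f x = F x := by
  classical
  let D : (Q → V) →+ (Q → V) :=
    { toFun := fun f x => f (x * σ⁻¹) - f x
      map_zero' := by ext; simp
      map_add' := fun f g => by ext; simp; abel }
  have hD (x : Q) (v : V) : D (Pi.single x v) = Pi.single (x * σ) v - Pi.single x v := by
    ext y
    simp only [D, AddMonoidHom.coe_mk, ZeroHom.coe_mk, Pi.sub_apply, Pi.single_apply,
      mul_inv_eq_iff_eq_mul]
  -- Modulo the image of `D` all point masses with the same value agree: by telescoping along the
  -- powers of `σ`, which exhaust the group.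
  have hp (n : ℕ) (v : V) : Pi.single (σ ^ n) v - Pi.single 1 v ∈ D.range := by
    induction n with
    | zero => simp
    | succ n ih =>
      have := D.range.add_mem ⟨_, hD (σ ^ n) v⟩ ih
      rwa [sub_add_sub_cancel, ← pow_succ] at this
  have hx (x : Q) (v : V) : Pi.single x v - Pi.single 1 v ∈ D.range := by
    obtain ⟨n, rfl⟩ := mem_powers_iff_mem_zpowers.2 (hσ ▸ Subgroup.mem_top x)
    exact hp n v
  -- The subtracted masses at `1` add up to the mass `∑ F x = 0`.
  have hsum : F = ∑ x, (Pi.single x (F x) - Pi.single 1 (F x)) := by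
    rw [Finset.sum_sub_distrib, Finset.univ_sum_single]
    have : ∑ x, Pi.single (1 : Q) (F x) = (0 : Q → V) := by
      exact (map_sum (AddMonoidHom.single (fun _ : Q => V) 1) F _).symm.trans
        (by rw [hF, map_zero])
    rw [this, sub_zero]
  obtain ⟨f, hf⟩ : F ∈ D.range := by
    rw [hsum]
    exact D.range.sum_mem fun x _ => hx x _
  exact ⟨f, fun x => congrFun hf x⟩

section
variable {k G : Type u} [Field k] [Group G]

/-- The vectors of `V` fixed by the subgroup `H`. -/
def invs (H : Subgroup G) (V : Rep.{u} k G) : Submodule k V.V where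
  carrier := {v | ∀ h ∈ H, V.ρ h v = v}
  add_mem' hv hw h hh := by rw [map_add, hv h hh, hw h hh]
  zero_mem' h _ := map_zero _
  smul_mem' c v hv h hh := by rw [map_smul, hv h hh]

lemma units_smul_mem {R M : Type*} [Ring R] [AddCommGroup M] [Module R M] (W : Submodule R M)
    (z : ℤˣ) {v : M} (hv : v ∈ W) : z • v ∈ W := by
  rcases Int.units_eq_one_or z with rfl | rfl
  · rwa [one_smul]
  · rw [Units.neg_smul, one_smul]; exact W.neg_mem hv

lemma map_units_smul' {M M' F : Type*} [AddCommGroup M] [AddCommGroup M'] [FunLike F M M']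
    [AddMonoidHomClass F M M'] (f : F) (z : ℤˣ) (v : M) : f (z • v) = z • f v := by
  rcases Int.units_eq_one_or z with rfl | rfl
  · rw [one_smul, one_smul]
  · rw [Units.neg_smul, one_smul, Units.neg_smul, one_smul, map_neg]

lemma units_smul_smul_self {M : Type*} [AddCommGroup M] (z : ℤˣ) (v : M) : z • z • v = v := by
  rw [smul_smul, Int.units_mul_self, one_smul]

lemma dl_mem_invs (X : Cpx k G) {H : Subgroup G} {i : ℤ} {x : (X.X i).V} (hx : x ∈ invs H (X.X i))
    (j : ℤ) : dl X i j x ∈ invs H (X.X j) := fun h hh => by rw [← dl_rho, hx h hh]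

lemma fl_mem_invs {X Y : Cpx k G} (φ : X ⟶ Y) {H : Subgroup G} {i : ℤ} {x : (X.X i).V}
    (hx : x ∈ invs H (X.X i)) : fl φ i x ∈ invs H (Y.X i) := fun h hh => by rw [← fl_rho, hx h hh]

lemma ten_mem_invs (X Y : Cpx k G) {H : Subgroup G} {p q : ℤ} {x : (X.X p).V} {y : (Y.X q).V}
    (hx : x ∈ invs H (X.X p)) (hy : y ∈ invs H (Y.X q)) (n : ℤ) (h : p + q = n) :
    ten X Y p q n h x y ∈ invs H ((X ⊗ Y).X n) := fun g hg => by rw [ten_rho, hx g hg, hy g hg]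

/-- For each subgroup `H`, every `H`-fixed cycle of `X` is a `G`-fixed cycle up to the boundary of
an `H`-fixed element, that is, restriction `H^n(X^G) → H^n(X^H)` is surjective. -/
def RestrictionSurjective (X : Cpx k G) : Prop :=
  ∀ (H : Subgroup G) (m n n' : ℤ), m + 1 = n → n + 1 = n' → ∀ x ∈ invs H (X.X n), dl X n n' x = 0 →
    ∃ z ∈ invs ⊤ (X.X n), dl X n n' z = 0 ∧ ∃ w ∈ invs H (X.X m), x = z + dl X m n w

/-- The functions `f : S → V` that commute with the action of the subgroup `H`. -/
def equivariants (H : Subgroup G) (S : Type*) [MulAction G S] (V : Rep.{u} k G) :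
    Submodule k (S → V.V) where
  carrier := {f | ∀ h ∈ H, ∀ s, f (h • s) = V.ρ h (f s)}
  add_mem' hv hw h hh s := by simp [hv h hh, hw h hh]
  zero_mem' h _ _ := (map_zero _).symm
  smul_mem' c v hv h hh s := by simp [hv h hh]

lemma sum_mem_invs {H : Subgroup G} {S : Type*} [MulAction G S] [Fintype S] {V : Rep.{u} k G}
    {f : S → V.V} (hf : f ∈ equivariants H S V) : ∑ s, f s ∈ invs H V := fun h hh => by
  rw [map_sum]
  exact Fintype.sum_equiv (MulAction.toPerm h) _ _ fun s => (hf h hh s).symm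

/-- A form of Shapiro's lemma. An equivariant family on a transitive `H`-set is determined by its
value at `s₀`, which is fixed by `H ∩ Stab(s₀)`. The hypothesis for that subgroup splits this value,
and translation spreads the splitting over `S`. The same `z` serves for all `s` because it is fixed
by all of `G`. -/
lemma RestrictionSurjective.of_transitive {X : Cpx k G} (hX : RestrictionSurjective X)
    {H : Subgroup G} {S : Type*} [MulAction G S] (s₀ : S) (hH : ∀ s : S, ∃ h ∈ H, h • s₀ = s)
    {m n n' : ℤ} (hm : m + 1 = n) (hn : n + 1 = n') {x : S → (X.X n).V}
    (hx : x ∈ equivariants H S (X.X n)) (hd : ∀ s, dl X n n' (x s) = 0) :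
    ∃ z ∈ invs ⊤ (X.X n), dl X n n' z = 0 ∧
      ∃ w ∈ equivariants H S (X.X m), ∀ s, x s = z + dl X m n (w s) := by
  choose t ht hts using hH
  obtain ⟨z, hz, hdz, w, hw, e⟩ := hX (H ⊓ MulAction.stabilizer G s₀) m n n' hm hn (x s₀)
    (fun h hh => by rw [← hx h hh.1, hh.2]) (hd s₀)
  refine ⟨z, hz, hdz, fun s => (X.X m).ρ (t s) w, fun h hh s => ?_, fun s => ?_⟩
  -- Two elements of `H` that carry `s₀` to the same point differ by an element fixing `w`, so the
  -- translates of `w` form an equivariant family.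
  · have h1 : (t (h • s))⁻¹ * (h * t s) ∈ H ⊓ MulAction.stabilizer G s₀ := by
      refine ⟨H.mul_mem (H.inv_mem (ht _)) (H.mul_mem hh (ht _)), ?_⟩
      change ((t (h • s))⁻¹ * (h * t s)) • s₀ = s₀
      rw [mul_smul, mul_smul, hts, inv_smul_eq_iff, hts]
    have h2 := congrArg ((X.X m).ρ (t (h • s))) (hw _ h1)
    rw [← Module.End.mul_apply, ← map_mul, mul_inv_cancel_left, map_mul, Module.End.mul_apply] at h2
    exact h2.symm
  · have h3 := hx (t s) (ht s) s₀
    rw [hts, e, map_add, hz _ trivial, ← dl_rho] at h3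
    exact h3

variable (p : ℕ) [Fact p.Prime] [CharP k p] (N : Subgroup G) [N.Normal] (hN : N.index = p)

-- The group `G/N` has prime order, so the image of `H` in it is trivial or everything. The two
-- cases need different splittings.
include hN in
omit [Field k] [CharP k p] in
lemma le_or_transitive (H : Subgroup G) :
    H ≤ N ∨ ∀ s : G ⧸ N, ∃ h ∈ H, h • (1 : G ⧸ N) = s := by
  have : Fact (Nat.card (G ⧸ N)).Prime := by rw [← Subgroup.index, hN]; infer_instance
  rcases (H.map (QuotientGroup.mk' N)).eq_bot_or_eq_top_of_prime_card with h | h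
  · left
    rwa [Subgroup.map_eq_bot_iff, QuotientGroup.ker_mk'] at h
  · right
    intro s
    obtain ⟨g, hg, e⟩ := (h ▸ Subgroup.mem_top s : s ∈ H.map (QuotientGroup.mk' N))
    refine ⟨g, hg, ?_⟩
    rw [← e]
    exact congrArg (QuotientGroup.mk' N) (mul_one g)

omit [Field k] [Fact p.Prime] [CharP k p] in
lemma smul_coset_of_le {H : Subgroup G} (hH : H ≤ N) {h : G} (hh : h ∈ H) (s : G ⧸ N) :
    h • s = s := by
  induction s using QuotientGroup.induction_on with
  | H g =>
    refine (QuotientGroup.eq.2 ?_).symm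
    change g⁻¹ * (h * g) ∈ N
    simpa [mul_assoc] using ‹N.Normal›.conj_mem h (hH hh) g⁻¹

-- As `N` is normal, a subgroup of `N` acts trivially on `G/N`.
variable {N} in
omit [Fact p.Prime] [CharP k p] in
lemma mem_equivariants_of_le {H : Subgroup G} (hH : H ≤ N) {V : Rep.{u} k G} {f : G ⧸ N → V.V} :
    f ∈ equivariants H (G ⧸ N) V ↔ ∀ s, f s ∈ invs H V :=
  ⟨fun h s g hg => by rw [← h g hg, smul_coset_of_le N hH hg],
    fun h g hg s => by rw [h s g hg, smul_coset_of_le N hH hg]⟩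

omit [Fact p.Prime] [CharP k p] in
lemma translate_mem_equivariants {H : Subgroup G} {V : Rep.{u} k G} {f : G ⧸ N → V.V}
    (hf : f ∈ equivariants H (G ⧸ N) V) (σ : G ⧸ N) :
    (fun s => f (s * σ)) ∈ equivariants H (G ⧸ N) V := fun h hh s =>
  (congrArg f (smul_mul_coset N h s σ)).trans (hf h hh _)

variable [Fintype (G ⧸ N)]

-- There are `p` equal terms, and `p = 0` in `k`.
include hN in
omit [Fact p.Prime] [N.Normal] in
lemma sum_const_coset {V : Type*} [AddCommGroup V] [Module k V] (v : V) : ∑ _ : G ⧸ N, v = 0 := by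
  rw [Finset.sum_const, Finset.card_univ, ← Nat.card_eq_fintype_card, ← Subgroup.index, hN,
    ← Nat.cast_smul_eq_nsmul k, CharP.cast_eq_zero, zero_smul]

variable {N} (σ : G ⧸ N) (hσ : Subgroup.zpowers σ = ⊤)

-- The cyclic group lemma is applied to functions with values in the fixed vectors, so that the
-- primitive is again fixed by `H`.
include hσ in
lemma exists_translate_sub_eq {V : Rep.{u} k G} {H : Subgroup G} {F : G ⧸ N → V.V}
    (hF : ∀ s, F s ∈ invs H V) (h : ∑ s, F s = 0) :
    ∃ f : G ⧸ N → V.V, (∀ s, f s ∈ invs H V) ∧ ∀ s, f (s * σ⁻¹) - f s = F s := by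
  obtain ⟨f, hf⟩ := exists_sub_eq_of_sum_eq_zero σ hσ (fun s => (⟨F s, hF s⟩ : invs H V))
    (by ext; simpa using h)
  exact ⟨fun s => f s, fun s => (f s).2, fun s => congrArg Subtype.val (hf s)⟩

lemma eq_of_translate_eq {V : Type*} {f : G ⧸ N → V} (hσ : Subgroup.zpowers σ = ⊤)
    (hf : ∀ s, f (s * σ⁻¹) = f s) (s : G ⧸ N) : f s = f 1 := by
  obtain ⟨n, rfl⟩ := mem_powers_iff_mem_zpowers.2 (hσ ▸ Subgroup.mem_top s)
  induction n with
  | zero => simp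
  | succ n ih =>
    dsimp only at ih ⊢
    rw [← ih, ← hf, pow_succ, mul_inv_cancel_right]

lemma sum_translate_sub {V : Type*} [AddCommGroup V] (f : G ⧸ N → V) (τ : G ⧸ N) :
    ∑ s, (f (s * τ) - f s) = 0 := by
  rw [Finset.sum_sub_distrib, sub_eq_zero]
  exact Fintype.sum_equiv (Equiv.mulRight τ) _ _ fun _ => rfl

/-- The function supported at the unit coset. -/
lemma exists_sum_eq {H : Subgroup G} {V : Rep.{u} k G} {v : V.V} (hv : v ∈ invs H V) :
    ∃ f : G ⧸ N → V.V, (∀ s, f s ∈ invs H V) ∧ ∑ s, f s = v := by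
  classical
  refine ⟨Pi.single 1 v, fun s => ?_, by simp⟩
  by_cases h : s = 1
  · subst h; simpa using hv
  · simp [h]

include hN hσ in
/-- Splitting of cycles of `X ⊗ u_N` for odd `p`, in coordinates. -/
lemma RestrictionSurjective.split_odd {X : Cpx k G} (hX : RestrictionSurjective X)
    {H : Subgroup G} {m n n₁ n₂ n₃ : ℤ} (hm : m + 1 = n) (hn : n + 1 = n₁) (hn₁ : n₁ + 1 = n₂)
    (hn₂ : n₂ + 1 = n₃) (ε : ℤˣ) {x₀ : (X.X n).V} {x₁ : G ⧸ N → (X.X n₁).V}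
    {x₂ : G ⧸ N → (X.X n₂).V} (hx₀ : x₀ ∈ invs H (X.X n))
    (hx₁ : x₁ ∈ equivariants H (G ⧸ N) (X.X n₁)) (hx₂ : x₂ ∈ equivariants H (G ⧸ N) (X.X n₂))
    (hd₀ : dl X n n₁ x₀ = ε • ∑ s, x₁ s)
    (hd₁ : ∀ s, dl X n₁ n₂ (x₁ s) = -(ε • (x₂ (s * σ⁻¹) - x₂ s)))
    (hd₂ : ∀ s, dl X n₂ n₃ (x₂ s) = 0) :
    ∃ z₀ ∈ invs ⊤ (X.X n), ∃ z₁ ∈ invs ⊤ (X.X n₁), ∃ z₂ ∈ invs ⊤ (X.X n₂),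
      dl X n n₁ z₀ = 0 ∧ dl X n₁ n₂ z₁ = 0 ∧ dl X n₂ n₃ z₂ = 0 ∧
      ∃ w₀ ∈ invs H (X.X m), ∃ w₁ ∈ equivariants H (G ⧸ N) (X.X n),
        ∃ w₂ ∈ equivariants H (G ⧸ N) (X.X n₁),
          x₀ = z₀ + (dl X m n w₀ + ε • ∑ s, w₁ s) ∧
          (∀ s, x₁ s = z₁ + (dl X n n₁ (w₁ s) - ε • (w₂ (s * σ⁻¹) - w₂ s))) ∧
          ∀ s, x₂ s = z₂ + dl X n₁ n₂ (w₂ s) := by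
  rcases le_or_transitive p N hN H with hH | hH
  -- The case `H ≤ N`. The family `w₁` is chosen to have `x₀` as its contribution to the boundary,
  -- and `f` accounts for `x₁ - d w₁`, which has sum zero by the cycle condition. Only the lowest
  -- layer survives.
  · obtain ⟨w₁, hw₁, e₁⟩ := exists_sum_eq (N := N) (units_smul_mem _ ε hx₀)
    rw [mem_equivariants_of_le hH] at hx₁ hx₂
    obtain ⟨f, hf, ef⟩ := exists_translate_sub_eq σ hσ (H := H)
      (F := fun s => -(ε • (x₁ s - dl X n n₁ (w₁ s))))
      (fun s => neg_mem (units_smul_mem _ _ (sub_mem (hx₁ s) (dl_mem_invs X (hw₁ s) _))))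
      (by
        rw [Finset.sum_neg_distrib, ← Finset.smul_sum, Finset.sum_sub_distrib, ← map_sum, e₁,
          map_units_smul', hd₀, units_smul_smul_self, sub_self, smul_zero, neg_zero])
    -- The rest of `x₂` is invariant under translation by `σ`, hence constant; its value is an
    -- `H`-fixed cycle of `X`, to which the hypothesis applies.
    have hc := eq_of_translate_eq (f := fun s => x₂ s - dl X n₁ n₂ (f s)) σ hσ fun s => by
      have h1 := congrArg (dl X n₁ n₂) (ef s)
      rw [map_sub, map_neg, map_units_smul', map_sub, dl_dl, sub_zero, hd₁, smul_neg,
        units_smul_smul_self, neg_neg] at h1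
      rw [sub_eq_sub_iff_sub_eq_sub, h1]
    obtain ⟨z, hz, hdz, w, hw, e⟩ := hX H n₁ n₂ n₃ hn₁ hn₂ (x₂ 1 - dl X n₁ n₂ (f 1))
      (sub_mem (hx₂ 1) (dl_mem_invs X (hf 1) _)) (by rw [map_sub, dl_dl, hd₂, sub_zero])
    -- Adding the constant `w` to `f` changes none of its translation differences, so the correction
    -- of `x₁` is preserved.
    refine ⟨0, zero_mem _, 0, zero_mem _, z, hz, map_zero _, map_zero _, hdz, 0, zero_mem _, w₁,
      (mem_equivariants_of_le hH).2 hw₁, fun s => f s + w,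
      (mem_equivariants_of_le hH).2 fun s => add_mem (hf s) hw, ?_, fun s => ?_, fun s => ?_⟩
    · rw [e₁, units_smul_smul_self, map_zero, zero_add, zero_add]
    · rw [add_sub_add_right_eq_sub, ef, smul_neg, units_smul_smul_self]
      abel
    · have := hc s
      simp only [e] at this
      rw [map_add, add_left_comm, ← this]
      abel
  -- The case of a transitive `H`. The layers are split from the lowest degree of `u_N` upwards;
  -- once `d w₂` is taken out of `x₂`, the family `x₁` corrected by the translation difference of
  -- `w₂` consists of cycles, because `z₂` is constant and drops out of differences.
  · obtain ⟨z₂, hz₂, hdz₂, w₂, hw₂, e₂⟩ := hX.of_transitive 1 hH hn₁ hn₂ hx₂ hd₂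
    obtain ⟨z₁, hz₁, hdz₁, w₁, hw₁, e₁⟩ := hX.of_transitive 1 hH hn hn₁
      (x := x₁ + ε • ((fun s => w₂ (s * σ⁻¹)) - w₂))
      (add_mem hx₁ (units_smul_mem _ _ (sub_mem (translate_mem_equivariants N hw₂ _) hw₂)))
      (fun s => by
        simp only [Pi.add_apply, Pi.smul_apply, Pi.sub_apply, map_add, map_units_smul', map_sub]
        rw [hd₁, e₂, e₂, add_sub_add_left_eq_sub, neg_add_cancel])
    have e₁' (s) : x₁ s = z₁ + (dl X n n₁ (w₁ s) - ε • (w₂ (s * σ⁻¹) - w₂ s)) := by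
      rw [← add_sub_assoc, ← e₁]
      simp
    -- The remainder of `x₀` is a cycle: the constant family `z₁` has sum `p z₁ = 0`, and
    -- translation differences have sum zero.
    obtain ⟨z₀, hz₀, hdz₀, w₀, hw₀, e₀⟩ := hX H m n n₁ hm hn (x₀ - ε • ∑ s, w₁ s)
      (sub_mem hx₀ (units_smul_mem _ _ (sum_mem_invs hw₁))) (by
        rw [map_sub, hd₀, map_units_smul', map_sum, ← smul_sub, ← Finset.sum_sub_distrib,
          Finset.sum_congr rfl fun s _ => show x₁ s - dl X n n₁ (w₁ s) =
            z₁ - ε • (w₂ (s * σ⁻¹) - w₂ s) by rw [e₁']; abel,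
          Finset.sum_sub_distrib, sum_const_coset (k := k) p N hN, ← Finset.smul_sum,
          sum_translate_sub, smul_zero, sub_zero, smul_zero])
    refine ⟨z₀, hz₀, z₁, hz₁, z₂, hz₂, hdz₀, hdz₁, hdz₂, w₀, hw₀, w₁, hw₁, w₂, hw₂, ?_, e₁', e₂⟩
    rw [← add_assoc, ← e₀, sub_add_cancel]

include hN hσ in
/-- Splitting of cycles of `X ⊗ u_N` for `p = 2`, in coordinates. -/
lemma RestrictionSurjective.split_two (hp : p = 2) {X : Cpx k G} (hX : RestrictionSurjective X)
    {H : Subgroup G} {m n n₁ n₂ : ℤ} (hm : m + 1 = n) (hn : n + 1 = n₁) (hn₁ : n₁ + 1 = n₂)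
    (ε : ℤˣ) {x₀ : (X.X n).V} {x₁ : G ⧸ N → (X.X n₁).V} (hx₀ : x₀ ∈ invs H (X.X n))
    (hx₁ : x₁ ∈ equivariants H (G ⧸ N) (X.X n₁))
    (hd₀ : dl X n n₁ x₀ = ε • ∑ s, x₁ s) (hd₁ : ∀ s, dl X n₁ n₂ (x₁ s) = 0) :
    ∃ z₀ ∈ invs ⊤ (X.X n), ∃ z₁ ∈ invs ⊤ (X.X n₁), dl X n n₁ z₀ = 0 ∧ dl X n₁ n₂ z₁ = 0 ∧
      ∃ w₀ ∈ invs H (X.X m), ∃ w₁ ∈ equivariants H (G ⧸ N) (X.X n),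
          x₀ = z₀ + (dl X m n w₀ + ε • ∑ s, w₁ s) ∧ ∀ s, x₁ s = z₁ + dl X n n₁ (w₁ s) := by
  rcases le_or_transitive p N hN H with hH | hH
  · obtain ⟨w₁, hw₁, e₁⟩ := exists_sum_eq (N := N) (units_smul_mem _ ε hx₀)
    rw [mem_equivariants_of_le hH] at hx₁
    obtain ⟨f, hf, ef⟩ := exists_translate_sub_eq σ hσ (H := H)
      (F := fun s => x₁ s - dl X n n₁ (w₁ s))
      (fun s => sub_mem (hx₁ s) (dl_mem_invs X (hw₁ s) _))
      (by
        rw [Finset.sum_sub_distrib, ← map_sum, e₁, map_units_smul', hd₀, units_smul_smul_self,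
          sub_self])
    -- For `p = 2` a translation difference changes sign under translation by `σ`, and signs do not
    -- matter. So `x₁ - d w₁`, being such a difference, is constant; this takes the place of the
    -- argument with `x₂` for odd `p`.
    have hσ2 : σ⁻¹ * σ⁻¹ = 1 := by
      rw [← mul_inv_rev, inv_eq_one, ← sq, ← hp, ← hN]
      exact pow_card_eq_one'
    have hneg {V : Rep.{u} k G} (v : V.V) : -v = v := by
      subst hp
      rw [neg_eq_iff_add_eq_zero, ← two_smul k, CharTwo.two_eq_zero, zero_smul]
    have hc := eq_of_translate_eq (f := fun s => x₁ s - dl X n n₁ (w₁ s)) σ hσ fun s => by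
      simp only [← ef]
      rw [mul_assoc, hσ2, mul_one, ← neg_sub, hneg]
    obtain ⟨z, hz, hdz, w, hw, e⟩ := hX H n n₁ n₂ hn hn₁ (x₁ 1 - dl X n n₁ (w₁ 1))
      (sub_mem (hx₁ 1) (dl_mem_invs X (hw₁ 1) _)) (by rw [map_sub, dl_dl, hd₁, sub_zero])
    -- The constant `w` contributes `2 w = 0` to the sum, so the correction of `x₀` is preserved.
    refine ⟨0, zero_mem _, z, hz, map_zero _, hdz, 0, zero_mem _, fun s => w₁ s + w,
      (mem_equivariants_of_le hH).2 fun s => add_mem (hw₁ s) hw, ?_, fun s => ?_⟩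
    · rw [Finset.sum_add_distrib, sum_const_coset (k := k) p N hN, add_zero, e₁,
        units_smul_smul_self, map_zero, zero_add, zero_add]
    · have := hc s
      simp only [e] at this
      rw [map_add, add_left_comm, ← this]
      abel
  · obtain ⟨z₁, hz₁, hdz₁, w₁, hw₁, e₁⟩ := hX.of_transitive 1 hH hn hn₁ hx₁ hd₁
    obtain ⟨z₀, hz₀, hdz₀, w₀, hw₀, e₀⟩ := hX H m n n₁ hm hn (x₀ - ε • ∑ s, w₁ s)
      (sub_mem hx₀ (units_smul_mem _ _ (sum_mem_invs hw₁))) (by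
        rw [map_sub, hd₀, map_units_smul', map_sum, ← smul_sub, ← Finset.sum_sub_distrib,
          Finset.sum_congr rfl fun s _ => show x₁ s - dl X n n₁ (w₁ s) = z₁ by rw [e₁]; abel,
          sum_const_coset (k := k) p N hN, smul_zero])
    refine ⟨z₀, hz₀, z₁, hz₁, hdz₀, hdz₁, w₀, hw₀, w₁, hw₁, ?_, e₁⟩
    rw [← add_assoc, ← e₀, sub_add_cancel]

end
end TwistedCohomology

/-! ### Coordinates on `X ⊗ u_N`. -/

namespace TwistedCohomology
section
variable {k G : Type u} [Field k] [Group G]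

section
variable {S : Type*} [Fintype S] (X U : Cpx k G) {p q n : ℤ} (h : p + q = n)
  (e : S → (U.X q).V)

/-- The sum of the pure tensors `f s ⊗ e s`. -/
noncomputable def layer (f : S → (X.X p).V) : ((X ⊗ U).X n).V := ∑ s, ten X U p q n h (f s) (e s)

lemma layer_add (f g : S → (X.X p).V) : layer X U h e (f + g) = layer X U h e f + layer X U h e g := by
  simp [layer, Finset.sum_add_distrib]

/-- For the bases of `u_N` the sum on the right underlies `b_N` or `c_N`; this is how constant
families become products with generators. -/
lemma layer_const (x : (X.X p).V) : layer X U h e (fun _ => x) = ten X U p q n h x (∑ s, e s) :=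
  (map_sum (ten X U p q n h x) _ _).symm

variable {U e} in
lemma layer_rho [MulAction G S] (he : ∀ g s, (U.X q).ρ g (e s) = e (g • s)) (g : G)
    (f : S → (X.X p).V) :
    ((X ⊗ U).X n).ρ g (layer X U h e f) = layer X U h e fun s => (X.X p).ρ g (f (g⁻¹ • s)) := by
  simp only [layer, map_sum, ten_rho, he]
  exact Fintype.sum_equiv (MulAction.toPerm g) _ _ fun s => by simp

variable {U e} in
lemma layer_mem_invs [MulAction G S] (he : ∀ g s, (U.X q).ρ g (e s) = e (g • s)) {H : Subgroup G}
    {f : S → (X.X p).V} (hf : f ∈ equivariants H S (X.X p)) :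
    layer X U h e f ∈ invs H ((X ⊗ U).X n) := fun g hg => by
  rw [layer_rho X h he]
  refine congrArg _ (funext fun s => ?_)
  rw [← hf g hg, smul_inv_smul]

lemma dl_layer {p' q' n' : ℤ} (hp : p + 1 = p') (hq : q + 1 = q') (h₁ : p' + q = n')
    (h₂ : p + q' = n') (f : S → (X.X p).V) :
    dl (X ⊗ U) n n' (layer X U h e f) = layer X U h₁ e (fun s => dl X p p' (f s)) +
      p.negOnePow • ∑ s, ten X U p q' n' h₂ (f s) (dl U q q' (e s)) := by
  simp only [layer, map_sum, dl_ten X U p q n p' q' n' h hp hq h₁ h₂, Finset.sum_add_distrib,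
    Finset.smul_sum]

end

variable (odd : Bool) (N : Subgroup G) [N.Normal] (σ : G ⧸ N)

/-- The generator of the term `k` of `u_N`. -/
def vec₀ : ((uCpx (k := k) odd N σ).X 0).V := (1 : k)

/-- The basis of the term `k(G/N)` of `u_N` in degree `-1`. -/
noncomputable def vec₁ (s : G ⧸ N) : ((uCpx (k := k) odd N σ).X (-1)).V :=
  (MonoidAlgebra.single s (1 : k) : MonoidAlgebra k (G ⧸ N))

/-- The basis of the term `k(G/N)` of `u_N` in degree `-2`, for odd `p`. -/
noncomputable def vec₂ (s : G ⧸ N) : ((uCpx (k := k) true N σ).X (-2)).V :=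
  (MonoidAlgebra.single s (1 : k) : MonoidAlgebra k (G ⧸ N))

lemma vec₀_rho (g : G) : ((uCpx (k := k) odd N σ).X 0).ρ g (vec₀ odd N σ) = vec₀ odd N σ := rfl

lemma vec₁_rho (g : G) (s : G ⧸ N) :
    ((uCpx (k := k) odd N σ).X (-1)).ρ g (vec₁ odd N σ s) = vec₁ odd N σ (g • s) :=
  Representation.ofMulAction_single _ _ _

lemma vec₂_rho (g : G) (s : G ⧸ N) :
    ((uCpx (k := k) true N σ).X (-2)).ρ g (vec₂ N σ s) = vec₂ N σ (g • s) :=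
  Representation.ofMulAction_single _ _ _

lemma dl_vec₀ : dl (uCpx (k := k) odd N σ) 0 1 (vec₀ odd N σ) = 0 := rfl

lemma dl_vec₁ (s : G ⧸ N) : dl (uCpx (k := k) odd N σ) (-1) 0 (vec₁ odd N σ s) = vec₀ odd N σ :=
  aug_single N s

lemma tau_single (s : G ⧸ N) : (tau (k := k) N σ).hom (MonoidAlgebra.single s 1) =
    (MonoidAlgebra.single (s * σ) 1 - MonoidAlgebra.single s 1 : MonoidAlgebra k (G ⧸ N)) := by
  have h : (rightMul (k := k) N σ).hom (MonoidAlgebra.single s 1) =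
      (MonoidAlgebra.single (s * σ) 1 : MonoidAlgebra k (G ⧸ N)) := permLift_single _ _ s
  exact congrArg (fun v : MonoidAlgebra k (G ⧸ N) => v - MonoidAlgebra.single s 1) h

lemma dl_vec₂ (s : G ⧸ N) : dl (uCpx (k := k) true N σ) (-2) (-1) (vec₂ N σ s) =
    vec₁ true N σ (s * σ) - vec₁ true N σ s :=
  tau_single N σ s

lemma vec₀_span (v : ((uCpx (k := k) odd N σ).X 0).V) : ∃ c : k, v = c • vec₀ odd N σ :=
  ⟨v, (@mul_one k _ v).symm⟩

/-- The coordinates on the term `k(G/N)` of `u_N` in degree `-1`. -/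
noncomputable def coord₁ (s : G ⧸ N) : ((uCpx (k := k) odd N σ).X (-1)).V →ₗ[k] k :=
  (MonoidAlgebra.basis (G ⧸ N) k).coord s

/-- The coordinates on the term `k(G/N)` of `u_N` in degree `-2`, for odd `p`. -/
noncomputable def coord₂ (s : G ⧸ N) : ((uCpx (k := k) true N σ).X (-2)).V →ₗ[k] k :=
  (MonoidAlgebra.basis (G ⧸ N) k).coord s

/-- The coordinate on the term `k` of `u_N`. -/
noncomputable def coord₀ : ((uCpx (k := k) odd N σ).X 0).V →ₗ[k] k := (LinearMap.id : k →ₗ[k] k)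

open Classical in
lemma coord₁_vec₁ (s t : G ⧸ N) : coord₁ (k := k) odd N σ s (vec₁ odd N σ t) = if t = s then 1 else 0 :=
  (MonoidAlgebra.basis (G ⧸ N) k).repr_self_apply t s

open Classical in
lemma coord₂_vec₂ (s t : G ⧸ N) : coord₂ (k := k) N σ s (vec₂ N σ t) = if t = s then 1 else 0 := 
  coord₁_vec₁ true N σ s t

lemma sum_coord₁ [Fintype (G ⧸ N)] (v : ((uCpx (k := k) odd N σ).X (-1)).V) :
    v = ∑ s, coord₁ odd N σ s v • vec₁ odd N σ s :=
  ((MonoidAlgebra.basis (G ⧸ N) k).sum_repr v).symm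

lemma sum_coord₂ [Fintype (G ⧸ N)] (v : ((uCpx (k := k) true N σ).X (-2)).V) :
    v = ∑ s, coord₂ N σ s v • vec₂ N σ s :=
  ((MonoidAlgebra.basis (G ⧸ N) k).sum_repr v).symm

variable (X : Cpx k G)

/-- It suffices to treat pure tensors. The second factor is then expanded in the basis of its
degree, and `u_N` vanishes outside the degrees `-2`, `-1` and `0`. -/
lemma exists_eq_layers_odd [Fintype (G ⧸ N)] {n n₁ n₂ : ℤ} (h₀ : n + 0 = n) (h₁ : n₁ + -1 = n)
    (h₂ : n₂ + -2 = n) (y : ((X ⊗ uCpx true N σ).X n).V) :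
    ∃ x₀ x₁ x₂, y = ten X (uCpx true N σ) n 0 n h₀ x₀ (vec₀ true N σ) +
      layer X _ h₁ (vec₁ true N σ) x₁ + layer X _ h₂ (vec₂ N σ) x₂ := by
  induction y using ten_induction with
  | zero => exact ⟨0, 0, 0, by simp [layer]⟩
  | add v w hv hw =>
    obtain ⟨x₀, x₁, x₂, rfl⟩ := hv
    obtain ⟨y₀, y₁, y₂, rfl⟩ := hw
    refine ⟨x₀ + y₀, x₁ + y₁, x₂ + y₂, ?_⟩
    rw [layer_add, layer_add, map_add, LinearMap.add_apply]
    abel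
  | ten p q e x y =>
    -- The five cases are degree `0`, positive degree, degree `-1`, degree `-2`, and degree below
    -- `-2`.
    rcases q with (_ | q) | (_ | _ | q)
    · obtain rfl : p = n := by simpa using e
      obtain ⟨c, rfl⟩ := vec₀_span true N σ y
      refine ⟨c • x, 0, 0, ?_⟩
      simp [layer]
    · obtain rfl : y = 0 := Subsingleton.elim (h := (Rep.isZero_iff _ _ _).1 (isZero_zero _)) _ _
      exact ⟨0, 0, 0, by simp [layer]⟩
    · obtain rfl : p = n₁ := by omega
      refine ⟨0, fun s => coord₁ true N σ s y • x, 0, ?_⟩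
      conv_lhs => rw [sum_coord₁ true N σ y]
      simp [layer]
    · obtain rfl : p = n₂ := by omega
      refine ⟨0, 0, fun s => coord₂ N σ s y • x, ?_⟩
      conv_lhs => rw [sum_coord₂ N σ y]
      simp [layer]
    · obtain rfl : y = 0 := Subsingleton.elim (h := (Rep.isZero_iff _ _ _).1 (isZero_zero _)) _ _
      exact ⟨0, 0, 0, by simp [layer]⟩

lemma exists_eq_layers_two [Fintype (G ⧸ N)] {n n₁ : ℤ} (h₀ : n + 0 = n) (h₁ : n₁ + -1 = n)
    (y : ((X ⊗ uCpx false N σ).X n).V) :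
    ∃ x₀ x₁, y = ten X (uCpx false N σ) n 0 n h₀ x₀ (vec₀ false N σ) +
      layer X _ h₁ (vec₁ false N σ) x₁ := by
  induction y using ten_induction with
  | zero => exact ⟨0, 0, by simp [layer]⟩
  | add v w hv hw =>
    obtain ⟨x₀, x₁, rfl⟩ := hv
    obtain ⟨y₀, y₁, rfl⟩ := hw
    refine ⟨x₀ + y₀, x₁ + y₁, ?_⟩
    rw [layer_add, map_add, LinearMap.add_apply]
    abel
  | ten p q e x y =>
    rcases q with (_ | q) | (_ | _ | q)
    · obtain rfl : p = n := by simpa using e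
      obtain ⟨c, rfl⟩ := vec₀_span false N σ y
      refine ⟨c • x, 0, ?_⟩
      simp [layer]
    · obtain rfl : y = 0 := Subsingleton.elim (h := (Rep.isZero_iff _ _ _).1 (isZero_zero _)) _ _
      exact ⟨0, 0, by simp [layer]⟩
    · obtain rfl : p = n₁ := by omega
      refine ⟨0, fun s => coord₁ false N σ s y • x, ?_⟩
      conv_lhs => rw [sum_coord₁ false N σ y]
      simp [layer]
    · obtain rfl : y = 0 := Subsingleton.elim (h := (Rep.isZero_iff _ _ _).1 (isZero_zero _)) _ _
      exact ⟨0, 0, by simp [layer]⟩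
    · obtain rfl : y = 0 := Subsingleton.elim (h := (Rep.isZero_iff _ _ _).1 (isZero_zero _)) _ _
      exact ⟨0, 0, by simp [layer]⟩

/-- Each coordinate is read off by contracting with a coordinate form of `u_N`; the layers in other
degrees are annihilated. -/
lemma layers_injective_odd [Fintype (G ⧸ N)] {n n₁ n₂ : ℤ} (h₀ : n + 0 = n) (h₁ : n₁ + -1 = n)
    (h₂ : n₂ + -2 = n) {x₀ y₀ : (X.X n).V} {x₁ y₁ : G ⧸ N → (X.X n₁).V}
    {x₂ y₂ : G ⧸ N → (X.X n₂).V}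
    (h : ten X (uCpx true N σ) n 0 n h₀ x₀ (vec₀ true N σ) +
        layer X _ h₁ (vec₁ true N σ) x₁ + layer X _ h₂ (vec₂ N σ) x₂ =
      ten X (uCpx true N σ) n 0 n h₀ y₀ (vec₀ true N σ) +
        layer X _ h₁ (vec₁ true N σ) y₁ + layer X _ h₂ (vec₂ N σ) y₂) :
    x₀ = y₀ ∧ x₁ = y₁ ∧ x₂ = y₂ := by
  refine ⟨?_, funext fun s => ?_, funext fun s => ?_⟩
  · obtain ⟨π, h1, h2⟩ := exists_contraction X (uCpx true N σ) n 0 n h₀ (coord₀ true N σ)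
    have e := congrArg π h
    simp only [map_add, h1, layer, map_sum, h2 _ _ _ _ _ (show n₁ ≠ n by omega),
      h2 _ _ _ _ _ (show n₂ ≠ n by omega), Finset.sum_const_zero, add_zero] at e
    exact (one_smul k x₀).symm.trans (e.trans (one_smul k y₀))
  · obtain ⟨π, h1, h2⟩ := exists_contraction X (uCpx true N σ) n₁ (-1) n h₁ (coord₁ true N σ s)
    have e := congrArg π h
    classical
    simpa [map_add, h1, layer, map_sum, h2 _ _ _ _ _ (show n ≠ n₁ by omega), coord₁_vec₁,
      h2 _ _ _ _ _ (show n₂ ≠ n₁ by omega)] using e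
  · obtain ⟨π, h1, h2⟩ := exists_contraction X (uCpx true N σ) n₂ (-2) n h₂ (coord₂ N σ s)
    have e := congrArg π h
    classical
    simpa [map_add, h1, layer, map_sum, h2 _ _ _ _ _ (show n ≠ n₂ by omega), coord₂_vec₂,
      h2 _ _ _ _ _ (show n₁ ≠ n₂ by omega)] using e

lemma layers_injective_two [Fintype (G ⧸ N)] {n n₁ : ℤ} (h₀ : n + 0 = n) (h₁ : n₁ + -1 = n)
    {x₀ y₀ : (X.X n).V} {x₁ y₁ : G ⧸ N → (X.X n₁).V}
    (h : ten X (uCpx false N σ) n 0 n h₀ x₀ (vec₀ false N σ) +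
        layer X _ h₁ (vec₁ false N σ) x₁ =
      ten X (uCpx false N σ) n 0 n h₀ y₀ (vec₀ false N σ) +
        layer X _ h₁ (vec₁ false N σ) y₁) :
    x₀ = y₀ ∧ x₁ = y₁ := by
  refine ⟨?_, funext fun s => ?_⟩
  · obtain ⟨π, h1, h2⟩ := exists_contraction X (uCpx false N σ) n 0 n h₀ (coord₀ false N σ)
    have e := congrArg π h
    simp only [map_add, h1, layer, map_sum, h2 _ _ _ _ _ (show n₁ ≠ n by omega),
      Finset.sum_const_zero, add_zero] at e
    exact (one_smul k x₀).symm.trans (e.trans (one_smul k y₀))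
  · obtain ⟨π, h1, h2⟩ := exists_contraction X (uCpx false N σ) n₁ (-1) n h₁ (coord₁ false N σ s)
    have e := congrArg π h
    classical
    simpa [map_add, h1, layer, map_sum, h2 _ _ _ _ _ (show n ≠ n₁ by omega), coord₁_vec₁] using e

/-- The vectors underlying `a_N`, `b_N` and `c_N`. -/
inductive IsGenerator [Fintype (G ⧸ N)] : (odd : Bool) → (q : ℤ) → ((uCpx (k := k) odd N σ).X q).V → Prop
  | bot (odd : Bool) : IsGenerator odd 0 (vec₀ odd N σ)
  | mid (odd : Bool) : IsGenerator odd (-1) (∑ s, vec₁ odd N σ s)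
  | top : IsGenerator true (-2) (∑ s, vec₂ N σ s)

/-- The span of the tensors `x ⊗ g`, where `x` is a `G`-fixed cycle and `g` is one of the vectors
underlying `a_N`, `b_N` and `c_N`. -/
noncomputable def splitCycles [Fintype (G ⧸ N)] (n : ℤ) : AddSubgroup ((X ⊗ uCpx odd N σ).X n).V :=
  AddSubgroup.closure {v | ∃ (p q : ℤ) (h : p + q = n) (x : (X.X p).V) (_ : x ∈ invs ⊤ (X.X p))
    (_ : ∀ j, dl X p j x = 0) (g : _) (_ : IsGenerator N σ odd q g), v = ten X _ p q n h x g}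

variable {X N odd} in
lemma mem_splitCycles [Fintype (G ⧸ N)] {p q n : ℤ} (h : p + q = n) {x : (X.X p).V}
    (hx : x ∈ invs ⊤ (X.X p)) {p' : ℤ} (hp : p + 1 = p') (hd : dl X p p' x = 0)
    {g : ((uCpx (k := k) odd N σ).X q).V} (hg : IsGenerator N σ odd q g) :
    ten X _ p q n h x g ∈ splitCycles odd N σ X n := by
  refine AddSubgroup.subset_closure ⟨p, q, h, x, hx, fun j => ?_, g, hg, rfl⟩
  by_cases hj : p + 1 = j
  · rw [← hj, hp, hd]
  · exact dl_shape X p j hj x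

lemma sum_orbit_mem_invs {S : Type*} [MulAction G S] [Fintype S] {V : Rep.{u} k G} {e : S → V.V}
    (he : ∀ g s, V.ρ g (e s) = e (g • s)) (H : Subgroup G) : ∑ s, e s ∈ invs H V :=
  sum_mem_invs fun g _ s => (he g s).symm

variable {σ N odd} in
lemma IsGenerator.mem_invs [Fintype (G ⧸ N)] {q : ℤ} {g : ((uCpx (k := k) odd N σ).X q).V}
    (hg : IsGenerator N σ odd q g) (H : Subgroup G) : g ∈ invs H ((uCpx (k := k) odd N σ).X q) := by
  cases hg with
  | bot => exact fun h _ => rfl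
  | mid => exact sum_orbit_mem_invs (vec₁_rho _ N σ) H
  | top => exact sum_orbit_mem_invs (vec₂_rho N σ) H

variable (p : ℕ) [CharP k p]

-- The sum in degree `-1` is sent to `p` times `vec₀`, and the sum in degree `-2` to a sum of
-- translation differences; both vanish.
variable {σ N odd} in
include p in
lemma IsGenerator.cycle [Fintype (G ⧸ N)] (hN : N.index = p) {q : ℤ}
    {g : ((uCpx (k := k) odd N σ).X q).V} (hg : IsGenerator N σ odd q g) (j : ℤ) :
    dl (uCpx (k := k) odd N σ) q j g = 0 := by
  by_cases hj : q + 1 = j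
  swap
  · exact dl_shape _ _ _ hj _
  subst hj
  cases hg with
  | bot => exact dl_vec₀ _ N σ
  | mid =>
    refine (map_sum (dl (uCpx (k := k) _ N σ) (-1) 0) _ _).trans ?_
    simp only [dl_vec₁]
    exact sum_const_coset (k := k) p N hN _
  | top =>
    refine (map_sum (dl (uCpx (k := k) true N σ) (-2) (-1)) _ _).trans ?_
    simp only [dl_vec₂]
    exact sum_translate_sub (vec₁ true N σ) σ

-- By the Leibniz rule, products of fixed cycles are fixed cycles. This makes the split part of an
-- `H`-fixed cycle come from the `G`-fixed points.
variable {σ N odd X} in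
include p in
lemma cycle_of_mem_splitCycles [Fintype (G ⧸ N)] (hN : N.index = p) {n : ℤ}
    {v : ((X ⊗ uCpx odd N σ).X n).V} (hv : v ∈ splitCycles odd N σ X n) :
    v ∈ invs ⊤ ((X ⊗ uCpx odd N σ).X n) ∧ ∀ j, dl (X ⊗ uCpx odd N σ) n j v = 0 := by
  induction hv using AddSubgroup.closure_induction with
  | zero => exact ⟨zero_mem _, fun j => map_zero _⟩
  | add v w _ _ hv hw =>
    exact ⟨add_mem hv.1 hw.1, fun j => by rw [map_add, hv.2, hw.2, add_zero]⟩
  | neg v _ hv => exact ⟨neg_mem hv.1, fun j => by rw [map_neg, hv.2, neg_zero]⟩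
  | mem v hv =>
    obtain ⟨p', q, h, x, hx, hd, g, hg, rfl⟩ := hv
    refine ⟨ten_mem_invs _ _ hx (hg.mem_invs _) _ _, fun j => ?_⟩
    by_cases hj : n + 1 = j
    · rw [dl_ten X _ p' q n _ _ j h rfl rfl (by omega) (by omega), hd, hg.cycle p hN]
      simp
    · exact dl_shape _ _ _ hj _

end
end TwistedCohomology

/-! ### The differential in coordinates and the splitting theorem. -/

namespace TwistedCohomology
section
variable {k G : Type u} [Field k] [Group G] {N : Subgroup G} [N.Normal] {σ : G ⧸ N}
  [Fintype (G ⧸ N)] {X : Cpx k G}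

lemma sum_ten {S : Type*} [Fintype S] (X U : Cpx k G) {p q n : ℤ} (h : p + q = n)
    (f : S → (X.X p).V) (v : (U.X q).V) :
    ∑ s, ten X U p q n h (f s) v = ten X U p q n h (∑ s, f s) v := by
  rw [map_sum, LinearMap.sum_apply]

variable (X σ) in
/-- The element of `X ⊗ u_N` with given coordinates, for odd `p`. -/
noncomputable def layersOdd {n n₁ n₂ : ℤ} (hn : n + 1 = n₁) (hn₁ : n₁ + 1 = n₂) (x₀ : (X.X n).V)
    (x₁ : G ⧸ N → (X.X n₁).V) (x₂ : G ⧸ N → (X.X n₂).V) : ((X ⊗ uCpx true N σ).X n).V :=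
  ten X (uCpx true N σ) n 0 n (by omega) x₀ (vec₀ true N σ) +
    layer X _ (by omega) (vec₁ true N σ) x₁ + layer X _ (by omega) (vec₂ N σ) x₂

variable (X σ) in
/-- The element of `X ⊗ u_N` with given coordinates, for `p = 2`. -/
noncomputable def layersTwo {n n₁ : ℤ} (hn : n + 1 = n₁) (x₀ : (X.X n).V)
    (x₁ : G ⧸ N → (X.X n₁).V) : ((X ⊗ uCpx false N σ).X n).V :=
  ten X (uCpx false N σ) n 0 n (by omega) x₀ (vec₀ false N σ) +
    layer X _ (by omega) (vec₁ false N σ) x₁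

lemma dl_ten_vec₀ (odd : Bool) {n n₁ : ℤ} (hn : n + 1 = n₁) (h : n + 0 = n) (h' : n₁ + 0 = n₁)
    (x : (X.X n).V) :
    dl (X ⊗ uCpx odd N σ) n n₁ (ten X (uCpx odd N σ) n 0 n h x (vec₀ odd N σ)) =
      ten X (uCpx odd N σ) n₁ 0 n₁ h' (dl X n n₁ x) (vec₀ odd N σ) := by
  rw [dl_ten X _ n 0 n n₁ 1 n₁ h hn rfl h' hn, dl_vec₀, map_zero, smul_zero, add_zero]

lemma dl_layer_vec₁ (odd : Bool) {n n₁ n₂ : ℤ} (hn : n + 1 = n₁) (hn₁ : n₁ + 1 = n₂)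
    (h : n₁ + -1 = n) (h' : n₂ + -1 = n₁) (h₀ : n₁ + 0 = n₁) (x : G ⧸ N → (X.X n₁).V) :
    dl (X ⊗ uCpx odd N σ) n n₁ (layer X _ h (vec₁ odd N σ) x) =
      ten X (uCpx odd N σ) n₁ 0 n₁ h₀ (n₁.negOnePow • ∑ s, x s) (vec₀ odd N σ) +
      layer X _ h' (vec₁ odd N σ) (fun s => dl X n₁ n₂ (x s)) := by
  rw [dl_layer X _ h _ hn₁ (by rfl : (-1 : ℤ) + 1 = 0) h' h₀, add_comm]
  simp only [dl_vec₁, sum_ten]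
  rw [map_units_smul']
  refine congrArg₂ (· + ·) ?_ rfl
  rcases Int.units_eq_one_or n₁.negOnePow with e | e <;> rw [e] <;> simp

/-- Summation by parts: multiplication by `σ` on the basis becomes multiplication by `σ⁻¹` in the
argument of the coefficients. This is why `σ⁻¹` occurs in all coordinate formulas. -/
lemma sum_ten_translate (X U : Cpx k G) {p q n : ℤ} (h : p + q = n) (e : G ⧸ N → (U.X q).V)
    (x : G ⧸ N → (X.X p).V) :
    ∑ s, ten X U p q n h (x s) (e (s * σ) - e s) = layer X U h e fun s => x (s * σ⁻¹) - x s := by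
  simp only [layer, map_sub, LinearMap.sub_apply, Finset.sum_sub_distrib]
  refine congrArg₂ _ ?_ rfl
  exact Fintype.sum_equiv (Equiv.mulRight σ) _ _ fun s => by simp

lemma layer_units_smul {S : Type*} [Fintype S] (X U : Cpx k G) {p q n : ℤ} (h : p + q = n)
    (e : S → (U.X q).V) (z : ℤˣ) (x : S → (X.X p).V) :
    layer X U h e (fun s => z • x s) = z • layer X U h e x := by
  rcases Int.units_eq_one_or z with rfl | rfl
  · simp
  · simp [layer]

lemma dl_layer_vec₂ {n n₁ n₂ n₃ : ℤ} (hn : n + 1 = n₁) (hn₁ : n₁ + 1 = n₂) (hn₂ : n₂ + 1 = n₃)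
    (h : n₂ + -2 = n) (h' : n₃ + -2 = n₁) (h₀ : n₂ + -1 = n₁) (x : G ⧸ N → (X.X n₂).V) :
    dl (X ⊗ uCpx true N σ) n n₁ (layer X _ h (vec₂ N σ) x) =
      layer X _ h₀ (vec₁ true N σ) (fun s => n₂.negOnePow • (x (s * σ⁻¹) - x s)) +
      layer X _ h' (vec₂ N σ) (fun s => dl X n₂ n₃ (x s)) := by
  rw [dl_layer X _ h _ hn₂ (by rfl : (-2 : ℤ) + 1 = -1) h' h₀, add_comm, layer_units_smul]
  simp only [dl_vec₂, sum_ten_translate]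

/-- The signs come from the degree of the coordinate in `X`, not from the total degree `n`; hence
two consecutive signs occur. -/
lemma dl_layersOdd {n n₁ n₂ n₃ : ℤ} (hn : n + 1 = n₁) (hn₁ : n₁ + 1 = n₂) (hn₂ : n₂ + 1 = n₃)
    (x₀ : (X.X n).V) (x₁ : G ⧸ N → (X.X n₁).V) (x₂ : G ⧸ N → (X.X n₂).V) :
    dl (X ⊗ uCpx true N σ) n n₁ (layersOdd σ X hn hn₁ x₀ x₁ x₂) =
      layersOdd σ X hn₁ hn₂ (dl X n n₁ x₀ + n₁.negOnePow • ∑ s, x₁ s)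
        (fun s => dl X n₁ n₂ (x₁ s) + n₂.negOnePow • (x₂ (s * σ⁻¹) - x₂ s))
        (fun s => dl X n₂ n₃ (x₂ s)) := by
  have e := layer_add X (uCpx true N σ) (show n₂ + -1 = n₁ by omega) (vec₁ true N σ)
    (fun s => dl X n₁ n₂ (x₁ s)) (fun s => n₂.negOnePow • (x₂ (s * σ⁻¹) - x₂ s))
  simp only [layersOdd, map_add, LinearMap.add_apply]
  rw [dl_ten_vec₀ true hn _ (by omega), dl_layer_vec₁ true hn hn₁ _ (by omega) (by omega),
    dl_layer_vec₂ hn hn₁ hn₂ _ (by omega) (by omega)]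
  refine Eq.trans ?_ (congrArg (fun v => _ + v + _) e.symm)
  abel

lemma dl_layersTwo {n n₁ n₂ : ℤ} (hn : n + 1 = n₁) (hn₁ : n₁ + 1 = n₂)
    (x₀ : (X.X n).V) (x₁ : G ⧸ N → (X.X n₁).V) :
    dl (X ⊗ uCpx false N σ) n n₁ (layersTwo σ X hn x₀ x₁) =
      layersTwo σ X hn₁ (dl X n n₁ x₀ + n₁.negOnePow • ∑ s, x₁ s)
        (fun s => dl X n₁ n₂ (x₁ s)) := by
  simp only [layersTwo, map_add, LinearMap.add_apply]
  rw [dl_ten_vec₀ false hn _ (by omega), dl_layer_vec₁ false hn hn₁ _ (by omega) (by omega)]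
  abel

lemma layersOdd_inj {n n₁ n₂ : ℤ} {hn : n + 1 = n₁} {hn₁ : n₁ + 1 = n₂} {x₀ y₀ : (X.X n).V}
    {x₁ y₁ : G ⧸ N → (X.X n₁).V} {x₂ y₂ : G ⧸ N → (X.X n₂).V}
    (h : layersOdd σ X hn hn₁ x₀ x₁ x₂ = layersOdd σ X hn hn₁ y₀ y₁ y₂) :
    x₀ = y₀ ∧ x₁ = y₁ ∧ x₂ = y₂ := layers_injective_odd N σ X _ _ _ h

lemma layersTwo_inj {n n₁ : ℤ} {hn : n + 1 = n₁} {x₀ y₀ : (X.X n).V} {x₁ y₁ : G ⧸ N → (X.X n₁).V}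
    (h : layersTwo σ X hn x₀ x₁ = layersTwo σ X hn y₀ y₁) : x₀ = y₀ ∧ x₁ = y₁ :=
  layers_injective_two N σ X _ _ h

lemma layersOdd_zero {n n₁ n₂ : ℤ} (hn : n + 1 = n₁) (hn₁ : n₁ + 1 = n₂) :
    layersOdd σ X hn hn₁ 0 0 0 = 0 := by simp [layersOdd, layer]

lemma layersTwo_zero {n n₁ : ℤ} (hn : n + 1 = n₁) : layersTwo σ X hn 0 0 = 0 := by
  simp [layersTwo, layer]

lemma layersOdd_add {n n₁ n₂ : ℤ} (hn : n + 1 = n₁) (hn₁ : n₁ + 1 = n₂) (x₀ y₀ : (X.X n).V)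
    (x₁ y₁ : G ⧸ N → (X.X n₁).V) (x₂ y₂ : G ⧸ N → (X.X n₂).V) :
    layersOdd σ X hn hn₁ (x₀ + y₀) (x₁ + y₁) (x₂ + y₂) =
      layersOdd σ X hn hn₁ x₀ x₁ x₂ + layersOdd σ X hn hn₁ y₀ y₁ y₂ := by
  simp only [layersOdd, layer_add, map_add, LinearMap.add_apply]
  abel

lemma layersTwo_add {n n₁ : ℤ} (hn : n + 1 = n₁) (x₀ y₀ : (X.X n).V)
    (x₁ y₁ : G ⧸ N → (X.X n₁).V) :
    layersTwo σ X hn (x₀ + y₀) (x₁ + y₁) = layersTwo σ X hn x₀ x₁ + layersTwo σ X hn y₀ y₁ := by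
  simp only [layersTwo, layer_add, map_add, LinearMap.add_apply]
  abel

lemma layersOdd_rho {n n₁ n₂ : ℤ} (hn : n + 1 = n₁) (hn₁ : n₁ + 1 = n₂) (g : G) (x₀ : (X.X n).V)
    (x₁ : G ⧸ N → (X.X n₁).V) (x₂ : G ⧸ N → (X.X n₂).V) :
    ((X ⊗ uCpx true N σ).X n).ρ g (layersOdd σ X hn hn₁ x₀ x₁ x₂) =
      layersOdd σ X hn hn₁ ((X.X n).ρ g x₀) (fun s => (X.X n₁).ρ g (x₁ (g⁻¹ • s)))
        (fun s => (X.X n₂).ρ g (x₂ (g⁻¹ • s))) := by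
  simp only [layersOdd, map_add, ten_rho, layer_rho X _ (vec₁_rho true N σ),
    layer_rho X _ (vec₂_rho N σ), vec₀_rho]

lemma layersTwo_rho {n n₁ : ℤ} (hn : n + 1 = n₁) (g : G) (x₀ : (X.X n).V)
    (x₁ : G ⧸ N → (X.X n₁).V) :
    ((X ⊗ uCpx false N σ).X n).ρ g (layersTwo σ X hn x₀ x₁) =
      layersTwo σ X hn ((X.X n).ρ g x₀) (fun s => (X.X n₁).ρ g (x₁ (g⁻¹ • s))) := by
  simp only [layersTwo, map_add, ten_rho, layer_rho X _ (vec₁_rho false N σ), vec₀_rho]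

lemma mem_equivariants_of_eq {H : Subgroup G} {S : Type*} [MulAction G S] {V : Rep.{u} k G}
    {f : S → V.V} (h : ∀ g ∈ H, (fun s => V.ρ g (f (g⁻¹ • s))) = f) : f ∈ equivariants H S V :=
  fun g hg s => by
    conv_lhs => rw [← h g hg]
    simp

/-- The group permutes the bases of `u_N`, so by uniqueness of coordinates an element is fixed
exactly when its families are equivariant. -/
lemma layersOdd_mem_invs {n n₁ n₂ : ℤ} {hn : n + 1 = n₁} {hn₁ : n₁ + 1 = n₂} {H : Subgroup G}
    {x₀ : (X.X n).V} {x₁ : G ⧸ N → (X.X n₁).V} {x₂ : G ⧸ N → (X.X n₂).V} :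
    layersOdd σ X hn hn₁ x₀ x₁ x₂ ∈ invs H ((X ⊗ uCpx true N σ).X n) ↔ x₀ ∈ invs H (X.X n) ∧
      x₁ ∈ equivariants H (G ⧸ N) (X.X n₁) ∧ x₂ ∈ equivariants H (G ⧸ N) (X.X n₂) := by
  refine ⟨fun h => ?_, fun ⟨h0, h1, h2⟩ => add_mem (add_mem (ten_mem_invs _ _ h0
    (fun _ _ => rfl) _ _) (layer_mem_invs _ _ (vec₁_rho _ _ _) h1))
    (layer_mem_invs _ _ (vec₂_rho _ _) h2)⟩
  have h' g (hg : g ∈ H) := layersOdd_inj ((layersOdd_rho hn hn₁ g x₀ x₁ x₂).symm.trans (h g hg))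
  exact ⟨fun g hg => (h' g hg).1, mem_equivariants_of_eq fun g hg => (h' g hg).2.1,
    mem_equivariants_of_eq fun g hg => (h' g hg).2.2⟩

lemma layersTwo_mem_invs {n n₁ : ℤ} {hn : n + 1 = n₁} {H : Subgroup G}
    {x₀ : (X.X n).V} {x₁ : G ⧸ N → (X.X n₁).V} :
    layersTwo σ X hn x₀ x₁ ∈ invs H ((X ⊗ uCpx false N σ).X n) ↔ x₀ ∈ invs H (X.X n) ∧
      x₁ ∈ equivariants H (G ⧸ N) (X.X n₁) := by
  refine ⟨fun h => ?_, fun ⟨h0, h1⟩ => add_mem (ten_mem_invs _ _ h0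
    (fun _ _ => rfl) _ _) (layer_mem_invs _ _ (vec₁_rho _ _ _) h1)⟩
  have h' g (hg : g ∈ H) := layersTwo_inj ((layersTwo_rho hn g x₀ x₁).symm.trans (h g hg))
  exact ⟨fun g hg => (h' g hg).1, mem_equivariants_of_eq fun g hg => (h' g hg).2⟩

/-- Every `H`-fixed cycle of `X ⊗ u_N` is a sum of products of `G`-fixed cycles of `X` with the
generators, up to the boundary of an `H`-fixed element. -/
theorem RestrictionSurjective.exists_splitCycles (p : ℕ) [Fact p.Prime] [CharP k p]
    (hN : N.index = p) (hσ : Subgroup.zpowers σ = ⊤) (odd : Bool) (hodd : odd = false → p = 2)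
    (hX : RestrictionSurjective X) (H : Subgroup G) {m n n₁ : ℤ} (hm : m + 1 = n) (hn : n + 1 = n₁)
    (y : ((X ⊗ uCpx odd N σ).X n).V) (hy : y ∈ invs H ((X ⊗ uCpx odd N σ).X n))
    (hd : dl (X ⊗ uCpx odd N σ) n n₁ y = 0) :
    ∃ t ∈ splitCycles odd N σ X n, ∃ w ∈ invs H ((X ⊗ uCpx odd N σ).X m),
      y = t + dl (X ⊗ uCpx odd N σ) m n w := by
  -- All signs are expressed through the single sign `(-1)^n`, the `ε` of the coordinate lemmas.
  have s1 : n₁.negOnePow = -n.negOnePow := by rw [← hn, Int.negOnePow_succ]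
  obtain ⟨n₂, hn₁⟩ : ∃ n₂, n₁ + 1 = n₂ := ⟨_, rfl⟩
  cases odd with
  | true =>
    obtain ⟨n₃, hn₂⟩ : ∃ n₃, n₂ + 1 = n₃ := ⟨_, rfl⟩
    have s2 : n₂.negOnePow = n.negOnePow := by rw [← hn₁, Int.negOnePow_succ, s1, neg_neg]
    obtain ⟨x₀, x₁, x₂, rfl⟩ : ∃ x₀ x₁ x₂, y = layersOdd σ X hn hn₁ x₀ x₁ x₂ :=
      exists_eq_layers_odd N σ X _ _ _ y
    obtain ⟨hx₀, hx₁, hx₂⟩ := layersOdd_mem_invs.1 hy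
    rw [dl_layersOdd hn hn₁ hn₂, ← layersOdd_zero hn₁ hn₂] at hd
    obtain ⟨e₀, e₁, e₂⟩ := layersOdd_inj hd
    rw [s1, Units.neg_smul, ← sub_eq_add_neg, sub_eq_zero] at e₀
    simp only [s2] at e₁
    obtain ⟨z₀, hz₀, z₁, hz₁, z₂, hz₂, d₀, d₁, d₂, w₀, hw₀, w₁, hw₁, w₂, hw₂, f₀, f₁, f₂⟩ :=
      hX.split_odd p hN σ hσ hm hn hn₁ hn₂ n.negOnePow hx₀ hx₁ hx₂ e₀
        (fun s => eq_neg_of_add_eq_zero_left (congrFun e₁ s)) (congrFun e₂)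
    refine ⟨layersOdd σ X hn hn₁ z₀ (fun _ => z₁) (fun _ => z₂), ?_,
      layersOdd σ X hm hn w₀ w₁ w₂, layersOdd_mem_invs.2 ⟨hw₀, hw₁, hw₂⟩, ?_⟩
    -- With constant families the three layers are the products with the three vectors in
    -- `IsGenerator`.
    · simp only [layersOdd, layer_const]
      exact add_mem (add_mem (mem_splitCycles σ _ hz₀ hn d₀ (.bot _))
        (mem_splitCycles σ _ hz₁ hn₁ d₁ (.mid _))) (mem_splitCycles σ _ hz₂ hn₂ d₂ .top)
    · rw [dl_layersOdd hm hn hn₁, ← layersOdd_add, s1]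
      simp only [Units.neg_smul, ← sub_eq_add_neg]
      rw [f₀]
      exact congrArg₂ _ (funext f₁) (funext f₂)
  | false =>
    obtain ⟨x₀, x₁, rfl⟩ : ∃ x₀ x₁, y = layersTwo σ X hn x₀ x₁ :=
      exists_eq_layers_two N σ X _ _ y
    obtain ⟨hx₀, hx₁⟩ := layersTwo_mem_invs.1 hy
    rw [dl_layersTwo hn hn₁, ← layersTwo_zero hn₁] at hd
    obtain ⟨e₀, e₁⟩ := layersTwo_inj hd
    rw [s1, Units.neg_smul, ← sub_eq_add_neg, sub_eq_zero] at e₀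
    obtain ⟨z₀, hz₀, z₁, hz₁, d₀, d₁, w₀, hw₀, w₁, hw₁, f₀, f₁⟩ :=
      hX.split_two p hN σ hσ (hodd rfl) hm hn hn₁ n.negOnePow hx₀ hx₁ e₀ (congrFun e₁)
    refine ⟨layersTwo σ X hn z₀ (fun _ => z₁), ?_,
      layersTwo σ X hm w₀ w₁, layersTwo_mem_invs.2 ⟨hw₀, hw₁⟩, ?_⟩
    · simp only [layersTwo, layer_const]
      exact add_mem (mem_splitCycles σ _ hz₀ hn d₀ (.bot _))
        (mem_splitCycles σ _ hz₁ hn₁ d₁ (.mid _))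
    · rw [dl_layersTwo hm hn, ← layersTwo_add, f₀]
      exact congrArg _ (funext f₁)

/-- The split part given by `exists_splitCycles` is a `G`-fixed cycle, which is what surjectivity of
restriction asks for. -/
theorem RestrictionSurjective.tensor (p : ℕ) [Fact p.Prime] [CharP k p]
    (hN : N.index = p) (hσ : Subgroup.zpowers σ = ⊤) (odd : Bool) (hodd : odd = false → p = 2)
    (hX : RestrictionSurjective X) : RestrictionSurjective (X ⊗ uCpx odd N σ) := by
  intro H m n n' hm hn y hy hd
  obtain ⟨t, ht, w, hw, e⟩ := hX.exists_splitCycles p hN hσ odd hodd H hm hn y hy hd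
  obtain ⟨h1, h2⟩ := cycle_of_mem_splitCycles p hN ht
  exact ⟨t, h1, h2 _, w, hw, e⟩

omit [N.Normal] [Fintype (G ⧸ N)] in
lemma RestrictionSurjective.of_iso {Y : Cpx k G} (hX : RestrictionSurjective X) (e : X ≅ Y) :
    RestrictionSurjective Y := by
  intro H m n n' hm hn y hy hd
  obtain ⟨z, hz, hdz, w, hw, h⟩ := hX H m n n' hm hn (fl e.inv n y) (fl_mem_invs _ hy)
    (by rw [← fl_dl, hd, map_zero])
  refine ⟨fl e.hom n z, fl_mem_invs _ hz, by rw [← fl_dl, hdz, map_zero], fl e.hom m w,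
    fl_mem_invs _ hw, ?_⟩
  rw [← fl_dl, ← map_add, ← h, fl_hom_inv]

variable (k G) in
lemma unit_span (v : ((𝟙_ (Cpx k G)).X 0).V) : ∃ c : k, v = c • oneU k G := by
  refine ⟨(singleObjXSelf (.up ℤ) 0 (𝟙_ (Rep k G))).hom.hom v, ?_⟩
  have h := hom_congr (singleObjXSelf (.up ℤ) 0 (𝟙_ (Rep k G))).hom_inv_id v
  refine h.symm.trans ?_
  refine Eq.trans ?_ (map_smul (singleObjXSelf (.up ℤ) 0 (𝟙_ (Rep k G))).inv.hom.toLinearMap _ _)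
  exact congrArg (singleObjXSelf (.up ℤ) 0 (𝟙_ (Rep k G))).inv.hom (mul_one _).symm

-- On `k` every vector is already fixed by `G`, so no boundary is needed. This starts the induction.
variable (k G) in
lemma restrictionSurjective_unit : RestrictionSurjective (𝟙_ (Cpx k G)) := by
  intro H m n n' _ _ y hy hd
  refine ⟨y, ?_, hd, 0, zero_mem _, by rw [map_zero, add_zero]⟩
  by_cases hn : n = 0
  · subst hn
    obtain ⟨c, rfl⟩ := unit_span k G y
    exact Submodule.smul_mem _ _ fun g _ => oneU_rho g
  · have : IsZero ((𝟙_ (Cpx k G)).X n) :=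
      HomologicalComplex.isZero_single_obj_X (.up ℤ) 0 (𝟙_ (Rep.{u} k G)) n hn
    rw [Subsingleton.elim (h := (Rep.isZero_iff _ _ _).1 this) y 0]
    exact zero_mem _

end
end TwistedCohomology

/-! ### Invertibility of the products of a graded monoid object. -/

namespace GradedMon
variable {C : Type*} [Category* C] [MonoidalCategory C]

/-- The structure morphisms of a graded monoid object are isomorphisms. -/
structure IsStrong {M : Type*} [AddMonoid M] (A : GradedMon M C) : Prop where
  isIso_one : IsIso A.one
  isIso_mul (i j : M) : IsIso (A.mul i j)

lemma isIso_tpowMul (u : C) (i : ℕ) : ∀ j, IsIso (tpowMul u i j)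
  | 0 => inferInstanceAs (IsIso (ρ_ _).hom)
  | j + 1 => by
    have := isIso_tpowMul u i j
    exact inferInstanceAs (IsIso ((α_ _ _ _).inv ≫ tpowMul u i j ▷ u))

lemma isStrong_powers (u : C) : (powers u).IsStrong :=
  ⟨inferInstanceAs (IsIso (𝟙 _)), isIso_tpowMul u⟩

lemma IsStrong.comap {M N : Type*} [AddMonoid M] [AddMonoid N] (f : M →+ N) {A : GradedMon N C}
    (hA : A.IsStrong) : (A.comap f).IsStrong := by
  obtain ⟨h, h'⟩ := hA
  refine ⟨?_, fun i j => ?_⟩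
  · change IsIso (A.one ≫ eqToHom (congrArg A.X (map_zero f).symm))
    infer_instance
  · change IsIso (A.mul (f i) (f j) ≫ eqToHom (congrArg A.X (map_add f i j).symm))
    infer_instance

lemma isStrong_unit (M : Type*) [AddMonoid M] : (unit M : GradedMon M C).IsStrong :=
  ⟨inferInstanceAs (IsIso (𝟙 _)), fun _ _ => inferInstanceAs (IsIso (λ_ _).hom)⟩

lemma isIso_tensorμ [BraidedCategory C] (W X Y Z : C) : IsIso (tensorμ W X Y Z) := by
  unfold tensorμ
  infer_instance

lemma IsStrong.tensor [BraidedCategory C] {M : Type*} [AddMonoid M] {A B : GradedMon M C}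
    (hA : A.IsStrong) (hB : B.IsStrong) : (A.tensor B).IsStrong := by
  obtain ⟨h, h'⟩ := hA
  obtain ⟨l, l'⟩ := hB
  have := isIso_tensorμ (C := C)
  refine ⟨?_, fun i j => ?_⟩
  · change IsIso ((λ_ (𝟙_ C)).inv ≫ (A.one ⊗ₘ B.one))
    infer_instance
  · change IsIso (tensorμ _ _ _ _ ≫ (A.mul i j ⊗ₘ B.mul i j))
    infer_instance
end GradedMon

/-! ### Morphisms out of the unit as fixed cycles. -/

namespace TwistedCohomology
section
variable {k G : Type u} [Field k] [Group G]

/-- The vector of `X` that underlies a chain map `1 ⟶ X[s]`. -/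
noncomputable def vec {X : Cpx k G} {s : ℤ} (f : 𝟙_ (Cpx k G) ⟶ X⟦s⟧) : (X.X s).V :=
  (el f).hom (1 : k)

variable {X Y : Cpx k G} {s : ℤ}

lemma vec_injective {f g : 𝟙_ (Cpx k G) ⟶ X⟦s⟧} (h : vec f = vec g) : f = g :=
  el_injective (unit_hom_ext h)

lemma vec_add (f g : 𝟙_ (Cpx k G) ⟶ X⟦s⟧) : vec (f + g) = vec f + vec g :=
  hom_congr (el_add f g) (1 : k)

lemma vec_smul (a : k) (f : 𝟙_ (Cpx k G) ⟶ X⟦s⟧) : vec (a • f) = a • vec f :=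
  hom_congr (el_smul a f) (1 : k)

lemma vec_comp (f : 𝟙_ (Cpx k G) ⟶ X⟦s⟧) (φ : X ⟶ Y) : vec (f ≫ φ⟦s⟧') = fl φ s (vec f) :=
  hom_congr (el_comp f φ) (1 : k)

lemma vec_ofCycle (x : 𝟙_ (Rep.{u} k G) ⟶ X.X s) (h : x ≫ X.d s (s + 1) = 0) :
    vec (ofCycle s x h) = x.hom (1 : k) := hom_congr (el_ofCycle s x h) (1 : k)

/-- Together with `vec_injective`, this identifies chain maps `1 ⟶ X[s]` with `G`-fixed cycles. -/
lemma exists_vec_eq {v : (X.X s).V} (hv : v ∈ invs ⊤ (X.X s)) (hd : dl X s (s + 1) v = 0) :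
    ∃ f : 𝟙_ (Cpx k G) ⟶ X⟦s⟧, vec f = v :=
  ⟨ofCycle s (invLift v fun g => hv g trivial)
    (unit_hom_ext ((congrArg (X.d s (s + 1)).hom (invLift_one v _)).trans hd)),
    (vec_ofCycle _ _).trans (invLift_one v _)⟩

lemma vec_mem_invs (f : 𝟙_ (Cpx k G) ⟶ X⟦s⟧) (H : Subgroup G) : vec f ∈ invs H (X.X s) :=
  fun g _ => (Rep.hom_comm_apply (el f) g (1 : k)).symm

/-- The differential of `X[s]` is that of `X` up to the invertible factor `(-1)^s`, so compatibility
with differentials is the cycle condition. -/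
lemma el_comp_d (f : 𝟙_ (Cpx k G) ⟶ X⟦s⟧) (j : ℤ) (hj : s + 1 = j) : el f ≫ X.d s j = 0 := by
  have h1 := f.comm 0 1
  have h0 : (𝟙_ (Cpx k G)).d 0 1 = 0 := single_obj_d (.up ℤ) 0 (𝟙_ (Rep k G)) 0 1
  rw [h0, zero_comp, CochainComplex.shiftFunctor_obj_d'] at h1
  have h3 : f.f 0 ≫ X.d (0 + s) (1 + s) = 0 := by
    have h2 := congrArg (s.negOnePow • ·) ((Linear.comp_units_smul (f.f 0) s.negOnePow
      (X.d (0 + s) (1 + s))).symm.trans h1)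
    simp only [smul_smul, Int.units_mul_self, one_smul] at h2
    have hz (z : ℤˣ) : z • (0 : (𝟙_ (Cpx k G)).X 0 ⟶ X.X (1 + s)) = 0 := smul_zero z
    exact h2.trans (hz _)
  have h4 : (CochainComplex.shiftFunctorObjXIso X s 0 s (by simp)).hom ≫ X.d s (1 + s) =
      X.d (0 + s) (1 + s) := XIsoOfEq_hom_comp_d _ _ _
  obtain rfl : j = 1 + s := by omega
  rw [el, assoc, assoc, h4, h3, comp_zero]

lemma dl_vec (f : 𝟙_ (Cpx k G) ⟶ X⟦s⟧) (j : ℤ) : dl X s j (vec f) = 0 := by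
  by_cases hj : s + 1 = j
  · exact hom_congr (el_comp_d f j hj) (1 : k)
  · exact dl_shape _ _ _ hj _

/-- As the source lives in degree `0`, a homotopy is a single map into degree `-1`, and homotopic
maps need only be compared in degree `0`. -/
lemma homotopy_of_single {A : Rep.{u} k G} {Y : Cpx k G} {f g : (single _ (.up ℤ) 0).obj A ⟶ Y}
    (w : ((single _ (.up ℤ) 0).obj A).X 0 ⟶ Y.X (-1)) (h : f.f 0 = g.f 0 + w ≫ Y.d (-1) 0) :
    Nonempty (Homotopy f g) := by
  let H (i j : ℤ) (_ : (ComplexShape.up ℤ).Rel j i) : ((single _ (.up ℤ) 0).obj A).X i ⟶ Y.X j :=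
    if e : i = 0 ∧ j = -1 then eqToHom (by rw [e.1]) ≫ w ≫ eqToHom (by rw [e.2]) else 0
  have e : f - g = Homotopy.nullHomotopicMap' H := by
    apply HomologicalComplex.from_single_hom_ext
    rw [Homotopy.nullHomotopicMap'_f (k₂ := -1) (k₀ := 1) (by simp) (by simp),
      single_obj_d, zero_comp, zero_add, HomologicalComplex.sub_f_apply, h, add_sub_cancel_left]
    simp [H]
  exact ⟨(Homotopy.equivSubZero).symm ((Homotopy.ofEq e).trans (Homotopy.nullHomotopy' H))⟩

/-- The fixed vector `w` is a map from `k`, and this map is the homotopy. If `m` is not the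
preceding degree, the boundary is zero and the maps are equal. -/
lemma homotopic_of_vec_eq {f g : 𝟙_ (Cpx k G) ⟶ X⟦s⟧} {m : ℤ} {w : (X.X m).V}
    (hw : w ∈ invs ⊤ (X.X m)) (h : vec f = vec g + dl X m s w) : Nonempty (Homotopy f g) := by
  by_cases hm : m + 1 = s
  swap
  · rw [dl_shape X m s hm, add_zero] at h
    rw [vec_injective h]
    exact ⟨Homotopy.refl g⟩
  obtain rfl : m = -1 + s := by omega
  have hel : el f = el g + invLift w (fun g => hw g trivial) ≫ X.d (-1 + s) s := by
    refine unit_hom_ext (h.trans ?_)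
    exact congrArg (fun v => vec g + (X.d (-1 + s) s).hom v) (invLift_one w _).symm
  -- The factor `(-1)^s` cancels the sign in the differential of `X[s]`.
  refine homotopy_of_single (s.negOnePow • ((singleObjXSelf (.up ℤ) 0 (𝟙_ (Rep k G))).hom ≫
    invLift w (fun g => hw g trivial))) ?_
  have h5 : X.d (-1 + s) s ≫ (CochainComplex.shiftFunctorObjXIso X s 0 s (by simp)).inv =
      X.d (-1 + s) (0 + s) := d_comp_XIsoOfEq_inv _ _ _
  have hf (f : 𝟙_ (Cpx k G) ⟶ X⟦s⟧) : f.f 0 = (singleObjXSelf (.up ℤ) 0 (𝟙_ (Rep k G))).hom ≫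
      el f ≫ (CochainComplex.shiftFunctorObjXIso X s 0 s (by simp)).inv := by
    rw [el, assoc, assoc, Iso.hom_inv_id_assoc]
    exact ((congrArg _ (Iso.hom_inv_id _)).trans (comp_id _)).symm
  refine (hf f).trans ((?_ : _ = _).trans (congrArg (· + _) (hf g).symm))
  rw [hel, Preadditive.add_comp, Preadditive.comp_add, assoc, h5]
  refine congrArg _ ?_
  have h6 : ((X⟦s⟧).d (-1) 0) = s.negOnePow • X.d (-1 + s) (0 + s) :=
    CochainComplex.shiftFunctor_obj_d' _ _ _ _
  refine Eq.trans ?_ (congrArg _ h6.symm)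
  refine Eq.trans ?_ (Linear.comp_units_smul _ s.negOnePow (X.d (-1 + s) (0 + s))).symm
  rw [Linear.units_smul_comp, smul_smul, Int.units_mul_self, one_smul, assoc]
  rfl

variable {M : Type*} [AddMonoid M] (P : GradedMon M (Cpx k G)) (hP : ∀ q, IsPermComplex (P.X q))

lemma vec_chainMul {i j : ℤ × M} (f : 𝟙_ (Cpx k G) ⟶ (P.X i.2)⟦i.1⟧)
    (g : 𝟙_ (Cpx k G) ⟶ (P.X j.2)⟦j.1⟧) : vec (chainMul P f g) =
      fl (P.mul i.2 j.2) (i.1 + j.1) (ten _ _ i.1 j.1 _ rfl (vec f) (vec g)) :=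
  hom_congr (el_chainMul P f g) (1 : k)

lemma vec_chainOne : vec (chainOne P) = fl P.one 0 (oneU k G) :=
  hom_congr (el_chainOne P) (1 : k)

lemma TwHom.cls_eq_of_vec_eq {i : ℤ × M} {f g : 𝟙_ (Cpx k G) ⟶ (P.X i.2)⟦i.1⟧} {m : ℤ}
    {w : ((P.X i.2).X m).V} (hw : w ∈ invs ⊤ ((P.X i.2).X m))
    (h : vec f = vec g + dl (P.X i.2) m i.1 w) : (cls f : TwHom P hP i) = cls g :=
  ObjectProperty.hom_ext _ (HomotopyCategory.eq_of_homotopy _ _ (homotopic_of_vec_eq hw h).some)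

end
end TwistedCohomology

/-! ### Generation of the twisted cohomology ring. -/

namespace TwistedCohomology
section
variable {k G : Type u} [Field k] [Group G] [Finite G] {p : ℕ} [CharP k p]

lemma eta_one (N : Subgroup G) [Fintype (G ⧸ N)] :
    (eta (k := k) N).hom (1 : k) = (∑ s : G ⧸ N, MonoidAlgebra.single s 1 : MonoidAlgebra k (G ⧸ N)) := by
  refine (invLift_one _ _).trans ?_
  congr!

variable (k p) in
/-- The chain maps `a_N`, `b_N` and `c_N`, with their degrees. -/
inductive IsGeneratorMap (odd : Bool) (N : Subgroup G) [N.Normal] (hN : N.index = p) (σ : G ⧸ N) :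
    (q : ℤ) → (𝟙_ (Cpx k G) ⟶ (uCpx (k := k) odd N σ)⟦q⟧) → Prop
  | a : IsGeneratorMap odd N hN σ 0 (aMap odd N σ)
  | b : IsGeneratorMap odd N hN σ _ (bMap p odd N hN σ)
  | c (h : odd = true) : IsGeneratorMap odd N hN σ _ (cMap p odd N hN σ)

variable {odd : Bool} {N : Subgroup G} [N.Normal] [Fintype (G ⧸ N)] {σ : G ⧸ N}

omit [Finite G] [Fintype (G ⧸ N)] in
lemma vec_aMap : vec (aMap (k := k) odd N σ) = vec₀ odd N σ := vec_ofCycle _ _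

lemma vec_cMap (hN : N.index = p) : vec (cMap (k := k) p odd N hN σ) = ∑ s, vec₁ odd N σ s :=
  (vec_ofCycle _ _).trans (eta_one N)

lemma vec_bMap_true (hN : N.index = p) :
    vec (s := -2) (bMap (k := k) p true N hN σ) = ∑ s, vec₂ N σ s :=
  (vec_ofCycle _ (eta_tau N σ)).trans (eta_one N)

lemma vec_bMap_false (hN : N.index = p) :
    vec (s := -1) (bMap (k := k) p false N hN σ) = ∑ s, vec₁ false N σ s :=
  (vec_ofCycle _ (eta_aug p N hN)).trans (eta_one N)

/-- The vector in degree `-1` underlies `c_N` for odd `p` but `b_N` for `p = 2`. -/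
lemma IsGenerator.exists_map (hN : N.index = p) {q : ℤ} {g : ((uCpx (k := k) odd N σ).X q).V}
    (hg : IsGenerator N σ odd q g) : ∃ f, IsGeneratorMap k p odd N hN σ q f ∧ vec f = g := by
  cases hg with
  | bot => exact ⟨_, .a, vec_aMap⟩
  | mid => cases odd with
    | false => exact ⟨_, .b (odd := false), vec_bMap_false hN⟩
    | true => exact ⟨_, .c rfl, vec_cMap hN⟩
  | top => exact ⟨_, .b (odd := true), vec_bMap_true hN⟩

lemma IsGeneratorMap.isGenerator {hN : N.index = p} {q : ℤ}
    {f : 𝟙_ (Cpx k G) ⟶ (uCpx (k := k) odd N σ)⟦q⟧} (hf : IsGeneratorMap k p odd N hN σ q f) :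
    IsGenerator N σ odd q (vec f) := by
  cases hf with
  | a => rw [vec_aMap]; exact .bot _
  | b => cases odd with
    | false => exact (vec_bMap_false (k := k) (σ := σ) hN).symm ▸ .mid false
    | true => exact (vec_bMap_true (k := k) (σ := σ) hN).symm ▸ .top
  | c h => rw [vec_cMap]; exact .mid _

/-- The splitting theorem for `H = G`, transported along `X ⊗ u_N ≅ Z`. The subgroup `T` will
consist of the vectors whose classes lie in the generated subalgebra; it only has to contain the
products with generators. -/
lemma RestrictionSurjective.exists_vec_eq [Fact p.Prime] (hN : N.index = p)
    (hσ : Subgroup.zpowers σ = ⊤) (hodd : odd = false → p = 2) {X Z : Cpx k G}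
    (hX : RestrictionSurjective X) (e : X ⊗ uCpx odd N σ ≅ Z) {s : ℤ} (f : 𝟙_ (Cpx k G) ⟶ Z⟦s⟧)
    (T : AddSubgroup (Z.X s).V)
    (hT : ∀ (a b : ℤ) (h : a + b = s) (f₁ : 𝟙_ (Cpx k G) ⟶ X⟦a⟧) (f₂ : _)
      (_ : IsGeneratorMap k p odd N hN σ b f₂), fl e.hom s (ten X _ a b s h (vec f₁) (vec f₂)) ∈ T) :
    ∃ v ∈ T, ∃ w ∈ invs ⊤ (Z.X (s - 1)), vec f = v + dl Z (s - 1) s w := by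
  obtain ⟨t, ht, w, hw, e'⟩ := hX.exists_splitCycles p hN hσ odd hodd ⊤
    (sub_add_cancel s 1) rfl (fl e.inv s (vec f))
    (fl_mem_invs _ (vec_mem_invs f ⊤)) (by rw [← fl_dl, dl_vec, map_zero])
  refine ⟨fl e.hom s t, ?_, fl e.hom _ w, fl_mem_invs _ hw, ?_⟩
  · clear e'
    induction ht using AddSubgroup.closure_induction with
    | zero => rw [map_zero]; exact zero_mem _
    | add v w _ _ hv hw => rw [map_add]; exact add_mem hv hw
    | neg v _ hv => rw [map_neg]; exact neg_mem hv
    | mem v hv =>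
      obtain ⟨a, b, h, x, hx, hd, g, hg, rfl⟩ := hv
      obtain ⟨f₁, rfl⟩ := TwistedCohomology.exists_vec_eq hx (hd _)
      obtain ⟨f₂, hf₂, rfl⟩ := hg.exists_map hN
      exact hT a b h f₁ f₂ hf₂
  · rw [← fl_dl, ← map_add, ← e', fl_hom_inv]
end

section
variable {k G : Type u} [Field k] [Group G] [Finite G] {p : ℕ} [Fact p.Prime] [CharP k p]
  (D : Choices p G)

-- Invertible products allow any `u_N` to be split off `1(q)`, whatever the place of `N` in the
-- list.
variable (k) in
omit [Finite G] [Fact p.Prime] [CharP k p] in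
lemma isStrong_twistList : ∀ l, (twistList k D l).IsStrong
  | [] => GradedMon.isStrong_unit _
  | _ :: l => ((GradedMon.isStrong_powers _).comap _).tensor (isStrong_twistList l)

variable (k) in
/-- The elements `a_N`, `b_N` and, for odd `p`, `c_N` of the twisted cohomology ring. -/
def generators : Set (TwistedRing k D) :=
  Set.range (elemA k D) ∪ Set.range (elemB k D) ∪ {x | p ≠ 2 ∧ x ∈ Set.range (elemC k D)}

variable (k) in
omit [Fact p.Prime] in
lemma mem_generators_iff (x : TwistedRing k D) : x ∈ generators k D ↔
    ∃ N q f, IsGeneratorMap k p (decide (p ≠ 2)) N.1 N.2.2 (D.σ N) q f ∧ homToRing k D N q f = x := by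
  constructor
  · rintro ((⟨N, rfl⟩ | ⟨N, rfl⟩) | ⟨hp, N, rfl⟩)
    · exact ⟨N, _, _, .a, rfl⟩
    · exact ⟨N, _, _, .b, rfl⟩
    · exact ⟨N, _, _, .c (decide_eq_true hp), rfl⟩
  · rintro ⟨N, q, f, hf, rfl⟩
    cases hf with
    | a => exact Or.inl (Or.inl ⟨N, rfl⟩)
    | b => exact Or.inl (Or.inr ⟨N, rfl⟩)
    | c h => exact Or.inr ⟨of_decide_eq_true h, N, rfl⟩

/-- The homogeneous element of the twisted cohomology ring given by a chain map. -/
noncomputable def ofMap {s : ℤ} {q : NormalOfIndex p G → ℕ}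
    (f : 𝟙_ (Cpx k G) ⟶ ((twistList k D D.list).X q)⟦s⟧) : TwistedRing k D :=
  open Classical in DirectSum.of (TwHomG k D) (s, q) (TwHom.cls f)

omit [Fact p.Prime] [CharP k p] in
lemma ofMap_add {s : ℤ} {q : NormalOfIndex p G → ℕ}
    (f g : 𝟙_ (Cpx k G) ⟶ ((twistList k D D.list).X q)⟦s⟧) :
    ofMap D (f + g) = ofMap D f + ofMap D g := by
  rw [ofMap, TwHom.cls_add]
  exact map_add _ _ _

omit [Fact p.Prime] [CharP k p] in
lemma ofMap_mul {s t : ℤ} {q r : NormalOfIndex p G → ℕ}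
    (f : 𝟙_ (Cpx k G) ⟶ ((twistList k D D.list).X q)⟦s⟧)
    (g : 𝟙_ (Cpx k G) ⟶ ((twistList k D D.list).X r)⟦t⟧) :
    ofMap D f * ofMap D g =
      ofMap D (chainMul (twistList k D D.list) (i := (s, q)) (j := (t, r)) f g) := by
  classical
  refine (DirectSum.of_mul_of (A := TwHomG k D) (i := (s, q)) (j := (t, r)) _ _).trans ?_
  exact congrArg (DirectSum.of (TwHomG k D) ((s, q) + (t, r))) (TwHom.mul_cls _ _)

omit [Fact p.Prime] [CharP k p] in
lemma ofMap_smul {s : ℤ} {q : NormalOfIndex p G → ℕ} (c : k)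
    (f : 𝟙_ (Cpx k G) ⟶ ((twistList k D D.list).X q)⟦s⟧) :
    ofMap D (c • f) = c • ofMap D f := by
  classical
  rw [ofMap, TwHom.cls_smul]
  exact (DirectSum.lof k _ (TwHomG k D) (s, q)).map_smul c _

omit [Fact p.Prime] [CharP k p] in
lemma ofMap_one : ofMap D (chainOne (twistList k D D.list)) = 1 := rfl

omit [Fact p.Prime] [CharP k p] in
lemma ofMap_eq_of_vec_eq {s m : ℤ} {q : NormalOfIndex p G → ℕ}
    {f g : 𝟙_ (Cpx k G) ⟶ ((twistList k D D.list).X q)⟦s⟧}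
    {w : (((twistList k D D.list).X q).X m).V} (hw : w ∈ invs ⊤ (((twistList k D D.list).X q).X m))
    (h : vec f = vec g + dl _ m s w) : ofMap D f = ofMap D g := by
  classical
  exact congrArg (DirectSum.of (TwHomG k D) (s, q)) (TwHom.cls_eq_of_vec_eq (i := (s, q)) _ _ hw h)

open Classical in
/-- The isomorphism of `u_N` with the object of weight `N`. -/
noncomputable def weightIso (N : NormalOfIndex p G) :
    uCpx (decide (p ≠ 2)) N.1 (D.σ N) ≅ (twistList k D D.list).X (basisWeight N) :=
  genIso k D N (basisWeight N) (Pi.single_eq_same _ _) (fun _ h => Pi.single_eq_of_ne h _)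
    D.list D.nodup (D.mem_list N)

omit [Fact p.Prime] [CharP k p] in
lemma homToRing_eq (N : NormalOfIndex p G) (q : ℤ) (f : 𝟙_ (Cpx k G) ⟶ (uN k D N)⟦q⟧) :
    homToRing k D N q f = ofMap D (f ≫ (weightIso D N).hom⟦q⟧') := rfl

/-- The isomorphism `1(q) ⊗ u_N ≅ 1(q + N)`. -/
noncomputable def weightSuccIso (N : NormalOfIndex p G) (q : NormalOfIndex p G → ℕ) :
    (twistList k D D.list).X q ⊗ uCpx (decide (p ≠ 2)) N.1 (D.σ N) ≅
      (twistList k D D.list).X (q + basisWeight N) :=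
  have := (isStrong_twistList k D D.list).isIso_mul q (basisWeight N)
  whiskerLeftIso _ (weightIso D N) ≪≫ asIso ((twistList k D D.list).mul q (basisWeight N))

-- The products found by splitting cycles of `1(q) ⊗ u_N` are thereby products in the twisted
-- cohomology ring.
omit [Finite G] [Fact p.Prime] [CharP k p] in
lemma vec_chainMul_weight (N : NormalOfIndex p G) (q : NormalOfIndex p G → ℕ) {a b : ℤ}
    (f : 𝟙_ (Cpx k G) ⟶ ((twistList k D D.list).X q)⟦a⟧)
    (g : 𝟙_ (Cpx k G) ⟶ (uCpx (decide (p ≠ 2)) N.1 (D.σ N))⟦b⟧) :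
    vec (chainMul (twistList k D D.list) (i := (a, q)) (j := (b, basisWeight N)) f
      (g ≫ (weightIso D N).hom⟦b⟧')) =
    fl (weightSuccIso D N q).hom (a + b) (ten _ _ a b (a + b) rfl (vec f) (vec g)) := by
  rw [vec_chainMul]
  refine congrArg (fl ((twistList k D D.list).mul q (basisWeight N)) (a + b)) ?_
  refine Eq.trans ?_ (fl_whiskerLeft _ _ _ _ _ _ _ _).symm
  exact congrArg (ten _ _ a b (a + b) rfl (vec f)) (vec_comp _ _)

/-- The vectors of `1(q)` that underlie a chain map whose class lies in the subalgebra `A`. -/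
def InSubalgebra (A : Subalgebra k (TwistedRing k D)) (s : ℤ) (q : NormalOfIndex p G → ℕ) :
    AddSubgroup (((twistList k D D.list).X q).X s).V where
  carrier := {v | ∃ f : 𝟙_ (Cpx k G) ⟶ ((twistList k D D.list).X q)⟦s⟧, vec f = v ∧ ofMap D f ∈ A}
  zero_mem' := ⟨(0 : k) • 0, by rw [vec_smul, zero_smul], by
    rw [ofMap_smul, zero_smul]; exact zero_mem A⟩
  add_mem' := by
    rintro _ _ ⟨f, rfl, hf⟩ ⟨g, rfl, hg⟩
    exact ⟨f + g, vec_add f g, by rw [ofMap_add]; exact add_mem hf hg⟩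
  neg_mem' := by
    rintro _ ⟨f, rfl, hf⟩
    exact ⟨(-1 : k) • f, by rw [vec_smul, neg_one_smul], by
      rw [ofMap_smul]; exact A.smul_mem hf _⟩

/-- Both statements are proved in one induction on the total weight. Splitting off `u_N` uses the
restriction property in the lower weight, and the left factors of the resulting products lie in the
subalgebra by induction. -/
lemma restrictionSurjective_and_mem_adjoin (n : ℕ) : ∀ q : NormalOfIndex p G → ℕ,
    (∑ᶠ N, q N) = n → RestrictionSurjective ((twistList k D D.list).X q) ∧
      ∀ (s : ℤ) (f : 𝟙_ (Cpx k G) ⟶ ((twistList k D D.list).X q)⟦s⟧),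
        ofMap D f ∈ Algebra.adjoin k (generators k D) := by
  have hone := (isStrong_twistList k D D.list).isIso_one
  induction n with
  | zero =>
    intro q hq
    obtain rfl : q = 0 := by
      have := Fintype.ofFinite (NormalOfIndex p G)
      rw [finsum_eq_sum_of_fintype, Finset.sum_eq_zero_iff] at hq
      exact funext fun N => hq N (Finset.mem_univ N)
    refine ⟨(restrictionSurjective_unit k G).of_iso (asIso (twistList k D D.list).one),
      fun s f => ?_⟩
    have hf : vec f = fl (twistList k D D.list).one s
      (fl (inv (twistList k D D.list).one) s (vec f)) := by
        rw [← fl_comp, IsIso.inv_hom_id, fl_id]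
    -- In weight zero the ring is `k` in degree `0` and nothing else, since `1(0) ≅ 1`.
    by_cases hs : s = 0
    · subst hs
      obtain ⟨c, hc⟩ := unit_span k G (fl (inv (twistList k D D.list).one) 0 (vec f))
      rw [hc, map_smul, ← vec_chainOne, ← vec_smul] at hf
      rw [vec_injective hf]
      refine (ofMap_smul D c _).symm ▸ Subalgebra.smul_mem _ ?_ c
      rw [ofMap_one]
      exact one_mem _
    · have hz : IsZero ((𝟙_ (Cpx k G)).X s) :=
        HomologicalComplex.isZero_single_obj_X (.up ℤ) 0 (𝟙_ (Rep.{u} k G)) s hs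
      rw [Subsingleton.elim (h := (Rep.isZero_iff _ _ _).1 hz)
        (fl (inv (twistList k D D.list).one) s (vec f)) 0, map_zero] at hf
      have : f = (0 : k) • f := vec_injective (by rw [vec_smul, zero_smul, hf])
      rw [this, ofMap_smul, zero_smul]
      exact zero_mem _
  | succ n ih =>
    classical
    intro q hq
    obtain ⟨N, hN⟩ : ∃ N, q N ≠ 0 := by
      by_contra! h
      simp [h] at hq
    -- Truncated subtraction is harmless because `q N ≠ 0`.
    obtain ⟨q, rfl⟩ : ∃ q', q = q' + basisWeight N := by
      refine ⟨q - basisWeight N, funext fun M => ?_⟩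
      by_cases e : M = N
      · subst e
        simp only [Pi.add_apply, Pi.sub_apply, Pi.single_eq_same]
        omega
      · simp [Pi.single_eq_of_ne e]
    have hq' : ∑ᶠ N, q N = n := by
      have h1 : ∑ᶠ M, (Pi.single N 1 : NormalOfIndex p G → ℕ) M = 1 := by
        rw [finsum_eq_single _ N (fun M h => Pi.single_eq_of_ne h _), Pi.single_eq_same]
      simp only [Pi.add_apply] at hq
      rw [finsum_add_distrib (Set.toFinite _) (Set.toFinite _), h1] at hq
      omega
    obtain ⟨hX, hA⟩ := ih q hq'
    let := Fintype.ofFinite (G ⧸ N.1)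
    have hodd : decide (p ≠ 2) = false → p = 2 := by simp
    refine ⟨(hX.tensor p N.2.2 (D.zpowers_eq_top N) _ hodd).of_iso (weightSuccIso D N q),
      fun s f => ?_⟩
    obtain ⟨_, ⟨g, rfl, hg⟩, w, hw, e⟩ := hX.exists_vec_eq N.2.2 (D.zpowers_eq_top N) hodd
      (weightSuccIso D N q) f (InSubalgebra D (Algebra.adjoin k (generators k D)) s _) (by
        rintro a b rfl f₁ f₂ hf₂
        refine ⟨_, vec_chainMul_weight D N q f₁ f₂, ?_⟩
        refine Eq.mp (congrArg (· ∈ _) (ofMap_mul D _ _)) ?_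
        exact mul_mem (hA a f₁) (Algebra.subset_adjoin
          ((mem_generators_iff k D _).2 ⟨N, b, f₂, hf₂, homToRing_eq D N b f₂⟩)))
    rw [ofMap_eq_of_vec_eq D hw e]
    exact hg

variable (k) in
theorem adjoin_generators : Algebra.adjoin k (generators k D) = ⊤ := by
  classical
  refine eq_top_iff.2 fun x _ => ?_
  induction x using DirectSum.induction_on with
  | zero => exact zero_mem _
  | add x y hx hy => exact add_mem (hx trivial) (hy trivial)
  | of i x =>
    obtain ⟨f, rfl⟩ := TwHom.cls_surjective x
    exact (restrictionSurjective_and_mem_adjoin D _ i.2 rfl).2 i.1 f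

end
end TwistedCohomology

/-! ### Boundaries, and commutation of the generators for a single `N`. -/

namespace TwistedCohomology
section
variable {k G : Type u} [Field k] [Group G]

/-- The boundaries of `G`-fixed elements. -/
noncomputable def bdry (X : Cpx k G) (n : ℤ) : Submodule k (X.X n).V :=
  (invs ⊤ (X.X (n - 1))).map (dl X (n - 1) n)

lemma dl_mem_bdry (X : Cpx k G) {m : ℤ} (n : ℤ) {x : (X.X m).V} (hx : x ∈ invs ⊤ (X.X m)) :
    dl X m n x ∈ bdry X n := by
  by_cases h : m + 1 = n
  · obtain rfl : m = n - 1 := by omega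
    exact Submodule.mem_map_of_mem hx
  · rw [dl_shape X m n h]
    exact zero_mem _

lemma fl_mem_bdry {X Y : Cpx k G} (φ : X ⟶ Y) {n : ℤ} {x : (X.X n).V} (hx : x ∈ bdry X n) :
    fl φ n x ∈ bdry Y n := by
  obtain ⟨w, hw, rfl⟩ := hx
  rw [fl_dl]
  exact dl_mem_bdry Y n (fl_mem_invs _ hw)

lemma ten_mem_bdry_left (X Y : Cpx k G) {p q n : ℤ} (h : p + q = n) {x : (X.X p).V} {y : (Y.X q).V}
    (hx : x ∈ bdry X p) (hy : y ∈ invs ⊤ (Y.X q)) (hd : ∀ j, dl Y q j y = 0) :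
    ten X Y p q n h x y ∈ bdry (X ⊗ Y) n := by
  obtain ⟨w, hw, rfl⟩ := hx
  have e := dl_ten X Y (p - 1) q (n - 1) p (q + 1) n (by omega) (by omega) rfl h (by omega) w y
  rw [hd, map_zero, smul_zero, add_zero] at e
  rw [← e]
  exact dl_mem_bdry _ _ (ten_mem_invs _ _ hw hy _ _)

lemma ten_mem_bdry_right (X Y : Cpx k G) {p q n : ℤ} (h : p + q = n) {x : (X.X p).V} {y : (Y.X q).V}
    (hx : x ∈ invs ⊤ (X.X p)) (hd : ∀ j, dl X p j x = 0) (hy : y ∈ bdry Y q) :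
    ten X Y p q n h x y ∈ bdry (X ⊗ Y) n := by
  obtain ⟨w, hw, rfl⟩ := hy
  have e := dl_ten X Y p (q - 1) (n - 1) (p + 1) q n (by omega) rfl (by omega) (by omega) h x w
  rw [hd, map_zero, LinearMap.zero_apply, zero_add] at e
  rw [← units_smul_smul_self p.negOnePow (ten X Y p q n h x _), ← e]
  exact units_smul_mem _ _ (dl_mem_bdry _ _ (ten_mem_invs _ _ hx hw _ _))

section
variable (p : ℕ) [CharP k p] {N : Subgroup G} [N.Normal] {σ : G ⧸ N} [Fintype (G ⧸ N)]

omit [Fintype (G ⧸ N)] in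
lemma vec₁_mem_equivariants (odd : Bool) (H : Subgroup G) :
    vec₁ (k := k) odd N σ ∈ equivariants H (G ⧸ N) ((uCpx (k := k) odd N σ).X (-1)) :=
  fun g _ s => (vec₁_rho odd N σ g s).symm

omit [Fintype (G ⧸ N)] in
lemma vec₂_mem_equivariants (H : Subgroup G) :
    vec₂ (k := k) N σ ∈ equivariants H (G ⧸ N) ((uCpx (k := k) true N σ).X (-2)) :=
  fun g _ s => (vec₂_rho N σ g s).symm

lemma sum_translate {V : Type*} [AddCommMonoid V] (f : G ⧸ N → V) (τ : G ⧸ N) :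
    ∑ s, f (s * τ) = ∑ s, f s :=
  Fintype.sum_equiv (Equiv.mulRight τ) _ _ fun _ => rfl

/-- The difference is the boundary of the diagonal element `∑ vec₁ s ⊗ vec₁ s`. -/
lemma comm_bot_mid (odd : Bool) :
    ten (uCpx (k := k) odd N σ) (uCpx odd N σ) 0 (-1) (-1) rfl (vec₀ odd N σ) (∑ s, vec₁ odd N σ s) -
      ten _ _ (-1) 0 (-1) rfl (∑ s, vec₁ odd N σ s) (vec₀ odd N σ) ∈ bdry _ (-1) := by
  have e := dl_layer_vec₁ (X := uCpx (k := k) odd N σ) (σ := σ) odd (n := -2) (n₁ := -1) (n₂ := 0)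
    rfl rfl rfl rfl rfl (vec₁ odd N σ)
  simp only [dl_vec₁, layer_const] at e
  have e' : Int.negOnePow (-1) = -1 := rfl
  simp only [e', Units.neg_smul, one_smul, map_neg, LinearMap.neg_apply] at e
  rw [sub_eq_add_neg, add_comm, ← e]
  exact dl_mem_bdry _ _ (layer_mem_invs _ _ (vec₁_rho odd N σ) (vec₁_mem_equivariants odd ⊤))

/-- The boundaries of `∑ vec₁ s ⊗ vec₂ s` and of `∑ vec₂ (s σ⁻¹) ⊗ vec₁ s` share the term `∑ (vec₁ s
- vec₁ (s σ⁻¹)) ⊗ vec₁ s`, and their difference is what is wanted. -/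
lemma comm_bot_top :
    ten (uCpx (k := k) true N σ) (uCpx true N σ) 0 (-2) (-2) rfl (vec₀ true N σ) (∑ s, vec₂ N σ s) -
      ten _ _ (-2) 0 (-2) rfl (∑ s, vec₂ N σ s) (vec₀ true N σ) ∈ bdry _ (-2) := by
  have e₁ := dl_layer_vec₂ (X := uCpx (k := k) true N σ) (σ := σ) (n := -3) (n₁ := -2) (n₂ := -1)
    (n₃ := 0) rfl rfl rfl rfl rfl rfl (vec₁ true N σ)
  have e₂ := dl_layer_vec₁ (X := uCpx (k := k) true N σ) (σ := σ) true (n := -3) (n₁ := -2)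
    (n₂ := -1) rfl rfl rfl rfl rfl (fun s => vec₂ N σ (s * σ⁻¹))
  simp only [dl_vec₁, layer_const] at e₁
  rw [show Int.negOnePow (-1) = -1 from rfl] at e₁
  simp only [dl_vec₂, inv_mul_cancel_right, sum_translate (vec₂ N σ)] at e₂
  rw [show Int.negOnePow (-2) = 1 from rfl, one_smul] at e₂
  simp only [Units.neg_smul, one_smul, neg_sub] at e₁
  have e := congrArg₂ (· - ·) e₁ e₂
  simp only [add_comm (ten _ _ _ _ _ _ _ _) (layer _ _ _ _ _), add_sub_add_left_eq_sub] at e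
  rw [← e]
  exact sub_mem (dl_mem_bdry _ _ (layer_mem_invs _ _ (vec₂_rho N σ) (vec₁_mem_equivariants true ⊤)))
    (dl_mem_bdry _ _ (layer_mem_invs _ _ (vec₁_rho true N σ)
      (translate_mem_equivariants N (vec₂_mem_equivariants ⊤) _)))

-- The difference is the boundary of `∑ f s ⊗ vec₂ s`, where `f s` is a sum of the `vec₂ (s h)`
-- weighted by a discrete logarithm of `h`.
include p in
lemma comm_top_mid (hN : N.index = p) (hσ : Subgroup.zpowers σ = ⊤) :
    ten (uCpx (k := k) true N σ) (uCpx true N σ) (-2) (-1) (-3) rfl (∑ s, vec₂ N σ s)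
        (∑ s, vec₁ true N σ s) -
      ten _ _ (-1) (-2) (-3) rfl (∑ s, vec₁ true N σ s) (∑ s, vec₂ N σ s) ∈ bdry _ (-3) := by
  -- The function `l` satisfies `l (h σ) = l h + 1`. It exists because the constant `-1` has sum `-p
  -- = 0` in `k`.
  obtain ⟨l, hl⟩ := exists_sub_eq_of_sum_eq_zero σ hσ (fun _ => (-1 : k))
    (sum_const_coset (k := k) p N hN _)
  have hcomm (h : G ⧸ N) : σ * h = h * σ := by
    obtain ⟨n, rfl⟩ := Subgroup.mem_zpowers_iff.1 (hσ ▸ Subgroup.mem_top h)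
    exact ((Commute.refl σ).zpow_right n)
  -- The weights are such that both the translation difference and the boundary of `f` are
  -- independent of `s`: they are `∑ vec₂` and `-∑ vec₁`.
  let f (s : G ⧸ N) : ((uCpx (k := k) true N σ).X (-2)).V := ∑ h, l h • vec₂ N σ (s * h)
  have hf : f ∈ equivariants ⊤ (G ⧸ N) ((uCpx (k := k) true N σ).X (-2)) := by
    intro g _ s
    simp only [f, map_sum, map_smul, vec₂_rho, smul_mul_coset]
  have h1 (s : G ⧸ N) : f (s * σ⁻¹) - f s = ∑ t, vec₂ N σ t := by
    have : f (s * σ⁻¹) = ∑ h, (l h + 1) • vec₂ N σ (s * h) := by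
      refine Fintype.sum_equiv (Equiv.mulRight σ⁻¹) _ _ fun h => ?_
      have : l (h * σ⁻¹) + 1 = l h := by linear_combination hl h
      simp only [Equiv.coe_mulRight, this]
      rw [mul_assoc, inv_mul_eq_iff_eq_mul.2 ((hcomm (h * σ⁻¹)).trans (inv_mul_cancel_right _ _)).symm]
    rw [this]
    simp only [f, ← Finset.sum_sub_distrib, add_smul, add_sub_cancel_left, one_smul]
    exact Fintype.sum_equiv (Equiv.mulLeft s) _ _ fun _ => rfl
  have h2 (s : G ⧸ N) : dl (uCpx (k := k) true N σ) (-2) (-1) (f s) = -∑ t, vec₁ true N σ t := by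
    simp only [f, map_sum, map_smul, dl_vec₂, smul_sub, Finset.sum_sub_distrib]
    have : ∑ h, l h • vec₁ (k := k) true N σ (s * h * σ) =
        ∑ h, (l h - 1) • vec₁ true N σ (s * h) := by
      refine Fintype.sum_equiv (Equiv.mulRight σ) _ _ fun h => ?_
      have : l (h * σ) - 1 = l h := by
        have := hl (h * σ)
        rw [mul_inv_cancel_right] at this
        linear_combination -this
      simp only [Equiv.coe_mulRight, this, mul_assoc]
    rw [this]
    simp only [← Finset.sum_sub_distrib, sub_smul, one_smul, sub_sub_cancel_left]
    rw [Finset.sum_neg_distrib]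
    exact congrArg _ (Fintype.sum_equiv (Equiv.mulLeft s) _ _ fun _ => rfl)
  have e := dl_layer_vec₂ (X := uCpx (k := k) true N σ) (σ := σ) (n := -4) (n₁ := -3) (n₂ := -2)
    (n₃ := -1) rfl rfl rfl rfl rfl rfl f
  simp only [h1, h2, layer_const] at e
  have e' : Int.negOnePow (-2) = 1 := rfl
  simp only [e', one_smul, map_neg, LinearMap.neg_apply, ← sub_eq_add_neg] at e
  rw [← e]
  exact dl_mem_bdry _ _ (layer_mem_invs _ _ (vec₂_rho N σ) hf)

include p in
/-- The generators of one weight commute up to boundaries. -/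
lemma IsGenerator.comm (hN : N.index = p) (hσ : Subgroup.zpowers σ = ⊤) {odd : Bool} {a b n : ℤ}
    {g : ((uCpx (k := k) odd N σ).X a).V} {h : ((uCpx (k := k) odd N σ).X b).V}
    (hg : IsGenerator N σ odd a g) (hh : IsGenerator N σ odd b h)
    (e : a + b = n) (e' : b + a = n) :
    ten (uCpx odd N σ) (uCpx odd N σ) a b n e g h - ten _ _ b a n e' h g ∈ bdry _ n := by
  have swap {a b n : ℤ} {g : ((uCpx (k := k) odd N σ).X a).V}
      {h : ((uCpx (k := k) odd N σ).X b).V} {e : a + b = n} {e' : b + a = n}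
      (hb : ten (uCpx odd N σ) (uCpx odd N σ) a b n e g h - ten _ _ b a n e' h g ∈ bdry _ n) :
      ten (uCpx odd N σ) (uCpx odd N σ) b a n e' h g - ten _ _ a b n e g h ∈ bdry _ n := by
    rw [← neg_sub]
    exact neg_mem hb
  subst e
  cases hg with
  | bot => cases hh with
    | bot => rw [sub_self]; exact zero_mem _
    | mid => exact comm_bot_mid _
    | top => exact comm_bot_top
  | mid => cases hh with
    | bot => exact swap (comm_bot_mid _)
    | mid => rw [sub_self]; exact zero_mem _
    | top => exact swap (comm_top_mid p hN hσ)
  | top => cases hh with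
    | bot => exact swap comm_bot_top
    | mid => exact comm_top_mid p hN hσ
    | top => rw [sub_self]; exact zero_mem _
end

end
end TwistedCohomology

/-! ### Commutation up to sign in graded monoids of complexes. -/

namespace TwistedCohomology
section
variable {k G : Type u} [Field k] [Group G] {M : Type*} [AddCommMonoid M]

/-- The product of two homogeneous elements of a graded monoid of complexes. -/
noncomputable def gmul (A : GradedMon M (Cpx k G)) {q r : M} {s t : ℤ} (n : ℤ) (h : s + t = n)
    (v : ((A.X q).X s).V) (w : ((A.X r).X t).V) : ((A.X (q + r)).X n).V :=
  fl (A.mul q r) n (ten _ _ s t n h v w)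

/-- The elements `v` and `w` commute up to a sign and the boundary of a fixed element. -/
def SignComm (A : GradedMon M (Cpx k G)) {q r : M} {s t : ℤ} (v : ((A.X q).X s).V)
    (w : ((A.X r).X t).V) : Prop :=
  ∃ ε : ℤˣ, ∀ (n : ℤ) (h : s + t = n) (h' : t + s = n), gmul A n h v w -
    ε • fl (eqToHom (congrArg A.X (add_comm r q))) n (gmul A n h' w v) ∈ bdry (A.X (q + r)) n

lemma fl_units_smul {X Y : Cpx k G} (φ : X ⟶ Y) (n : ℤ) (z : ℤˣ) (x : (X.X n).V) :
    fl φ n (z • x) = z • fl φ n x := map_units_smul' _ _ _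

lemma fl_eqToHom_trans {X Y Z : Cpx k G} (h : X = Y) (h' : Y = Z) (n : ℤ) (x : (X.X n).V) :
    fl (eqToHom h') n (fl (eqToHom h) n x) = fl (eqToHom (h.trans h')) n x := by
  rw [← fl_comp, eqToHom_trans]

lemma SignComm.symm {A : GradedMon M (Cpx k G)} {q r : M} {s t : ℤ} {v : ((A.X q).X s).V}
    {w : ((A.X r).X t).V} (h : SignComm A v w) : SignComm A w v := by
  obtain ⟨ε, h⟩ := h
  refine ⟨ε, fun n e e' => ?_⟩
  have := units_smul_mem _ (-ε) (fl_mem_bdry (eqToHom (congrArg A.X (add_comm q r))) (h n e' e))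
  rw [map_sub, fl_units_smul, fl_eqToHom_trans, eqToHom_refl, fl_id, Units.neg_smul, smul_sub,
    units_smul_smul_self, neg_sub] at this
  exact this

lemma SignComm.comap {L : Type*} [AddCommMonoid L] (f : L →+ M) (A : GradedMon M (Cpx k G))
    {q r : L} {s t : ℤ} {v : ((A.X (f q)).X s).V} {w : ((A.X (f r)).X t).V}
    (h : SignComm A v w) : SignComm (A.comap f) (q := q) (r := r) v w := by
  obtain ⟨ε, h⟩ := h
  refine ⟨ε, fun n e e' => ?_⟩
  have h₁ := fl_mem_bdry (eqToHom (congrArg A.X (map_add f q r).symm)) (h n e e')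
  rw [map_sub, fl_units_smul, fl_eqToHom_trans] at h₁
  have h₂ : fl (eqToHom (congrArg (A.comap f).X (add_comm r q))) n (gmul (A.comap f) n e' w v) =
      fl (eqToHom (congrArg A.X ((add_comm _ _).trans (map_add f q r).symm))) n
        (gmul A n e' w v) := fl_eqToHom_trans _ _ n _
  rw [h₂]
  exact h₁

lemma gmul_mem_invs (A : GradedMon M (Cpx k G)) {q r : M} {s t n : ℤ} (h : s + t = n)
    {v : ((A.X q).X s).V} {w : ((A.X r).X t).V} {H : Subgroup G} (hv : v ∈ invs H _)
    (hw : w ∈ invs H _) : gmul A n h v w ∈ invs H _ :=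
  fl_mem_invs _ (ten_mem_invs _ _ hv hw _ _)

lemma ten_cycle (X Y : Cpx k G) {p q n : ℤ} (h : p + q = n) {x : (X.X p).V} {y : (Y.X q).V}
    (hx : ∀ j, dl X p j x = 0) (hy : ∀ j, dl Y q j y = 0) (j : ℤ) :
    dl (X ⊗ Y) n j (ten X Y p q n h x y) = 0 := by
  by_cases hj : n + 1 = j
  · rw [dl_ten X Y p q n (p + 1) (q + 1) j h rfl rfl (by omega) (by omega), hx, hy, map_zero,
      map_zero, smul_zero, add_zero, LinearMap.zero_apply]
  · exact dl_shape _ _ _ hj _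

lemma gmul_cycle (A : GradedMon M (Cpx k G)) {q r : M} {s t n : ℤ} (h : s + t = n)
    {v : ((A.X q).X s).V} {w : ((A.X r).X t).V} (hv : ∀ j, dl _ s j v = 0)
    (hw : ∀ j, dl _ t j w = 0) (j : ℤ) : dl _ n j (gmul A n h v w) = 0 := by
  rw [gmul, ← fl_dl, ten_cycle _ _ h hv hw, map_zero]

lemma ten_units_smul_left (X Y : Cpx k G) {p q n : ℤ} (h : p + q = n) (z : ℤˣ) (x : (X.X p).V)
    (y : (Y.X q).V) : ten X Y p q n h (z • x) y = z • ten X Y p q n h x y :=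
  map_units_smul' ((ten X Y p q n h).flip y) z x

lemma ten_units_smul_right (X Y : Cpx k G) {p q n : ℤ} (h : p + q = n) (z : ℤˣ) (x : (X.X p).V)
    (y : (Y.X q).V) : ten X Y p q n h x (z • y) = z • ten X Y p q n h x y :=
  map_units_smul' (ten X Y p q n h x) z y

/-- Only `x` and `y` change places, which costs the Koszul sign `(-1)^(bc)`. -/
lemma fl_tensorμ (W X Y Z : Cpx k G) {a b c d ab cd ac bd n : ℤ} (hab : a + b = ab)
    (hcd : c + d = cd) (hac : a + c = ac) (hbd : b + d = bd) (h : ab + cd = n) (h' : ac + bd = n)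
    (w : (W.X a).V) (x : (X.X b).V) (y : (Y.X c).V) (z : (Z.X d).V) :
    fl (tensorμ W X Y Z) n (ten _ _ ab cd n h (ten _ _ a b ab hab w x) (ten _ _ c d cd hcd y z)) =
      (b * c).negOnePow • ten _ _ ac bd n h' (ten _ _ a c ac hac w y) (ten _ _ b d bd hbd x z) := by
  rw [tensorμ]
  simp only [fl_comp]
  rw [fl_associator W X _ a b cd n ab (b + cd) hab h rfl (by omega), fl_whiskerLeft,
    fl_associator_inv X Y Z b c d (b + cd) (b + c) cd rfl (by omega) hcd rfl, fl_whiskerLeft,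
    fl_whiskerRight, fl_braiding X Y b c (b + c) rfl (add_comm c b), ten_units_smul_left,
    ten_units_smul_right, fl_units_smul, fl_whiskerLeft,
    fl_associator Y X Z c b d (b + cd) (b + c) bd _ _ hbd (by omega), fl_units_smul,
    fl_associator_inv W Y _ a c bd n ac (b + cd) hac h' (by omega) (by omega)]

lemma units_smul_sub_units_smul {V : Type*} [AddCommGroup V] (z z' ε : ℤˣ) (x y : V) :
    z • x - (z * (ε * z')) • z' • y = z • (x - ε • y) := by
  rw [smul_sub, mul_smul, mul_smul, units_smul_smul_self]

lemma gmul_tensor (A B : GradedMon M (Cpx k G)) {q r : M} {a b c d s t ac bd n : ℤ} (hs : a + b = s)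
    (ht : c + d = t) (hac : a + c = ac) (hbd : b + d = bd) (h : s + t = n) (h' : ac + bd = n) (v : ((A.X q).X a).V) (v' : ((B.X q).X b).V)
    (w : ((A.X r).X c).V) (w' : ((B.X r).X d).V) :
    gmul (A.tensor B) n h (ten _ _ a b s hs v v' : (((A.tensor B).X q).X s).V)
      (ten _ _ c d t ht w w' : (((A.tensor B).X r).X t).V) =
      (b * c).negOnePow • ten _ _ ac bd n h' (gmul A ac hac v w) (gmul B bd hbd v' w') := by
  have e := congrArg (fl (A.mul q r ⊗ₘ B.mul q r) n)
    (fl_tensorμ (A.X q) (B.X q) (A.X r) (B.X r) hs ht hac hbd h h' v v' w w')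
  rw [fl_units_smul, fl_tensorHom] at e
  exact e

/-- The factors can be exchanged separately, since the product of a boundary with a fixed cycle is
again a boundary. -/
lemma SignComm.tensor {A B : GradedMon M (Cpx k G)} {q r : M} {a b c d s t : ℤ}
    (hs : a + b = s) (ht : c + d = t) {v : ((A.X q).X a).V} {v' : ((B.X q).X b).V}
    {w : ((A.X r).X c).V} {w' : ((B.X r).X d).V} (h : SignComm A v w) (h' : SignComm B v' w')
    (hv : v ∈ invs ⊤ _) (hw : w ∈ invs ⊤ _) (hv' : v' ∈ invs ⊤ _) (hw' : w' ∈ invs ⊤ _)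
    (dv : ∀ j, dl _ _ j v = 0) (dw : ∀ j, dl _ _ j w = 0)
    (dv' : ∀ j, dl _ _ j v' = 0) (dw' : ∀ j, dl _ _ j w' = 0) :
    SignComm (A.tensor B) (q := q) (r := r) (ten _ _ a b s hs v v') (ten _ _ c d t ht w w') := by
  obtain ⟨ε, h⟩ := h
  obtain ⟨ε', h'⟩ := h'
  -- The outer signs come from the middle exchanges in the two products, of `v'` with `w` and of
  -- `w'` with `v`.
  refine ⟨(b * c).negOnePow * (ε' * ε * (d * a).negOnePow), fun n e e' => ?_⟩
  have h₁ := h (a + c) rfl (add_comm c a)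
  have h₂ := h' (b + d) rfl (add_comm d b)
  -- First the factor in `A` is exchanged, then the factor in `B`; the intermediate term cancels.
  have h₃ := add_mem (ten_mem_bdry_left _ _ (n := n) (by omega) h₁
    (gmul_mem_invs B rfl hv' hw') (gmul_cycle B rfl dv' dw'))
    (ten_mem_bdry_right _ _ (by omega) (units_smul_mem _ ε (fl_mem_invs
      (eqToHom (congrArg A.X (add_comm r q))) (gmul_mem_invs A (add_comm c a) hw hv)))
      (fun j => by rw [map_units_smul', ← fl_dl, gmul_cycle A _ dw dv, map_zero, smul_zero]) h₂)
  simp only [map_sub, LinearMap.sub_apply, ten_units_smul_left, ten_units_smul_right,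
    sub_add_sub_cancel] at h₃
  rw [smul_smul] at h₃
  have hE : fl (eqToHom (congrArg (A.tensor B).X (add_comm r q))) n
      (ten (A.X (r + q)) (B.X (r + q)) (a + c) (b + d) n (by omega)
        (gmul A _ (add_comm c a) w v) (gmul B _ (add_comm d b) w' v')) =
      ten (A.X (q + r)) (B.X (q + r)) (a + c) (b + d) n (by omega)
        (fl (eqToHom (congrArg A.X (add_comm r q))) _ (gmul A (a + c) (add_comm _ _) w v))
        (fl (eqToHom (congrArg B.X (add_comm r q))) _ (gmul B (b + d) (add_comm _ _) w' v')) :=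
    (congrArg (fun φ => fl φ n _) (GradedMon.eqToHom_tensor (congrArg A.X (add_comm r q))
      (congrArg B.X (add_comm r q))).symm).trans (fl_tensorHom _ _ _ _ _ _ _ _)
  have g₁ := gmul_tensor A B hs ht rfl rfl e (by omega) v v' w w'
  have g₂ := (congrArg (fl (eqToHom (congrArg (A.tensor B).X (add_comm r q))) n)
    (gmul_tensor A B ht hs (add_comm c a) (add_comm d b) e' (by omega) w w' v v')).trans
      ((fl_units_smul _ n _ _).trans (congrArg ((d * a).negOnePow • ·) hE))
  refine Eq.mp (congrArg (· ∈ bdry _ n) ((units_smul_sub_units_smul _ _ _ _ _).symm.trans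
    (congrArg₂ (fun x y => x - _ • y) g₁ g₂).symm)) (units_smul_mem _ (b * c).negOnePow h₃)

lemma signComm_one_left (A : GradedMon M (Cpx k G)) {q : M} {s : ℤ} (v : ((A.X q).X s).V) :
    SignComm A (fl A.one 0 (oneU k G)) v := by
  refine ⟨1, fun n h h' => ?_⟩
  obtain rfl : s = n := by omega
  have e₁ := congrArg (fun φ => fl φ s (ten _ _ 0 s s h (oneU k G) v)) (A.one_mul q)
  have e₂ := congrArg (fun φ => fl φ s (ten _ _ s 0 s h' v (oneU k G))) (A.mul_one q)
  simp only [fl_comp, fl_whiskerLeft, fl_whiskerRight, fl_leftUnitor, fl_rightUnitor] at e₁ e₂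
  rw [gmul, gmul, e₁, e₂, fl_eqToHom_trans, one_smul, sub_self]
  exact zero_mem _

lemma signComm_unit (q r : M) :
    SignComm (GradedMon.unit M) (q := q) (r := r) (oneU k G) (oneU k G) := by
  exact signComm_one_left (GradedMon.unit M) (q := r) (oneU k G)

section
variable {u : Cpx k G} (E : ∀ s : ℤ, (u.X s).V → Prop)

/-- The unit in degree zero and the given elements `E` in degree one, as elements of the graded
monoid of powers of `u`. -/
inductive PowElt : (n : ℕ) → (s : ℤ) → (((GradedMon.powers u).X n).X s).V → Prop
  | one : PowElt 0 0 (oneU k G)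
  | gen (s : ℤ) (g : (u.X s).V) (hg : E s g) :
      PowElt 1 s (ten (𝟙_ (Cpx k G)) u 0 s s (zero_add s) (oneU k G) g)

variable {E}

lemma PowElt.cast {n m : ℕ} {s : ℤ} {v : (((GradedMon.powers u).X n).X s).V} (h : PowElt E n s v)
    (e : n = m) : PowElt E m s (fl (eqToHom (congrArg (GradedMon.powers u).X e)) s v) := by
  subst e
  exact h

lemma PowElt.mem_invs (hE : ∀ s g, E s g → g ∈ invs ⊤ (u.X s)) {n : ℕ} {s : ℤ}
    {v : (((GradedMon.powers u).X n).X s).V} (h : PowElt E n s v) : v ∈ invs ⊤ _ := by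
  cases h with
  | one => exact fun g _ => oneU_rho g
  | gen _ g hg => exact ten_mem_invs _ _ (fun g _ => oneU_rho g) (hE _ _ hg) _ _

lemma PowElt.cycle (hE : ∀ s g, E s g → ∀ j, dl u s j g = 0) {n : ℕ} {s : ℤ}
    {v : (((GradedMon.powers u).X n).X s).V} (h : PowElt E n s v) (j : ℤ) : dl _ s j v = 0 := by
  cases h with
  | one => exact dl_oneU _
  | gen _ g hg => exact ten_cycle _ _ _ dl_oneU (hE _ _ hg) j

/-- Tensor powers start with a unit factor, so the first power is `1 ⊗ u` and the second `(1 ⊗ u) ⊗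
u`. The identity reduces commutation in the second power to commutation in `u ⊗ u`. -/
lemma gmul_powers {s t n : ℤ} (h : s + t = n) (g : (u.X s).V) (g' : (u.X t).V) :
    gmul (GradedMon.powers u) (q := 1) (r := 1) n h
      (ten (𝟙_ (Cpx k G)) u 0 s s (zero_add s) (oneU k G) g)
      (ten (𝟙_ (Cpx k G)) u 0 t t (zero_add t) (oneU k G) g') =
      fl ((λ_ u).inv ▷ u) n (ten u u s t n h g g') := by
  rw [fl_whiskerRight, fl_leftUnitor_inv]
  refine (congrArg (fl ((ρ_ (𝟙_ (Cpx k G) ⊗ u)).hom ▷ u) n) (fl_associator_inv _ _ _ s 0 t n s t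
    (add_zero s) h (zero_add t) h _ _ _)).trans ?_
  rw [fl_whiskerRight, fl_rightUnitor]

lemma PowElt.signComm (hE : ∀ s t g h, E s g → E t h → ∀ n e e',
    ten u u s t n e g h - ten u u t s n e' h g ∈ bdry _ n) {n m : ℕ} {s t : ℤ}
    {v : (((GradedMon.powers u).X n).X s).V} {w : (((GradedMon.powers u).X m).X t).V}
    (hv : PowElt E n s v) (hw : PowElt E m t w) : SignComm (GradedMon.powers u) v w := by
  cases hv with
  | one => exact signComm_one_left (GradedMon.powers u) w
  | gen _ g hg =>
    cases hw with
    | one => exact (signComm_one_left (GradedMon.powers u) _).symm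
    | gen _ h hh =>
      refine ⟨1, fun n e e' => ?_⟩
      have := fl_mem_bdry ((λ_ u).inv ▷ u) (hE _ _ _ _ hg hh n e e')
      rw [map_sub, ← gmul_powers e, ← gmul_powers e'] at this
      rw [one_smul, eqToHom_refl, fl_id]
      exact this
end

end
end TwistedCohomology

/-! ### The generators commute up to sign. -/

namespace TwistedCohomology
section
variable {k G : Type u} [Field k] [Group G] [Finite G] {p : ℕ} (D : Choices p G)

/-- The cycles underlying `a_N`, `b_N` and `c_N`. -/
def GenPred (N : NormalOfIndex p G) (s : ℤ) (g : ((uN k D N).X s).V) : Prop :=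
  letI := Fintype.ofFinite (G ⧸ N.1)
  IsGenerator N.1 (D.σ N) (decide (p ≠ 2)) s g

/-- The pure tensors of the cycles underlying `a_N`, `b_N`, `c_N` and of units. -/
inductive TwistElt : (l : List (NormalOfIndex p G)) → (q : NormalOfIndex p G → ℕ) → (s : ℤ) →
    (((twistList k D l).X q).X s).V → Prop
  | nil (q) : TwistElt [] q 0 (oneU k G)
  | cons (N l q) (a b s : ℤ) (h : a + b = s) (v) (w) (hv : PowElt (GenPred (k := k) D N) (q N) a v)
      (hw : TwistElt l q b w) : TwistElt (N :: l) q s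
        (ten ((GradedMon.powers (uN k D N)).X (q N)) ((twistList k D l).X q) a b s h v w)

variable {D}

lemma GenPred.mem_invs {N : NormalOfIndex p G} {s : ℤ} {g : ((uN k D N).X s).V}
    (h : GenPred D N s g) : g ∈ invs ⊤ ((uN k D N).X s) :=
  let := Fintype.ofFinite (G ⧸ N.1)
  IsGenerator.mem_invs h ⊤

lemma GenPred.cycle [CharP k p] {N : NormalOfIndex p G} {s : ℤ} {g : ((uN k D N).X s).V}
    (h : GenPred D N s g) (j : ℤ) : dl (uN k D N) s j g = 0 :=
  let := Fintype.ofFinite (G ⧸ N.1)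
  IsGenerator.cycle p N.2.2 h j

lemma TwistElt.mem_invs {l : List (NormalOfIndex p G)} {q : NormalOfIndex p G → ℕ} {s : ℤ}
    {v : (((twistList k D l).X q).X s).V} (h : TwistElt D l q s v) : v ∈ invs ⊤ _ := by
  induction h with
  | nil q => exact fun g _ => oneU_rho g
  | cons N l q a b s h v w hv hw ih =>
    exact ten_mem_invs _ _ (hv.mem_invs fun _ _ h => h.mem_invs) ih _ _

lemma TwistElt.cycle [CharP k p] {l : List (NormalOfIndex p G)} {q : NormalOfIndex p G → ℕ} {s : ℤ}
    {v : (((twistList k D l).X q).X s).V} (h : TwistElt D l q s v) : ∀ j, dl _ s j v = 0 := by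
  induction h with
  | nil q => exact dl_oneU
  | cons N l q a b s h v w hv hw ih =>
    exact ten_cycle _ _ h (hv.cycle fun _ _ h => h.cycle) ih

/-- Induction on the list: at `N` each factor is a unit or a generator for that `N`, and these
commute up to boundaries; the Koszul sign enters when the rest of the list is tensored on. -/
lemma TwistElt.signComm [CharP k p] {l : List (NormalOfIndex p G)} :
    ∀ {q r : NormalOfIndex p G → ℕ} {s t : ℤ} {v : (((twistList k D l).X q).X s).V}
      {w : (((twistList k D l).X r).X t).V}, TwistElt D l q s v → TwistElt D l r t w →
        SignComm (twistList k D l) v w := by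
  induction l with
  | nil =>
    intro q r s t v w hv hw
    cases hv
    cases hw
    exact signComm_unit q r
  | cons N l ih =>
    intro q r s t v w hv hw
    cases hv with
    | cons _ _ _ a b _ h v v' hv hv' =>
    cases hw with
    | cons _ _ _ c d _ h' w w' hw hw' =>
    let := Fintype.ofFinite (G ⧸ N.1)
    have hE (s t g h) (hg : GenPred (k := k) D N s g) (hh : GenPred D N t h) (n e e') :
        ten _ _ s t n e g h - ten _ _ t s n e' h g ∈ bdry _ n :=
      IsGenerator.comm p N.2.2 (D.zpowers_eq_top N) hg hh e e'
    exact SignComm.tensor h h' ((hv.signComm hE hw).comap _ _) (ih hv' hw') (hv.mem_invs fun _ _ h => h.mem_invs)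
      (hw.mem_invs fun _ _ h => h.mem_invs) hv'.mem_invs hw'.mem_invs (hv.cycle fun _ _ h => h.cycle) (hw.cycle fun _ _ h => h.cycle) hv'.cycle hw'.cycle

lemma twistElt_unitIso (q : NormalOfIndex p G → ℕ) : ∀ (l : List (NormalOfIndex p G))
    (h : ∀ N ∈ l, q N = 0), TwistElt D l q 0 (fl (unitIso k D q l h).hom 0 (oneU k G))
  | [], _ => .nil q
  | N :: l, h => by
    have := TwistElt.cons N l q 0 0 0 rfl _ _
      ((PowElt.one (E := GenPred (k := k) D N)).cast (h N List.mem_cons_self).symm)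
      (twistElt_unitIso q l fun M hM => h M (List.mem_cons_of_mem _ hM))
    refine Eq.mp (congrArg (TwistElt D (N :: l) q 0) ?_) this
    refine (fl_tensorHom _ _ _ _ _ _ _ _).symm.trans ?_
    exact (congrArg (fl (eqToHom _ ⊗ₘ _) 0) (fl_leftUnitor_inv _ 0 _)).symm

/-- The canonical isomorphism `u_M ≅ 1(q)` inserts units at all places other than that of `M`, so
generators become pure tensors as in `TwistElt`. -/
lemma twistElt_genIso (M : NormalOfIndex p G) (q : NormalOfIndex p G → ℕ) (hM : q M = 1)
    (hq : ∀ N, N ≠ M → q N = 0) {s : ℤ} {g : ((uN k D M).X s).V} (hg : GenPred D M s g) :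
    ∀ (l : List (NormalOfIndex p G)) (hl : l.Nodup) (h : M ∈ l),
      TwistElt D l q s (fl (genIso k D M q hM hq l hl h).hom s g)
  | [], _, h => absurd h List.not_mem_nil
  | N :: l, hl, h => by
    rw [genIso]
    split_ifs with e
    · subst e
      have hp := (PowElt.gen (E := GenPred (k := k) D N) s g hg).cast hM.symm
      rw [show ten (𝟙_ (Cpx k G)) (uN k D N) 0 s s (zero_add s) (oneU k G) g =
        fl (λ_ (uN k D N)).inv s g from (fl_leftUnitor_inv _ s g).symm] at hp
      have := TwistElt.cons N l q s 0 s (add_zero s) _ _ hp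
        (twistElt_unitIso q l fun L hL => hq L fun e' =>
            (List.nodup_cons.1 hl).1 (by rwa [← e']))
      refine Eq.mp (congrArg (TwistElt D (N :: l) q s) ?_) this
      refine (fl_tensorHom ((λ_ (uN k D N)).inv ≫ eqToHom _) _ _ _ _ _ _ _).symm.trans ?_
      exact (congrArg (fl (_ ⊗ₘ _) s) (fl_rightUnitor_inv _ s _)).symm
    · have := TwistElt.cons N l q 0 s s (zero_add s) _ _
        ((PowElt.one (E := GenPred (k := k) D N)).cast (hq N e).symm)
        (twistElt_genIso M q hM hq hg l (List.nodup_cons.1 hl).2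
            ((List.mem_cons.1 h).resolve_left (Ne.symm e)))
      refine Eq.mp (congrArg (TwistElt D (N :: l) q s) ?_) this
      refine (fl_tensorHom _ _ _ _ _ _ _ _).symm.trans ?_
      exact (congrArg (fl (eqToHom _ ⊗ₘ _) s) (fl_leftUnitor_inv _ s _)).symm

/-- The two orders of a product lie in degrees and weights that agree only propositionally. Giving
the vector as a function of the degree lets it be compared after the transport. -/
lemma exists_ofMap_cast {s t : ℤ} {q r : NormalOfIndex p G → ℕ}
    (f : 𝟙_ (Cpx k G) ⟶ ((twistList k D D.list).X q)⟦s⟧)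
    (z : ∀ n, s = n → (((twistList k D D.list).X q).X n).V) (hz : vec f = z s rfl) (hq : q = r)
    (hs : s = t) : ∃ f' : 𝟙_ (Cpx k G) ⟶ ((twistList k D D.list).X r)⟦t⟧, ofMap D f' = ofMap D f ∧
      vec f' = fl (eqToHom (congrArg (twistList k D D.list).X hq)) t (z t hs) := by
  subst hq hs
  exact ⟨f, rfl, hz⟩

/-- The fixed element whose boundary is the defect of commutation is a homotopy between the two
products. -/
lemma ofMap_commute_or {s t : ℤ} {q r : NormalOfIndex p G → ℕ}
    (f : 𝟙_ (Cpx k G) ⟶ ((twistList k D D.list).X q)⟦s⟧)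
    (g : 𝟙_ (Cpx k G) ⟶ ((twistList k D D.list).X r)⟦t⟧)
    (h : SignComm (twistList k D D.list) (vec f) (vec g)) :
    ofMap D f * ofMap D g = ofMap D g * ofMap D f ∨
      ofMap D f * ofMap D g = -(ofMap D g * ofMap D f) := by
  obtain ⟨ε, h⟩ := h
  obtain ⟨w, hw, e⟩ := h (s + t) rfl (add_comm t s)
  obtain ⟨f', hf', hv⟩ := exists_ofMap_cast
    (chainMul (twistList k D D.list) (i := (t, r)) (j := (s, q)) g f)
    (fun n h => gmul (twistList k D D.list) n h (vec g) (vec f)) (vec_chainMul _ _ _)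
    (add_comm r q) (add_comm t s)
  have hm : vec (chainMul (twistList k D D.list) (i := (s, q)) (j := (t, r)) f g) =
      gmul (twistList k D D.list) (s + t) rfl (vec f) (vec g) := vec_chainMul _ _ _
  rw [ofMap_mul, ofMap_mul, ← hf']
  rw [← hv, ← hm] at e
  have e' := eq_add_of_sub_eq' e.symm
  rcases Int.units_eq_one_or ε with rfl | rfl
  · rw [one_smul] at e'
    exact .inl (ofMap_eq_of_vec_eq D hw e')
  · refine .inr ((ofMap_eq_of_vec_eq D (g := (-1 : k) • f') hw ?_).trans ?_)
    · rw [vec_smul, neg_one_smul, e', Units.neg_smul, one_smul]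
    · rw [ofMap_smul, neg_one_smul]

variable (k D) in
lemma generators_finite [CharP k p] : (generators k D).Finite :=
  ((Set.finite_range _).union (Set.finite_range _)).union
    ((Set.finite_range (elemC k D)).subset fun _ hx => hx.2)

variable (D) in
lemma generators_commute_or [CharP k p] {x y : TwistedRing k D} (hx : x ∈ generators k D)
    (hy : y ∈ generators k D) : x * y = y * x ∨ x * y = -(y * x) := by
  obtain ⟨N, s, f, hf, rfl⟩ := (mem_generators_iff k D x).1 hx
  obtain ⟨M, t, g, hg, rfl⟩ := (mem_generators_iff k D y).1 hy
  rw [homToRing_eq, homToRing_eq]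
  refine ofMap_commute_or _ _ ?_
  have h (N : NormalOfIndex p G) {s : ℤ} {f : 𝟙_ (Cpx k G) ⟶ (uN k D N)⟦s⟧}
      (hf : IsGeneratorMap k p (decide (p ≠ 2)) N.1 N.2.2 (D.σ N) s f) :
      TwistElt D D.list (basisWeight N) s (vec (f ≫ (weightIso D N).hom⟦s⟧')) := by
    let := Fintype.ofFinite (G ⧸ N.1)
    refine Eq.mp (congrArg (TwistElt D D.list _ s) (vec_comp f (weightIso D N).hom).symm) ?_
    exact twistElt_genIso N _ _ _ (show GenPred D N s (vec f) from hf.isGenerator) _ _ _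
  exact (h N hf).signComm (h M hg)

end
end TwistedCohomology

/-! ### Noetherianity of algebras whose generators commute up to sign. -/

namespace TwistedCohomology
/-- A ring that is finite over a noetherian commutative ring is noetherian on both sides. -/
lemma isNoetherianRing_and_op_of_finite (C : Type*) {R : Type*} [CommRing C] [IsNoetherianRing C]
    [Ring R] [Algebra C R] [Module.Finite C R] : IsNoetherianRing R ∧ IsNoetherianRing Rᵐᵒᵖ := by
  have : Module.Finite C Rᵐᵒᵖ := Module.Finite.equiv (MulOpposite.opLinearEquiv C)
  exact ⟨isNoetherian_of_tower C inferInstance, isNoetherian_of_tower C inferInstance⟩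

/-- The module is spanned by square-free monomials. A new element `g` replaces `W` by `W + gW`: the
old elements pass `g` up to sign, and `g` times `gW` falls back into `W` because `g²` is a scalar.
-/
lemma exists_fg_submodule_closed {C R : Type*} [CommRing C] [Ring R] [Algebra C R] {S : Set R}
    (hS : S.Finite) (hsq : ∀ x ∈ S, ∃ c : C, x ^ 2 = algebraMap C R c)
    (hcomm : ∀ x ∈ S, ∀ y ∈ S, x * y = y * x ∨ x * y = -(y * x)) :
    ∃ W : Submodule C R, W.FG ∧ 1 ∈ W ∧ ∀ x ∈ S, ∀ w ∈ W, x * w ∈ W := by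
  induction S, hS using Set.Finite.induction_on with
  | empty => exact ⟨Submodule.span C {1}, Submodule.fg_span_singleton 1,
      Submodule.mem_span_singleton_self 1, by simp⟩
  | @insert g S _ _ ih =>
    obtain ⟨W, hW, h1, hx⟩ := ih (fun x h => hsq x (Or.inr h))
      fun x hx y hy => hcomm x (Or.inr hx) y (Or.inr hy)
    have hmem {w : R} (hw : w ∈ W) : g * w ∈ W.map (LinearMap.mulLeft C g) :=
      Submodule.mem_map_of_mem hw
    refine ⟨W ⊔ W.map (LinearMap.mulLeft C g), hW.sup (hW.map _), Submodule.mem_sup_left h1, ?_⟩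
    intro x hxS w hw
    obtain ⟨a, ha, _, ⟨b, hb, rfl⟩, rfl⟩ := Submodule.mem_sup.1 hw
    rw [LinearMap.mulLeft_apply, mul_add]
    rcases hxS with rfl | hxS
    · refine add_mem (Submodule.mem_sup_right (hmem ha)) (Submodule.mem_sup_left ?_)
      obtain ⟨c, hc⟩ := hsq x (Or.inl rfl)
      rw [← mul_assoc, ← sq, hc, ← Algebra.smul_def]
      exact W.smul_mem c hb
    · refine add_mem (Submodule.mem_sup_left (hx x hxS a ha)) (Submodule.mem_sup_right ?_)
      have := hmem (hx x hxS b hb)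
      rw [← mul_assoc]
      rcases hcomm x (Or.inr hxS) g (Or.inl rfl) with h | h
      · rwa [h, mul_assoc]
      · rw [h, neg_mul, mul_assoc]
        exact neg_mem this

/-- An algebra that is generated by finitely many elements which pairwise commute up to sign is
noetherian: it is a finite module over the polynomial algebra on their squares, which are central. -/
theorem isNoetherianRing_and_op_of_adjoin {k R : Type*} [Field k] [Ring R] [Algebra k R] {S : Set R}
    (hS : S.Finite) (hadj : Algebra.adjoin k S = ⊤)
    (hcomm : ∀ x ∈ S, ∀ y ∈ S, x * y = y * x ∨ x * y = -(y * x)) :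
    IsNoetherianRing R ∧ IsNoetherianRing Rᵐᵒᵖ := by
  -- Passing `x²` through a generator produces the same sign twice.
  have hsq (x : S) : x.1 ^ 2 ∈ Subalgebra.center k R := by
    refine Subalgebra.mem_center_iff.2 fun y => ?_
    have : y ∈ Algebra.adjoin k S := hadj ▸ trivial
    suffices Commute y (x.1 ^ 2) from this
    induction this using Algebra.adjoin_induction with
    | mem y hy =>
      refine Commute.symm (?_ : x.1 ^ 2 * y = y * x.1 ^ 2)
      rcases hcomm x x.2 y hy with h | h
      · rw [sq, mul_assoc, h, ← mul_assoc, h, mul_assoc]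
      · rw [sq, mul_assoc, h, mul_neg, ← mul_assoc, h, neg_mul, neg_neg, mul_assoc]
    | algebraMap r => exact Algebra.commute_algebraMap_left r _
    | add _ _ _ _ h₁ h₂ => exact h₁.add_left h₂
    | mul _ _ _ _ h₁ h₂ => exact h₁.mul_left h₂
  have := hS.to_subtype
  let z (x : S) : Subalgebra.center k R := ⟨_, hsq x⟩
  let f : MvPolynomial S k →ₐ[k] Subalgebra.center k R := MvPolynomial.aeval z
  -- Each variable acts as the square of the corresponding generator.
  let : Algebra (MvPolynomial S k) R := ((Subalgebra.center k R).val.comp f).toRingHom.toAlgebra'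
    fun c x => ((Subalgebra.mem_center_iff.1 (f c).2) x).symm
  obtain ⟨W, hW, h1, hx⟩ := exists_fg_submodule_closed (C := MvPolynomial S k) hS (fun x hx =>
    ⟨.X ⟨x, hx⟩, (congrArg Subtype.val (MvPolynomial.aeval_X (R := k) z ⟨x, hx⟩)).symm⟩) hcomm
  -- Closure under the generators makes `W` a left ideal; since it contains `1`, it is the whole
  -- ring.
  have hW' (r w : R) (hw : w ∈ W) : r * w ∈ W := by
    have : r ∈ Algebra.adjoin k S := hadj ▸ trivial
    induction this using Algebra.adjoin_induction generalizing w with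
    | mem y hy => exact hx y hy w hw
    | algebraMap r =>
      have : algebraMap k R r = algebraMap (MvPolynomial S k) R (.C r) :=
        (congrArg Subtype.val (f.commutes r)).symm
      rw [this, ← Algebra.smul_def]
      exact W.smul_mem _ hw
    | add _ _ _ _ h₁ h₂ => rw [add_mul]; exact add_mem (h₁ w hw) (h₂ w hw)
    | mul _ _ _ _ h₁ h₂ => rw [mul_assoc]; exact h₁ _ (h₂ w hw)
  have : Module.Finite (MvPolynomial S k) R :=
    ⟨(eq_top_iff.2 fun r _ => mul_one r ▸ hW' r 1 h1 : W = ⊤) ▸ hW⟩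
  exact isNoetherianRing_and_op_of_finite (MvPolynomial S k)
end TwistedCohomology

end

theorem mainTheorem7 {k G : Type u} (p : ℕ) [Fact p.Prime] [Field k] [CharP k p] [Group G]
    [Finite G] (D : TwistedCohomology.Choices p G) :
    let S : Set (TwistedCohomology.TwistedRing k D) :=
      Set.range (TwistedCohomology.elemA k D) ∪ Set.range (TwistedCohomology.elemB k D) ∪
        {x | p ≠ 2 ∧ x ∈ Set.range (TwistedCohomology.elemC k D)}
    S.Finite ∧ Algebra.adjoin k S = ⊤ ∧ IsNoetherianRing (TwistedCohomology.TwistedRing k D) ∧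
      IsNoetherianRing (TwistedCohomology.TwistedRing k D)ᵐᵒᵖ := by
  refine ⟨?_, TwistedCohomology.adjoin_generators k D, ?_⟩
  · exact TwistedCohomology.generators_finite k D
  · exact TwistedCohomology.isNoetherianRing_and_op_of_adjoin
      (TwistedCohomology.generators_finite k D) (TwistedCohomology.adjoin_generators k D)
      fun x hx y hy => TwistedCohomology.generators_commute_or D hx hy
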